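/- **Setting.** Let $M\subset\mathbb C^4$ be a (local, embedded) real analytic CR-generic submanifold of real dimension $5$, hence of codimension $3$ and CR dimension $1$. It is of *Class III₁* if at every point the values of the local real analytic sections of $T^{1,0}M+T^{0,1}M+[T^{1,0}M,T^{0,1}M]+[T^{1,0}M,[T^{1,0}M,T^{0,1}M]]+[T^{0,1}M,[T^{1,0}M,T^{0,1}M]]$ span $\mathbb C\otimes TM$. Locally $T^{1,0}M$ has a nowhere zero real analytic generator $\mathcal L$. If $M$ is of Class III₁ and $\mathcal L$ is such a generator on $M$, put $\mathcal T=i[\mathcal L,\overline{\mathcal L}]$, $\mathcal S=[\mathcal L,\mathcal T]$; then $(\overline{\mathcal S},\mathcal S,\mathcal T,\overline{\mathcal L},\mathcal L)$ is a frame of $\mathbb C\otimes TM$, and $(\bar\sigma_0,\sigma_0,\rho_0,\bar\zeta_0,\zeta_0)$ denotes the dual coframe. Let $Q$ and $R$ be the $\mathcal S$- and $\overline{\mathcal S}$-components of $[\mathcal L,\mathcal S]$, $B$ the $\mathcal S$-component of $[\overline{\mathcal L},\mathcal S]$, and $G$ the $\overline{\mathcal S}$-component of $[\mathcal T,\mathcal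 S]$. The initial structure group $G_{III_1}$ consists of the matrices $$g=\begin{pmatrix}a\bar a\bar a&0&\bar c&\bar e&\bar d\\0&aa\bar a&c&d&e\\0&0&a\bar a&\bar b&b\\0&0&0&\bar a&0\\0&0&0&0&a\end{pmatrix},\qquad a\in\mathbb C^*,\ b,c,d,e\in\mathbb C .$$ **The seven forms.** Put $$\mathbf B_0=\tfrac i3\overline Q-iB,\qquad \mathbf C_0=\overline B,\qquad \mathbf D_0=-G-\tfrac i3Q\overline B+i\overline B^2+\tfrac i3\overline QR-iBR,\qquad \mathbf E_0=-i\,\overline{\tau},$$ where $\tau$ is the coefficient of $\bar\sigma_1\wedge\zeta_1$ in $d\rho_1$ for the coframe given by $\sigma_1=\sigma_0$, $\rho_1=\overline{\mathbf C_0}\bar\sigma_0+\mathbf C_0\sigma_0+\rho_0$, $\zeta_1=\overline{\mathbf D_0}\bar\sigma_0+\mathbf B_0\rho_0+\zeta_0$ and conjugates. On $P^7=M\times\mathbb C^*$, with fibre coordinate $a$, let $$\sigma=a^2\bar a\,\sigma_2,\quad \rho=a\bar a\,\rho_2,\quad \zeta=a\,\zeta_2,\qquad\text{with}\quad \sigma_2=\sigma_0,\quad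 \rho_2=\rho_1,\quad \zeta_2=\zeta_1+\mathbf E_0\sigma_0;$$ that is, $(\bar\sigma,\sigma,\rho,\bar\zeta,\zeta)$ is $g^{\mathsf T}$ applied to the initial coframe, with $g\in G_{III_1}$ at $b=a\mathbf B_0$, $c=a\bar a\mathbf C_0$, $d=\bar a\mathbf D_0$, $e=a\mathbf E_0$. Let $x_1,x_5,x_6,x_7$ be the coefficients of $\bar\sigma_2\wedge\sigma_2$, $\sigma_2\wedge\rho_2$, $\sigma_2\wedge\bar\zeta_2$, $\sigma_2\wedge\zeta_2$ in $d\sigma_2$, let $y_2$ be the coefficient of $\bar\sigma_2\wedge\rho_2$ in $d\rho_2$, and put $$\lambda=\frac{da}a+(x_1-y_2)\,\bar\sigma_2+\overline{(2y_2-x_1)}\,\sigma_2+\tfrac13(\bar x_5-2x_5)\,\rho_2+\tfrac13(\bar x_7-2x_6)\,\bar\zeta_2+\tfrac13(\bar x_6-2x_7)\,\zeta_2 .$$ **Theorem 3.1.** (a) Every such $M$, presented by a real analytic embedding of an open subset of $\mathbb R^5$, has a real analytic generator $\mathcal L$ of $T^{1,0}M$. Let $M$ be of Class III₁ and $\mathcal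 L$ any such generator. The seven forms $\bar\lambda,\lambda,\bar\sigma,\sigma,\rho,\bar\zeta,\zeta$ define an absolute parallelism on $P^7$: they are real analytic and form a basis of $\mathbb C\otimes T_p^*P^7$ at every $p\in P^7$; moreover $\rho$ is real. The function $R$ is real analytic, and there are real analytic functions $V_1,V_3,W_1,\dots,W_{10}$ on $M$ (thus independent of $a$) such that on $P^7$ $$\begin{aligned} d\sigma&=(2\lambda+\bar\lambda)\wedge\sigma+\tfrac{a}{\bar a^2}\overline R\,\bar\sigma\wedge\bar\zeta+\rho\wedge\zeta,\\ d\rho&=(\lambda+\bar\lambda)\wedge\rho+\tfrac1{a^2\bar a^2}V_1\,\bar\sigma\wedge\sigma+\tfrac1{\bar a^2}V_3\,\bar\sigma\wedge\bar\zeta+\tfrac1{a^2}\overline{V_3}\,\sigma\wedge\zeta+i\,\zeta\wedge\bar\zeta,\\ d\zeta&=\lambda\wedge\zeta+\tfrac1{a^2\bar a^3}W_1\,\bar\sigma\wedge\sigma+\tfrac1{a\bar a^3}W_2\,\bar\sigma\wedge\rho+\tfrac1{\bar a^3}W_3\,\bar\sigma\wedge\bar\zeta+\tfrac1{a\bar a^2}W_4\,\bar\sigma\wedge\zeta+\tfrac1{a^2\bar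 a^2}W_5\,\sigma\wedge\rho\\ &\quad+\tfrac1{a\bar a^2}W_6\,\sigma\wedge\bar\zeta+\tfrac1{a^2\bar a}W_7\,\sigma\wedge\zeta+\tfrac1{\bar a^2}W_8\,\rho\wedge\bar\zeta+\tfrac1{a\bar a}W_9\,\rho\wedge\zeta+\tfrac1{\bar a}W_{10}\,\bar\zeta\wedge\zeta, \end{aligned}\tag{1}$$ and there are real analytic functions $I_{\nu\mu}$ on $P^7$ such that $$d\lambda=\sum_{\nu,\mu}I_{\nu\mu}\,\nu\wedge\mu,\tag{2}$$ where $\nu\wedge\mu$ runs over the ten products of two distinct forms among $\bar\sigma,\sigma,\rho,\bar\zeta,\zeta$, taken in this order. (b) This reduces the local biholomorphic equivalence problem, with initial structure group $G_{III_1}$, to an $\{e\}$-structure. That is, let $M,M'$ be of Class III₁, with arbitrary generators $\mathcal L,\mathcal L'$, bundles $P,P'$, and the initial coframes and seven forms built from them; primes mark the objects of $M'$. 1. Every biholomorphism $H$ between open subsets $\Omega,\Omega'$ of $\mathbb C^4$ with $H(M\cap\Omega)=M'\cap\Omega'$ restricts to a real analytic diffeomorphism $h:M\cap\Omega\to M'\cap\Omega'$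 which is an equivalence of the initial $G_{III_1}$-structures: at each point, the pull-back by $h$ of the initial coframe of $M'$ is $g^{\mathsf T}$ applied to the initial coframe of $M$, for some $g\in G_{III_1}$. Conversely, every real analytic diffeomorphism between open subsets of $M$ and $M'$ with this last property coincides, near each point, with the restriction of such an $H$. 2. Every such $H$ lifts to a real analytic diffeomorphism $F$ from $P|_{M\cap\Omega}$ onto $P'|_{M'\cap\Omega'}$ which covers $h$, commutes with the action of $\mathbb C^*$ on the fibres by multiplication, and pulls back each of the seven forms of $P'$ to the corresponding form of $P$. Every real analytic diffeomorphism between open subsets of $P|_{M\cap\Omega}$ and $P'$ which covers $H$ and pulls back the seven forms in this way coincides with $F$ where it is defined. 3. Conversely, if a real analytic diffeomorphism between open subsets of $P$ and $P'$ pulls back each of the seven forms of $P'$ to the corresponding form of $P$, then near each point of its domain it covers the restriction to $M$ of such a biholomorphism $H$. -/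

import Mathlib

open scoped ComplexConjugate Topology Matrix

namespace ClassIII

/-! ### Complex vector fields and complex-valued differential forms -/

/-- Coordinate space of a 5-dimensional real manifold patch. -/
abbrev Base := Fin 5 → ℝ

/-- Complexified tangent vectors `∑ v k ∂/∂x_k` at a point of `Base`. -/
abbrev CVec := Fin 5 → ℂ

/-- The ambient complex space. -/
abbrev Amb := Fin 4 → ℂ

/-- The total coordinate space of the bundle (base point, fibre coordinate). -/
abbrev Tot := Base × ℂ

/-- Derivative of the complex-valued function `f` at `x` along the complex vector
`v = ∑ v k ∂/∂x_k`. -/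
noncomputable def cderiv (f : Base → ℂ) (x : Base) (v : CVec) : ℂ :=
  ∑ k, v k * fderiv ℝ f x (Pi.single k 1)

/-- Lie bracket of complex vector fields: `[V, W]_k = V(W_k) - W(V_k)`. -/
noncomputable def bracket (V W : Base → CVec) : Base → CVec := fun x k =>
  cderiv (fun y => W y k) x (V x) - cderiv (fun y => V y k) x (W x)

/-- Complex conjugate of a complex vector field. -/
noncomputable def conjField (V : Base → CVec) : Base → CVec := fun x k => conj (V x k)

/-- Exterior derivative of a complex-valued 1-form `ω`, evaluated on two tangent vectors:
`dω(X, Y) = X ω(Y) - Y ω(X)` for constant `X`, `Y`. -/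
noncomputable def dForm {F : Type*} [NormedAddCommGroup F] [NormedSpace ℝ F]
    (ω : F → F →L[ℝ] ℂ) (p : F) : F → F → ℂ := fun X Y =>
  extDeriv (fun q => ContinuousAlternatingMap.ofSubsingleton ℝ F ℂ (0 : Fin 1) (ω q)) p ![X, Y]

/-- Wedge product of two complex-valued covectors, as a bilinear form. -/
noncomputable def wedge {F : Type*} [NormedAddCommGroup F] [NormedSpace ℝ F]
    (α β : F →L[ℝ] ℂ) : F → F → ℂ := fun X Y => α X * β Y - α Y * β X

infixl:72 " ⋏ " => wedge

/-- Complex conjugate of a complex-valued 1-form. -/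
noncomputable def conjForm {F : Type*} [NormedAddCommGroup F] [NormedSpace ℝ F]
    (ω : F → F →L[ℝ] ℂ) : F → F →L[ℝ] ℂ := fun p =>
  (Complex.conjCLE : ℂ →L[ℝ] ℂ).comp (ω p)

/-- The complex bilinear extension of `dω` to complex tangent vectors of the base. -/
noncomputable def dFormC (ω : Base → Base →L[ℝ] ℂ) (x : Base) (V W : CVec) : ℂ :=
  ∑ k, ∑ l, V k * W l * dForm ω x (Pi.single k 1) (Pi.single l 1)

/-! ### Generic submanifolds of dimension 5 and Class III₁ -/

/-- A local real analytic CR-generic submanifold of dimension 5 in `ℂ⁴`, presented by a real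
analytic embedding of an open set of `ℝ⁵`. Genericity: the real tangent spaces span `ℂ⁴` over
`ℂ`; hence the codimension is 3 and the CR dimension is 1. -/
structure Patch where
  dom : Set Base
  isOpen_dom : IsOpen dom
  param : Base → Amb
  analytic : AnalyticOnNhd ℝ param dom
  embedding : Topology.IsEmbedding (dom.domRestrict param)
  immersion : ∀ x ∈ dom, Function.Injective (fderiv ℝ param x)
  generic : ∀ x ∈ dom, Submodule.span ℂ (Set.range (fderiv ℝ param x)) = ⊤

namespace Patch

/-- The submanifold itself, as a subset of `ℂ⁴`. -/
def carrier (M : Patch) : Set Amb := M.param '' M.dom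

/-- The bundle `P = M × ℂ*`. -/
def bundle (M : Patch) : Set Tot := M.dom ×ˢ {a : ℂ | a ≠ 0}

/-- `T^{1,0}M` at a point: the complex tangent vectors annihilating the restrictions to `M` of
the antiholomorphic coordinates. -/
noncomputable def T10 (M : Patch) (x : Base) : Submodule ℂ CVec where
  carrier := {v | ∀ j, cderiv (fun y => conj (M.param y j)) x v = 0}
  zero_mem' := by intro j; simp [cderiv]
  add_mem' := by
    intro v w hv hw j
    have h1 := hv j
    have h2 := hw j
    simp only [cderiv] at h1 h2 ⊢
    simp only [Pi.add_apply, add_mul, Finset.sum_add_distrib, h1, h2, add_zero]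
  smul_mem' := by
    intro c v hv j
    have h1 := hv j
    simp only [cderiv] at h1 ⊢
    simp only [Pi.smul_apply, smul_eq_mul, mul_assoc, ← Finset.mul_sum, h1, mul_zero]

/-- `X` is a real analytic section of `T^{1,0}M` near `x`. -/
def IsSection10 (M : Patch) (X : Base → CVec) (x : Base) : Prop :=
  AnalyticAt ℝ X x ∧ ∀ᶠ y in 𝓝 x, X y ∈ M.T10 y

/-- `X` is a real analytic section of `T^{0,1}M`, the conjugate of `T^{1,0}M`, near `x`. -/
def IsSection01 (M : Patch) (X : Base → CVec) (x : Base) : Prop :=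
  M.IsSection10 (conjField X) x

/-- Class III₁ (maximal minimality): at every point the values of the local sections of
`T^{1,0} + T^{0,1} + [T^{1,0}, T^{0,1}] + [T^{1,0}, [T^{1,0}, T^{0,1}]]
+ [T^{0,1}, [T^{1,0}, T^{0,1}]]` span the whole complexified tangent space. -/
def IsClassIII1 (M : Patch) : Prop :=
  ∀ x ∈ M.dom, Submodule.span ℂ
    ({v | ∃ X, M.IsSection10 X x ∧ v = X x} ∪
      {v | ∃ X, M.IsSection01 X x ∧ v = X x} ∪
      {v | ∃ X Y, M.IsSection10 X x ∧ M.IsSection01 Y x ∧ v = bracket X Y x} ∪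
      {v | ∃ X Y Z, M.IsSection10 X x ∧ M.IsSection10 Y x ∧ M.IsSection01 Z x ∧
        v = bracket X (bracket Y Z) x} ∪
      {v | ∃ X Y Z, M.IsSection01 X x ∧ M.IsSection10 Y x ∧ M.IsSection01 Z x ∧
        v = bracket X (bracket Y Z) x}) = (⊤ : Submodule ℂ CVec)

/-- `L` is a real analytic generator of `T^{1,0}M`. -/
def IsGenerator (M : Patch) (L : Base → CVec) : Prop :=
  AnalyticOnNhd ℝ L M.dom ∧ ∀ x ∈ M.dom, L x ≠ 0 ∧ M.T10 x = Submodule.span ℂ {L x}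

end Patch

/-! ### The initial frame, coframe and structure functions -/

/-- `T = i [L, L̄]`. -/
noncomputable def fieldT (L : Base → CVec) : Base → CVec := fun x =>
  Complex.I • bracket L (conjField L) x

/-- `S = [L, T]`. -/
noncomputable def fieldS (L : Base → CVec) : Base → CVec := bracket L (fieldT L)

/-- The frame `(S̄, S, T, L̄, L)`, in this order. -/
noncomputable def frame (L : Base → CVec) : Fin 5 → Base → CVec :=
  ![conjField (fieldS L), fieldS L, fieldT L, conjField L, L]

/-- The matrix whose columns are the members of the frame. -/
noncomputable def frameMatrix (L : Base → CVec) (x : Base) : Matrix (Fin 5) (Fin 5) ℂ :=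
  Matrix.of fun k i => frame L i x k

/-- The `i`-th component of the vector `v` at `x` in the frame. -/
noncomputable def comp (L : Base → CVec) (x : Base) (v : CVec) (i : Fin 5) : ℂ :=
  ((frameMatrix L x)⁻¹ *ᵥ v) i

/-- The initial coframe `(σ̄₀, σ₀, ρ₀, ζ̄₀, ζ₀)`, dual to the frame. -/
noncomputable def coframe₀ (L : Base → CVec) (i : Fin 5) : Base → Base →L[ℝ] ℂ := fun x =>
  ∑ k, (frameMatrix L x)⁻¹ i k • Complex.ofRealCLM.comp (ContinuousLinearMap.proj k)

/-- `Q` is the `S`-component of `[L, S]`. -/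
noncomputable def fnQ (L : Base → CVec) (x : Base) : ℂ := comp L x (bracket L (fieldS L) x) 1

/-- `R` is the `S̄`-component of `[L, S]`. -/
noncomputable def fnR (L : Base → CVec) (x : Base) : ℂ := comp L x (bracket L (fieldS L) x) 0

/-- `B` is the `S`-component of `[L̄, S]`. -/
noncomputable def fnB (L : Base → CVec) (x : Base) : ℂ :=
  comp L x (bracket (conjField L) (fieldS L) x) 1

/-- `G` is the `S̄`-component of `[T, S]`. -/
noncomputable def fnG (L : Base → CVec) (x : Base) : ℂ :=
  comp L x (bracket (fieldT L) (fieldS L) x) 0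

/-! ### The initial structure group and the lifted coframe -/

/-- The matrix acting on frames, with parameters `a, b, c, d, e`. -/
def groupMatrix (a b c d e : ℂ) : Matrix (Fin 5) (Fin 5) ℂ :=
  !![a * conj a * conj a, 0, conj c, conj e, conj d;
     0, a * a * conj a, c, d, e;
     0, 0, a * conj a, conj b, b;
     0, 0, 0, conj a, 0;
     0, 0, 0, 0, a]

/-- The initial structure group `G_{III₁}`. -/
def GIII1 : Set (Matrix (Fin 5) (Fin 5) ℂ) :=
  {g | ∃ a b c d e : ℂ, a ≠ 0 ∧ g = groupMatrix a b c d e}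

/-- The coframe `(σ̄, σ, ρ, ζ̄, ζ)` on the base obtained from the initial coframe by the
transposed group matrix with `a = 1` and with functions `b, c, d, e` as parameters. -/
noncomputable def adapted (L : Base → CVec) (b c d e : Base → ℂ) (i : Fin 5) :
    Base → Base →L[ℝ] ℂ := fun x =>
  ∑ j, (groupMatrix 1 (b x) (c x) (d x) (e x))ᵀ i j • coframe₀ L j x

/-- The frame dual to `adapted L b c d e`. -/
noncomputable def adaptedFrame (L : Base → CVec) (b c d e : Base → ℂ) (i : Fin 5) :
    Base → CVec := fun x =>
  ∑ j, (groupMatrix 1 (b x) (c x) (d x) (e x))⁻¹ i j • frame L j x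

/-- For `i < j`, the coefficient of `θ_i ∧ θ_j` in `dθ_k`, where `θ = adapted L b c d e`. -/
noncomputable def torsion (L : Base → CVec) (b c d e : Base → ℂ) (k i j : Fin 5)
    (x : Base) : ℂ :=
  dFormC (adapted L b c d e k) x (adaptedFrame L b c d e i x) (adaptedFrame L b c d e j x)

/-! ### Normalization of the group parameters -/

/-- Normalization `b = a B₀`. -/
noncomputable def normB (L : Base → CVec) (x : Base) : ℂ :=
  Complex.I / 3 * conj (fnQ L x) - Complex.I * fnB L x

/-- Normalization `c = a ā C₀`. -/
noncomputable def normC (L : Base → CVec) (x : Base) : ℂ := conj (fnB L x)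

/-- Normalization `d = ā D₀`. -/
noncomputable def normD (L : Base → CVec) (x : Base) : ℂ :=
  -fnG L x - Complex.I / 3 * fnQ L x * conj (fnB L x) + Complex.I * conj (fnB L x) ^ 2
    + Complex.I / 3 * conj (fnQ L x) * fnR L x - Complex.I * fnB L x * fnR L x

/-- Normalization `e = a E₀`: it makes the coefficient of `σ̄ ∧ ζ` in `dρ` vanish. That
coefficient is `T / (a ā) + i ē / (a ā²)`, where `T` is the coefficient of `σ̄₁ ∧ ζ₁` in `dρ₁`
for the coframe obtained from the first three normalizations (and `a = 1`, `e = 0`). -/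
noncomputable def normE (L : Base → CVec) (x : Base) : ℂ :=
  -Complex.I * conj (torsion L (normB L) (normC L) (normD L) 0 2 0 4 x)

/-- The coframe `(σ̄₂, σ₂, ρ₂, ζ̄₂, ζ₂)` on the base after all normalizations. -/
noncomputable def reduced (L : Base → CVec) : Fin 5 → Base → Base →L[ℝ] ℂ :=
  adapted L (normB L) (normC L) (normD L) (normE L)

/-- The coefficients in the exterior derivatives of the reduced coframe. -/
noncomputable def redTorsion (L : Base → CVec) : Fin 5 → Fin 5 → Fin 5 → Base → ℂ :=
  torsion L (normB L) (normC L) (normD L) (normE L)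

/-- The coefficients of the last absorption: they are the unique solution of
`2 A + B̄ = X₁`, `A + B̄ = Y₂`, `2 C + C̄ = -X₅`, `2 D + Ē = -X₆`, `2 E + D̄ = -X₇`, where
`X₁, X₅, X₆, X₇` are the coefficients of `σ̄ ∧ σ`, `σ ∧ ρ`, `σ ∧ ζ̄`, `σ ∧ ζ` in `dσ` and `Y₂` is
the coefficient of `σ̄ ∧ ρ` in `dρ`. -/
noncomputable def absorption (L : Base → CVec) (x : Base) : Fin 5 → ℂ :=
  ![redTorsion L 1 0 1 x - redTorsion L 2 0 2 x,
    conj (2 * redTorsion L 2 0 2 x - redTorsion L 1 0 1 x),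
    (conj (redTorsion L 1 1 2 x) - 2 * redTorsion L 1 1 2 x) / 3,
    (conj (redTorsion L 1 1 4 x) - 2 * redTorsion L 1 1 3 x) / 3,
    (conj (redTorsion L 1 1 3 x) - 2 * redTorsion L 1 1 4 x) / 3]

/-! ### The seven 1-forms on the bundle -/

/-- The lifted coframe on `P`, i.e. the transposed matrix of an element of `G_{III₁}` applied
to the initial coframe, at the normalized values of the group parameters. -/
noncomputable def lifted (L : Base → CVec) (i : Fin 5) : Tot → Tot →L[ℝ] ℂ := fun p =>
  ∑ j, (groupMatrix p.2 (p.2 * normB L p.1) (p.2 * conj p.2 * normC L p.1)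
      (conj p.2 * normD L p.1) (p.2 * normE L p.1))ᵀ i j •
    (coframe₀ L j p.1).comp (ContinuousLinearMap.fst ℝ Base ℂ)

noncomputable def sigma (L : Base → CVec) : Tot → Tot →L[ℝ] ℂ := lifted L 1

noncomputable def rho (L : Base → CVec) : Tot → Tot →L[ℝ] ℂ := lifted L 2

noncomputable def zeta (L : Base → CVec) : Tot → Tot →L[ℝ] ℂ := lifted L 4

/-- `λ = da / a +` a linear combination of `σ̄, σ, ρ, ζ̄, ζ`. -/
noncomputable def lam (L : Base → CVec) : Tot → Tot →L[ℝ] ℂ := fun p =>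
  p.2⁻¹ • ContinuousLinearMap.snd ℝ Base ℂ +
    ∑ i, absorption L p.1 i • (reduced L i p.1).comp (ContinuousLinearMap.fst ℝ Base ℂ)

/-- The five forms `(σ̄, σ, ρ, ζ̄, ζ)` on `P`. -/
noncomputable def fiveForms (L : Base → CVec) : Fin 5 → Tot → Tot →L[ℝ] ℂ :=
  ![conjForm (sigma L), sigma L, rho L, conjForm (zeta L), zeta L]

/-- The seven forms `(λ̄, λ, σ̄, σ, ρ, ζ̄, ζ)` on `P`. -/
noncomputable def sevenForms (L : Base → CVec) : Fin 7 → Tot → Tot →L[ℝ] ℂ :=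
  ![conjForm (lam L), lam L, conjForm (sigma L), sigma L, rho L, conjForm (zeta L), zeta L]

/-- Complex-valued forms `Θ` define an absolute parallelism on the open set `s`: they are real
analytic and form a basis of the complexified cotangent space at every point of `s`. -/
def IsAbsoluteParallelism {n : ℕ} (Θ : Fin n → Tot → Tot →L[ℝ] ℂ) (s : Set Tot) : Prop :=
  (∀ i, AnalyticOnNhd ℝ (Θ i) s) ∧ ∀ p ∈ s, LinearIndependent ℂ (fun i => Θ i p) ∧
    Submodule.span ℂ (Set.range fun i => Θ i p) = ⊤

/-! ### Equivalences -/

/-- `H` is a biholomorphism between open sets of `ℂ⁴` mapping `M ∩ H.source` onto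
`M' ∩ H.target`. -/
def IsBiholEquiv (M M' : Patch) (H : OpenPartialHomeomorph Amb Amb) : Prop :=
  AnalyticOnNhd ℂ H H.source ∧ AnalyticOnNhd ℂ H.symm H.target ∧ H.IsImage M.carrier M'.carrier

/-- `h` is a real analytic diffeomorphism between open parts of `M` and `M'` which matches the
initial coframes up to an element of the initial structure group at each point. -/
def IsGStructureEquiv (M M' : Patch) (L L' : Base → CVec)
    (h : OpenPartialHomeomorph Base Base) : Prop :=
  h.source ⊆ M.dom ∧ h.target ⊆ M'.dom ∧
    AnalyticOnNhd ℝ h h.source ∧ AnalyticOnNhd ℝ h.symm h.target ∧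
    ∀ x ∈ h.source, ∃ g ∈ GIII1, ∀ i,
      (coframe₀ L' i (h x)).comp (fderiv ℝ h x) = ∑ j, gᵀ i j • coframe₀ L j x

/-- `F` is a real analytic diffeomorphism between open parts of the two bundles which pulls back
the seven forms of the target to those of the source. -/
def IsParallelismEquiv (M M' : Patch) (L L' : Base → CVec)
    (F : OpenPartialHomeomorph Tot Tot) : Prop :=
  F.source ⊆ M.bundle ∧ F.target ⊆ M'.bundle ∧
    AnalyticOnNhd ℝ F F.source ∧ AnalyticOnNhd ℝ F.symm F.target ∧
    ∀ p ∈ F.source, ∀ i, (sevenForms L' i (F p)).comp (fderiv ℝ F p) = sevenForms L i p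

end ClassIII

/-! Two mechanisms carry the theorem: Cartan's reduction, which makes a coframe canonical by
normalizing its torsion, and a complexification argument, which turns a CR map into a holomorphic
one.

Reduction. Every local section of T^{1,0}M is a multiple of L, so by the Leibniz rule all brackets
allowed in Class III₁ lie in the span of S̄, S, T, L̄, L; the spanning hypothesis makes these a
frame (`Patch.IsClassIII1.good`). A torsion coefficient of an adapted coframe is minus a component
of a bracket of dual frame fields (`torsion_eq`), hence computable from [L, L̄] = -iT, [L, T] = S,
[L̄, T] = S̄, the Jacobi consequence [L̄, S] = [L, S̄], and the remaining structure functions. Four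
conditions have exactly one solution in b, c, d, e (`eq_norm_of_torsion`): no σ̄∧ζ and no σ̄∧ρ in
dσ, no σ̄∧ζ in dρ, and a relation between the ρ∧ζ coefficient in dρ and the σ∧ζ, σ∧ζ̄ coefficients
in dσ. The last relation is the compatibility which lets one form λ absorb terms of dσ and of dρ
simultaneously. On P each form is a reduced form times a monomial in a and ā, which produces the
powers of a in the structure equations (`dForm_lifted`). Since da/a is closed, dλ has base terms
only (`dForm_lam`).

Invariance. Replacing L by fL moves the initial frame by a group element with diagonal parameter f.
Because the normalization is unique, the reduced coframe is merely rescaled by monomials in f, and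
the base part of λ changes by -df/f (`reduced_smulField`, `lamBase_smulField`); this compensates the
change a ↦ af of fibre coordinate. A map h carrying the line of L to the line of L' becomes an exact
relation after L is multiplied by the function `scale`, and every construction is natural for
related fields. Therefore (x, a) ↦ (h x, a · scale) preserves the seven forms, and the equation for
ζ alone already forces this fibre component.

Extension. An equivalence of the initial structures, or of the parallelisms, has a base map sending
the line of L to that of L'. Complexify the embedding of M and the map into M' to holomorphic maps Φ
and f near a real point of ℂ⁵. At real points the kernel of dΦ is spanned by the conjugate of L, and
df kills it because the map is CR. Holomorphic functions vanishing at real points vanish nearby, so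
f is constant along the fibres of Φ and factors through it (`exists_holomorphic_extension`).
Genericity of M' makes the factor locally biholomorphic, and the embedding property excludes other
sheets of M and M' (`exists_isBiholEquiv`). -/

namespace ClassIII

/-! ### Calculus of complex vector fields -/

/-- The complex linear extension of a complex-valued real linear form to complex vectors. -/
noncomputable def cext (ω : Base →L[ℝ] ℂ) : CVec →ₗ[ℂ] ℂ where
  toFun v := ∑ k, v k * ω (Pi.single k 1)
  map_add' v w := by simp [add_mul, Finset.sum_add_distrib]
  map_smul' c v := by simp [mul_assoc, Finset.mul_sum]

theorem cext_apply (ω : Base →L[ℝ] ℂ) (v : CVec) : cext ω v = ∑ k, v k * ω (Pi.single k 1) := rfl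

theorem cderiv_eq_cext (f : Base → ℂ) (x : Base) (v : CVec) :
    cderiv f x v = cext (fderiv ℝ f x) v := rfl

theorem cext_add (ω η : Base →L[ℝ] ℂ) (v : CVec) : cext (ω + η) v = cext ω v + cext η v := by
  simp [cext_apply, mul_add, Finset.sum_add_distrib]

theorem cext_smul (c : ℂ) (ω : Base →L[ℝ] ℂ) (v : CVec) : cext (c • ω) v = c * cext ω v := by
  simp [cext_apply, Finset.mul_sum, mul_left_comm]

theorem cext_sum {ι : Type*} (s : Finset ι) (ω : ι → Base →L[ℝ] ℂ) (v : CVec) :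
    cext (∑ i ∈ s, ω i) v = ∑ i ∈ s, cext (ω i) v := by
  simp only [cext_apply, _root_.sum_apply, Finset.mul_sum]
  exact Finset.sum_comm

/-- A real vector as a complex vector. -/
def toC (v : Base) : CVec := fun k => (v k : ℂ)

theorem cext_toC (ω : Base →L[ℝ] ℂ) (v : Base) : cext ω (toC v) = ω v := by
  conv_rhs => rw [pi_eq_sum_univ' v]
  simp [cext_apply, toC, map_sum]

theorem cext_injective {ω η : Base →L[ℝ] ℂ} (h : ∀ v, cext ω v = cext η v) : ω = η := by
  ext v
  rw [← cext_toC, ← cext_toC, h]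

/-- The complex-valued coordinate functions. -/
noncomputable def coordC (k : Fin 5) : Base →L[ℝ] ℂ :=
  Complex.ofRealCLM.comp (ContinuousLinearMap.proj k)

section cderiv

variable {f g : Base → ℂ} {x : Base} {V W : Base → CVec}

theorem cderiv_congr (h : f =ᶠ[𝓝 x] g) (v : CVec) : cderiv f x v = cderiv g x v := by
  simp [cderiv_eq_cext, h.fderiv_eq]

theorem cderiv_add_vec (f : Base → ℂ) (x : Base) (v w : CVec) :
    cderiv f x (v + w) = cderiv f x v + cderiv f x w := (cext _).map_add v w

theorem cderiv_smul_vec (f : Base → ℂ) (x : Base) (c : ℂ) (v : CVec) :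
    cderiv f x (c • v) = c * cderiv f x v := (cext _).map_smul c v

theorem cderiv_sum_vec {ι : Type*} (s : Finset ι) (f : Base → ℂ) (x : Base) (v : ι → CVec) :
    cderiv f x (∑ i ∈ s, v i) = ∑ i ∈ s, cderiv f x (v i) := map_sum (cext _) v s

@[simp] theorem cderiv_const (c : ℂ) (x : Base) (v : CVec) : cderiv (fun _ => c) x v = 0 := by
  simp [cderiv]

theorem cderiv_sub (hf : DifferentiableAt ℝ f x) (hg : DifferentiableAt ℝ g x) (v : CVec) :
    cderiv (fun y => f y - g y) x v = cderiv f x v - cderiv g x v := by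
  rw [cderiv_eq_cext, fderiv_fun_sub hf hg]
  simp [cderiv_eq_cext, cext_apply, mul_sub]

theorem cderiv_mul (hf : DifferentiableAt ℝ f x) (hg : DifferentiableAt ℝ g x) (v : CVec) :
    cderiv (fun y => f y * g y) x v = f x * cderiv g x v + g x * cderiv f x v := by
  rw [cderiv_eq_cext, fderiv_fun_mul hf hg, cext_add, cext_smul, cext_smul]
  rfl

theorem cderiv_sum {ι : Type*} (s : Finset ι) {f : ι → Base → ℂ}
    (hf : ∀ i ∈ s, DifferentiableAt ℝ (f i) x) (v : CVec) :
    cderiv (fun y => ∑ i ∈ s, f i y) x v = ∑ i ∈ s, cderiv (f i) x v := by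
  rw [cderiv_eq_cext, fderiv_fun_sum hf, cext_sum]
  rfl

theorem fderiv_conj (hf : DifferentiableAt ℝ f x) :
    fderiv ℝ (fun y => conj (f y)) x = (Complex.conjCLE : ℂ →L[ℝ] ℂ).comp (fderiv ℝ f x) :=
  ((Complex.conjCLE : ℂ →L[ℝ] ℂ).hasFDerivAt.comp x hf.hasFDerivAt).fderiv

theorem cderiv_conj (hf : DifferentiableAt ℝ f x) (v : CVec) :
    cderiv (fun y => conj (f y)) x (fun k => conj (v k)) = conj (cderiv f x v) := by
  simp [cderiv, fderiv_conj hf]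

theorem analyticAt_conj : AnalyticAt ℝ f x → AnalyticAt ℝ (fun y => conj (f y)) x := fun h =>
  ((Complex.conjCLE : ℂ →L[ℝ] ℂ).analyticAt _).comp h

theorem analyticAt_fderiv_apply {E F : Type*} [NormedAddCommGroup E] [NormedSpace ℝ E]
    [NormedAddCommGroup F] [NormedSpace ℝ F] [CompleteSpace F] {f : E → F} {x : E}
    (hf : AnalyticAt ℝ f x) (v : E) : AnalyticAt ℝ (fun y => fderiv ℝ f y v) x :=
  ((ContinuousLinearMap.apply ℝ F v).analyticAt _).comp hf.fderiv

theorem analyticAt_cderiv (hf : AnalyticAt ℝ f x) (hV : AnalyticAt ℝ V x) :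
    AnalyticAt ℝ (fun y => cderiv f y (V y)) x := by
  unfold cderiv
  exact Finset.analyticAt_fun_sum _ fun k _ =>
    (analyticAt_pi_iff.1 hV k).mul (analyticAt_fderiv_apply hf _)

theorem analyticAt_bracket (hV : AnalyticAt ℝ V x) (hW : AnalyticAt ℝ W x) :
    AnalyticAt ℝ (bracket V W) x :=
  analyticAt_pi_iff.2 fun k => (analyticAt_cderiv (analyticAt_pi_iff.1 hW k) hV).sub
    (analyticAt_cderiv (analyticAt_pi_iff.1 hV k) hW)

theorem analyticAt_conjField (hV : AnalyticAt ℝ V x) : AnalyticAt ℝ (conjField V) x :=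
  analyticAt_pi_iff.2 fun k => analyticAt_conj (analyticAt_pi_iff.1 hV k)

/-- Symmetry of the second derivative; it is what removes second-order terms from commutators. -/
theorem fderiv_symm (hf : AnalyticAt ℝ f x) (v w : Base) :
    fderiv ℝ (fun y => fderiv ℝ f y v) x w = fderiv ℝ (fun y => fderiv ℝ f y w) x v := by
  have h : ∀ u : Base, fderiv ℝ (fun y => fderiv ℝ f y u) x =
      (ContinuousLinearMap.apply ℝ ℂ u).comp (fderiv ℝ (fderiv ℝ f) x) := fun u =>
    ((ContinuousLinearMap.apply ℝ ℂ u).hasFDerivAt.comp x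
      hf.fderiv.differentiableAt.hasFDerivAt).fderiv
  rw [h, h]
  have := (hf.contDiffAt (n := ⊤)).isSymmSndFDerivAt_of_omega
  exact this w v

/-- The bracket acts on functions as the commutator. -/
theorem cderiv_bracket (hf : AnalyticAt ℝ f x) (hV : AnalyticAt ℝ V x) (hW : AnalyticAt ℝ W x) :
    cderiv f x (bracket V W x) =
      cderiv (fun y => cderiv f y (W y)) x (V x) - cderiv (fun y => cderiv f y (V y)) x (W x) := by
  -- The Leibniz rule splits U f into a part with second derivatives of f and a part differentiating
  -- the coefficients of U. The former is symmetric in V and W and cancels; the latter is the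
  -- bracket.
  have key : ∀ {U : Base → CVec}, AnalyticAt ℝ U x → ∀ v : CVec,
      cderiv (fun y => cderiv f y (U y)) x v =
        (∑ k, U x k * cderiv (fun y => fderiv ℝ f y (Pi.single k 1)) x v) +
          ∑ k, cderiv (fun y => U y k) x v * fderiv ℝ f x (Pi.single k 1) := by
    intro U hU v
    have hd : ∀ k, DifferentiableAt ℝ (fun y => U y k) x := fun k =>
      (analyticAt_pi_iff.1 hU k).differentiableAt
    have hd' : ∀ k : Fin 5, DifferentiableAt ℝ (fun y => fderiv ℝ f y (Pi.single k 1)) x :=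
      fun k => (analyticAt_fderiv_apply hf _).differentiableAt
    have e : (fun y => cderiv f y (U y)) =
        fun y => ∑ k, U y k * fderiv ℝ f y (Pi.single k 1) := rfl
    rw [e, cderiv_sum (f := fun k y => U y k * fderiv ℝ f y (Pi.single k 1)) _
      (fun k _ => (hd k).mul (hd' k)) v]
    rw [← Finset.sum_add_distrib]
    refine Finset.sum_congr rfl fun k _ => ?_
    rw [cderiv_mul (hd k) (hd' k), mul_comm (fderiv ℝ f x (Pi.single k 1))]
  rw [key hV, key hW]
  have hs : ∑ k, W x k * cderiv (fun y => fderiv ℝ f y (Pi.single k 1)) x (V x) =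
      ∑ k, V x k * cderiv (fun y => fderiv ℝ f y (Pi.single k 1)) x (W x) := by
    simp only [cderiv, Finset.mul_sum]
    rw [Finset.sum_comm]
    refine Finset.sum_congr rfl fun k _ => Finset.sum_congr rfl fun l _ => ?_
    rw [fderiv_symm hf]
    ring
  rw [hs]
  simp only [cderiv_eq_cext f, cext_apply, bracket, sub_mul, Finset.sum_sub_distrib]
  ring

end cderiv

/-! ### Leibniz rules, conjugation and the Jacobi identity for the bracket. -/

section bracket

variable {U V W V' W' : Base → CVec} {x : Base} {f g : Base → ℂ}

theorem bracket_congr (hV : V =ᶠ[𝓝 x] V') (hW : W =ᶠ[𝓝 x] W') :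
    bracket V W x = bracket V' W' x := by
  funext k
  simp only [bracket]
  rw [hV.eq_of_nhds, hW.eq_of_nhds,
    cderiv_congr (f := fun y => W y k) (g := fun y => W' y k) (hW.mono fun y h => by simp [h]),
    cderiv_congr (f := fun y => V y k) (g := fun y => V' y k) (hV.mono fun y h => by simp [h])]

theorem bracket_anticomm (V W : Base → CVec) (x : Base) : bracket V W x = -bracket W V x := by
  funext k
  simp [bracket]

@[simp] theorem bracket_self (V : Base → CVec) (x : Base) : bracket V V x = 0 := by
  funext k
  simp [bracket]

theorem bracket_sum_right {ι : Type*} (s : Finset ι) {a : ι → Base → ℂ} {E : ι → Base → CVec}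
    (ha : ∀ i, DifferentiableAt ℝ (a i) x) (hE : ∀ i, DifferentiableAt ℝ (E i) x) :
    bracket V (fun y => ∑ i ∈ s, a i y • E i y) x =
      ∑ i ∈ s, (a i x • bracket V (E i) x + cderiv (a i) x (V x) • E i x) := by
  have hE' : ∀ i k, DifferentiableAt ℝ (fun y => E i y k) x := fun i k =>
    differentiableAt_pi.1 (hE i) k
  funext k
  simp only [bracket, Finset.sum_apply, Pi.smul_apply, smul_eq_mul, Pi.add_apply]
  rw [cderiv_sum s (f := fun i y => a i y * E i y k) (fun i _ => (ha i).mul (hE' i k)),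
    cderiv_sum_vec, ← Finset.sum_sub_distrib]
  refine Finset.sum_congr rfl fun i _ => ?_
  rw [cderiv_mul (ha i) (hE' i k), cderiv_smul_vec]
  ring

theorem bracket_smul_right (hf : DifferentiableAt ℝ f x) (hW : DifferentiableAt ℝ W x) :
    bracket V (fun y => f y • W y) x = f x • bracket V W x + cderiv f x (V x) • W x := by
  simpa using bracket_sum_right (V := V) (x := x) (Finset.univ : Finset (Fin 1))
    (a := fun _ => f) (E := fun _ => W) (fun _ => hf) (fun _ => hW)

theorem bracket_smul_left (hf : DifferentiableAt ℝ f x) (hV : DifferentiableAt ℝ V x) :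
    bracket (fun y => f y • V y) W x = f x • bracket V W x - cderiv f x (W x) • V x := by
  rw [bracket_anticomm, bracket_smul_right hf hV, bracket_anticomm W V]
  simp [sub_eq_add_neg, add_comm]

theorem bracket_smul_smul (hf : DifferentiableAt ℝ f x) (hg : DifferentiableAt ℝ g x)
    (hV : DifferentiableAt ℝ V x) (hW : DifferentiableAt ℝ W x) :
    bracket (fun y => f y • V y) (fun y => g y • W y) x =
      (f x * g x) • bracket V W x + (f x * cderiv g x (V x)) • W x
        - (g x * cderiv f x (W x)) • V x := by
  rw [bracket_smul_left hf hV, bracket_smul_right hg hW, cderiv_smul_vec]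
  module

/-- Leibniz in both arguments. It reduces torsion in any adapted frame to structure functions of the
initial frame and derivatives of the group parameters. -/
theorem bracket_sum_sum {ι : Type*} [Fintype ι] {a b : ι → Base → ℂ} {E : ι → Base → CVec}
    (ha : ∀ i, DifferentiableAt ℝ (a i) x) (hb : ∀ i, DifferentiableAt ℝ (b i) x)
    (hE : ∀ i, DifferentiableAt ℝ (E i) x) :
    bracket (fun y => ∑ i, a i y • E i y) (fun y => ∑ i, b i y • E i y) x =
      ∑ i, ∑ j, (a i x * b j x) • bracket (E i) (E j) x
        + ∑ j, cderiv (b j) x (∑ i, a i x • E i x) • E j x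
        - ∑ i, cderiv (a i) x (∑ j, b j x • E j x) • E i x := by
  rw [bracket_sum_right _ hb hE, Finset.sum_add_distrib, Finset.sum_comm, add_sub_right_comm]
  congr 1
  have : ∀ j, bracket (fun y => ∑ i, a i y • E i y) (E j) x =
      ∑ i, (a i x • bracket (E i) (E j) x - cderiv (a i) x (E j x) • E i x) := by
    intro j
    rw [bracket_anticomm, bracket_sum_right _ ha hE, ← Finset.sum_neg_distrib]
    refine Finset.sum_congr rfl fun i _ => ?_
    rw [bracket_anticomm (E j)]
    module
  simp only [this, Finset.smul_sum, smul_sub, Finset.sum_sub_distrib, cderiv_sum_vec,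
    cderiv_smul_vec, Finset.sum_smul, smul_smul]
  congr 1
  · refine Finset.sum_congr rfl fun j _ => Finset.sum_congr rfl fun i _ => ?_
    rw [mul_comm]
  · rw [Finset.sum_comm]

/-- The coordinates are real, so conjugation passes through derivatives along a complex vector
provided the vector is conjugated too. -/
theorem bracket_conj (hV : DifferentiableAt ℝ V x) (hW : DifferentiableAt ℝ W x) :
    bracket (conjField V) (conjField W) x = conjField (bracket V W) x := by
  funext k
  simp only [bracket, conjField, map_sub]
  rw [← cderiv_conj (differentiableAt_pi.1 hV k), ← cderiv_conj (differentiableAt_pi.1 hW k)]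
  rfl

theorem conjField_conjField (V : Base → CVec) : conjField (conjField V) = V := by
  funext x k
  simp [conjField]

/-- Jacobi identity. -/
theorem bracket_jacobi (hU : AnalyticAt ℝ U x) (hV : AnalyticAt ℝ V x) (hW : AnalyticAt ℝ W x) :
    bracket U (bracket V W) x = bracket (bracket U V) W x + bracket V (bracket U W) x := by
  funext k
  have aU := analyticAt_pi_iff.1 hU k
  have aV := analyticAt_pi_iff.1 hV k
  have aW := analyticAt_pi_iff.1 hW k
  simp only [Pi.add_apply]
  simp only [bracket.eq_1 U (bracket V W), bracket.eq_1 V (bracket U W),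
    bracket.eq_1 (bracket U V) W]
  rw [cderiv_bracket aU hV hW, cderiv_bracket aW hU hV, cderiv_bracket aV hU hW]
  simp only [bracket]
  rw [cderiv_sub (analyticAt_cderiv aW hV).differentiableAt
      (analyticAt_cderiv aV hW).differentiableAt,
    cderiv_sub (analyticAt_cderiv aV hU).differentiableAt
      (analyticAt_cderiv aU hV).differentiableAt,
    cderiv_sub (analyticAt_cderiv aW hU).differentiableAt
      (analyticAt_cderiv aU hW).differentiableAt]
  ring

end bracket

/-! ### Push-forward by a map -/

/-- The complexified differential of `h`. -/
noncomputable def push (h : Base → Base) (x : Base) : CVec →ₗ[ℂ] CVec where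
  toFun v k := cderiv (fun y => ((h y k : ℝ) : ℂ)) x v
  map_add' v w := by funext k; exact cderiv_add_vec _ _ _ _
  map_smul' c v := by funext k; exact cderiv_smul_vec _ _ _ _

theorem push_apply (h : Base → Base) (x : Base) (v : CVec) (k : Fin 5) :
    push h x v k = cderiv (fun y => ((h y k : ℝ) : ℂ)) x v := rfl

theorem fderiv_ofReal_coord {h : Base → Base} {x : Base} (hh : DifferentiableAt ℝ h x)
    (k : Fin 5) (v : Base) :
    fderiv ℝ (fun y => ((h y k : ℝ) : ℂ)) x v = ((fderiv ℝ h x v k : ℝ) : ℂ) := by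
  have e : HasFDerivAt (fun y => ((h y k : ℝ) : ℂ))
      ((coordC k).comp (fderiv ℝ h x)) x :=
    (coordC k).hasFDerivAt.comp x
      hh.hasFDerivAt
  rw [e.fderiv]
  simp [coordC]

/-- Pull-back of forms is dual to the complexified differential; this is used to test identities of
pulled-back forms on complex vectors. -/
theorem cext_comp {h : Base → Base} {x : Base} (hh : DifferentiableAt ℝ h x)
    (ω : Base →L[ℝ] ℂ) (v : CVec) : cext (ω.comp (fderiv ℝ h x)) v = cext ω (push h x v) := by
  have : push h x v = ∑ k, v k • toC (fderiv ℝ h x (Pi.single k 1)) := by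
    funext j
    simp [push_apply, cderiv, fderiv_ofReal_coord hh, toC]
  rw [this, map_sum]
  simp [cext_toC, cext_apply (ω.comp _)]

theorem cderiv_comp {h : Base → Base} {f : Base → ℂ} {x : Base}
    (hf : DifferentiableAt ℝ f (h x)) (hh : DifferentiableAt ℝ h x) (v : CVec) :
    cderiv (fun y => f (h y)) x v = cderiv f (h x) (push h x v) := by
  have e : fderiv ℝ (fun y => f (h y)) x = _ := fderiv_comp x hf hh
  rw [cderiv_eq_cext, e, cext_comp hh]
  rfl

theorem push_conj {h : Base → Base} {x : Base} (hh : DifferentiableAt ℝ h x) (v : CVec) :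
    push h x (fun k => conj (v k)) = fun k => conj (push h x v k) := by
  funext k
  rw [push_apply, push_apply, ← cderiv_conj]
  · simp
  · exact (coordC k).differentiableAt.comp x hh

/-- `V'` is `h`-related to `V` near `x`. -/
def Related (h : Base → Base) (V V' : Base → CVec) (x : Base) : Prop :=
  ∀ᶠ y in 𝓝 x, V' (h y) = push h y (V y)

/-- Apply the commutator formula to the coordinate functions of h. Relatedness is imposed on a
neighbourhood because the bracket differentiates the fields. -/
theorem Related.bracket {h : Base → Base} {V V' W W' : Base → CVec} {x : Base}
    (hh : AnalyticAt ℝ h x) (hV : AnalyticAt ℝ V x) (hW : AnalyticAt ℝ W x)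
    (hV' : AnalyticAt ℝ V' (h x)) (hW' : AnalyticAt ℝ W' (h x))
    (rV : Related h V V' x) (rW : Related h W W' x) :
    Related h (bracket V W) (bracket V' W') x := by
  have hc : ContinuousAt h x := hh.continuousAt
  filter_upwards [hh.eventually_analyticAt, hV.eventually_analyticAt, hW.eventually_analyticAt,
    hc.eventually hV'.eventually_analyticAt, hc.eventually hW'.eventually_analyticAt,
    rV.eventually_nhds, rW.eventually_nhds] with y hh hV hW hV' hW' rV rW
  funext k
  have hk : AnalyticAt ℝ (fun y => ((h y k : ℝ) : ℂ)) y :=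
    ((coordC k).analyticAt _).comp hh
  rw [push_apply, cderiv_bracket hk hV hW]
  simp only [ClassIII.bracket]
  rw [rV.self_of_nhds, rW.self_of_nhds,
    ← cderiv_comp (analyticAt_pi_iff.1 hW' k).differentiableAt hh.differentiableAt,
    ← cderiv_comp (analyticAt_pi_iff.1 hV' k).differentiableAt hh.differentiableAt]
  congr 1
  · exact cderiv_congr (rW.mono fun z hz => by simp [hz, push_apply]) _
  · exact cderiv_congr (rV.mono fun z hz => by simp [hz, push_apply]) _

theorem Related.conj {h : Base → Base} {V V' : Base → CVec} {x : Base}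
    (hh : AnalyticAt ℝ h x) (rV : Related h V V' x) :
    Related h (conjField V) (conjField V') x := by
  filter_upwards [hh.eventually_analyticAt, rV] with y hh rV
  have := push_conj hh.differentiableAt (V y)
  unfold conjField
  rw [this, rV]

theorem Related.smul {h : Base → Base} {V V' : Base → CVec} {x : Base} (c : ℂ)
    (rV : Related h V V' x) : Related h (fun y => c • V y) (fun y => c • V' y) x := by
  filter_upwards [rV] with y rV
  rw [rV, map_smul]

end ClassIII

namespace ClassIII

/-! ### Analyticity of determinants and inverses -/

section matrix

variable {E : Type*} [NormedAddCommGroup E] [NormedSpace ℝ E] {n : Type*} [Fintype n]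
  [DecidableEq n] {A : E → Matrix n n ℂ} {x : E}

theorem analyticAt_det (hA : ∀ i j, AnalyticAt ℝ (fun y => A y i j) x) :
    AnalyticAt ℝ (fun y => (A y).det) x := by
  simp only [Matrix.det_apply, Units.smul_def, zsmul_eq_mul]
  exact Finset.analyticAt_fun_sum _ fun σ _ =>
    analyticAt_const.mul (Finset.analyticAt_fun_prod _ fun i _ => hA _ _)

/-- Cramer's rule: an entry of the inverse is a quotient of determinants. -/
theorem analyticAt_matrix_inv (hA : ∀ i j, AnalyticAt ℝ (fun y => A y i j) x)
    (h0 : (A x).det ≠ 0) (i j : n) : AnalyticAt ℝ (fun y => (A y)⁻¹ i j) x := by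
  simp only [Matrix.inv_def, Matrix.smul_apply, Ring.inverse_eq_inv', smul_eq_mul,
    Matrix.adjugate_apply]
  refine ((analyticAt_det hA).inv h0).mul (analyticAt_det fun k l => ?_)
  by_cases hk : k = j
  · subst hk
    simpa using analyticAt_const
  · simpa [Matrix.updateRow_ne hk] using hA k l

end matrix

/-! ### Existence of generators -/

/-- The generalized cross product of the rows of a `4 × 5` matrix. -/
noncomputable def cross (B : Matrix (Fin 4) (Fin 5) ℂ) : CVec := fun k =>
  (-1) ^ (k : ℕ) * (B.submatrix id k.succAbove).det

/-- Adding a first row to a `4 × 5` matrix. -/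
def rowCons (r : CVec) (B : Matrix (Fin 4) (Fin 5) ℂ) : Matrix (Fin 5) (Fin 5) ℂ :=
  Matrix.of fun i k => Fin.cases (r k) (fun j => B j k) i

theorem rowCons_zero (r : CVec) (B : Matrix (Fin 4) (Fin 5) ℂ) (k : Fin 5) :
    rowCons r B 0 k = r k := rfl

theorem rowCons_succ (r : CVec) (B : Matrix (Fin 4) (Fin 5) ℂ) (j : Fin 4) (k : Fin 5) :
    rowCons r B j.succ k = B j k := rfl

theorem det_rowCons (B : Matrix (Fin 4) (Fin 5) ℂ) (r : CVec) :
    (rowCons r B).det = ∑ k, r k * cross B k := by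
  rw [Matrix.det_succ_row_zero]
  refine Finset.sum_congr rfl fun k _ => ?_
  have : (rowCons r B).submatrix Fin.succ k.succAbove = B.submatrix id k.succAbove := rfl
  rw [this, rowCons_zero, cross]
  ring

/-- Each component is a determinant with a repeated row. -/
theorem mulVec_cross (B : Matrix (Fin 4) (Fin 5) ℂ) : B *ᵥ cross B = 0 := by
  funext j
  have h := det_rowCons B (B j)
  rw [Matrix.det_zero_of_row_eq (i := 0) (j := j.succ) (Fin.succ_ne_zero j).symm rfl] at h
  simpa [Matrix.mulVec, dotProduct] using h.symm

theorem exists_ker_generator {B : Matrix (Fin 4) (Fin 5) ℂ}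
    (hB : Function.Surjective fun v => B *ᵥ v) :
    ∃ v : CVec, v ≠ 0 ∧ ∀ w, B *ᵥ w = 0 → ∃ c : ℂ, w = c • v := by
  have hr : LinearMap.range B.mulVecLin = ⊤ := LinearMap.range_eq_top.2 hB
  have h := B.mulVecLin.finrank_range_add_finrank_ker
  rw [hr, finrank_top] at h
  have h1 : Module.finrank ℂ (LinearMap.ker B.mulVecLin) = 1 := by
    simp at h
    omega
  obtain ⟨v, hv, hw⟩ := finrank_eq_one_iff'.1 h1
  refine ⟨v, fun h => hv (Subtype.ext h), fun w hw' => ?_⟩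
  obtain ⟨c, hc⟩ := hw ⟨w, by simpa using hw'⟩
  exact ⟨c, by simpa using (congrArg Subtype.val hc).symm⟩

/-- Adjoin as first row the conjugate of a generator v of the kernel. A null vector of the enlarged
matrix is a multiple c v with c‖v‖² = 0 in the Hermitian norm, hence zero, so the enlarged
determinant does not vanish. -/
theorem cross_ne_zero {B : Matrix (Fin 4) (Fin 5) ℂ}
    (hB : Function.Surjective fun v => B *ᵥ v) : cross B ≠ 0 := by
  obtain ⟨v, hv, hw⟩ := exists_ker_generator hB
  intro h0
  have h := det_rowCons B (fun k => conj (v k))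
  simp only [h0, Pi.zero_apply, mul_zero, Finset.sum_const_zero] at h
  obtain ⟨w, hw0, hw1⟩ := Matrix.exists_mulVec_eq_zero_iff.2 h
  obtain ⟨c, rfl⟩ := hw w (by
    funext j
    simpa only [Matrix.mulVec, dotProduct, rowCons_succ, Pi.zero_apply] using congrFun hw1 j.succ)
  have h2 := congrFun hw1 0
  simp only [Matrix.mulVec, dotProduct, rowCons_zero, Pi.smul_apply, smul_eq_mul,
    Pi.zero_apply] at h2
  have h3 : c * ((∑ k, ‖v k‖ ^ 2 : ℝ) : ℂ) = 0 := by
    rw [← h2]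
    push_cast
    rw [Finset.mul_sum]
    refine Finset.sum_congr rfl fun k _ => ?_
    rw [← Complex.conj_mul']
    ring
  rcases mul_eq_zero.1 h3 with h | h
  · exact hw0 (by simp [h])
  · apply hv
    have h4 := Complex.ofReal_eq_zero.1 h
    rw [Finset.sum_eq_zero_iff_of_nonneg fun k _ => by positivity] at h4
    funext k
    simpa using h4 k (Finset.mem_univ k)

theorem mem_span_cross {B : Matrix (Fin 4) (Fin 5) ℂ}
    (hB : Function.Surjective fun v => B *ᵥ v) {w : CVec} (h : B *ᵥ w = 0) :
    ∃ c : ℂ, w = c • cross B := by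
  obtain ⟨v, -, hw⟩ := exists_ker_generator hB
  obtain ⟨c, hc⟩ := hw _ (mulVec_cross B)
  obtain ⟨d, hd⟩ := hw _ h
  have : c ≠ 0 := fun h => cross_ne_zero hB (by simp [hc, h])
  exact ⟨d * c⁻¹, by rw [hc, smul_smul, mul_assoc, inv_mul_cancel₀ this, mul_one, hd]⟩

/-- A complex linear map with the given values on the standard real basis. -/
theorem mulVec_toC (A : Base →L[ℝ] Amb) (v : Base) :
    (Matrix.of fun (j : Fin 4) (k : Fin 5) => A (Pi.single k 1) j) *ᵥ toC v = A v := by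
  conv_rhs => rw [pi_eq_sum_univ' v]
  funext j
  simp [Matrix.mulVec, dotProduct, toC, map_sum, mul_comm]

theorem mulVec_surjective_of_span {A : Base →L[ℝ] Amb}
    (h : Submodule.span ℂ (Set.range A) = ⊤) :
    Function.Surjective fun v =>
      (Matrix.of fun (j : Fin 4) (k : Fin 5) => A (Pi.single k 1) j) *ᵥ v := by
  have : LinearMap.range
      (Matrix.of fun (j : Fin 4) (k : Fin 5) => A (Pi.single k 1) j).mulVecLin = ⊤ := by
    rw [eq_top_iff, ← h, Submodule.span_le]
    rintro _ ⟨v, rfl⟩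
    exact ⟨toC v, mulVec_toC A v⟩
  exact LinearMap.range_eq_top.1 this

namespace Patch

variable (M : Patch)

/-- The conjugate Jacobian matrix of the embedding. -/
noncomputable def conjJac (x : Base) : Matrix (Fin 4) (Fin 5) ℂ :=
  Matrix.of fun j k => conj (fderiv ℝ M.param x (Pi.single k 1) j)

variable {M} {x : Base}

theorem fderiv_param_coord (hx : x ∈ M.dom) (j : Fin 4) (v : Base) :
    fderiv ℝ (fun y => M.param y j) x v = fderiv ℝ M.param x v j := by
  have h := ((M.analytic x hx).differentiableAt).hasFDerivAt
  have := (hasFDerivAt_pi'.1 h) j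
  rw [this.fderiv]
  rfl

theorem analyticAt_param_coord (hx : x ∈ M.dom) (j : Fin 4) :
    AnalyticAt ℝ (fun y => M.param y j) x := analyticAt_pi_iff.1 (M.analytic x hx) j

theorem conjJac_mulVec (hx : x ∈ M.dom) (v : CVec) (j : Fin 4) :
    (M.conjJac x *ᵥ v) j = cderiv (fun y => conj (M.param y j)) x v := by
  simp only [Matrix.mulVec, dotProduct, conjJac, Matrix.of_apply, cderiv]
  refine Finset.sum_congr rfl fun k _ => ?_
  rw [fderiv_conj (analyticAt_param_coord hx j).differentiableAt]
  simp [fderiv_param_coord hx, mul_comm]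

theorem mem_T10_iff (hx : x ∈ M.dom) (v : CVec) : v ∈ M.T10 x ↔ M.conjJac x *ᵥ v = 0 := by
  rw [funext_iff]
  simp only [conjJac_mulVec hx]
  rfl

/-- Conjugate of genericity. It forces the CR dimension to be 5 - 4 = 1. -/
theorem conjJac_surjective (hx : x ∈ M.dom) : Function.Surjective fun v => M.conjJac x *ᵥ v := by
  intro w
  obtain ⟨v, hv⟩ := mulVec_surjective_of_span (M.generic x hx) (fun j => conj (w j))
  refine ⟨fun k => conj (v k), ?_⟩
  funext j
  have := congrArg (starRingEnd ℂ) (congrFun hv j)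
  simpa [Matrix.mulVec, dotProduct, conjJac] using this

-- The cross product of the rows of the conjugate Jacobian spans its kernel and depends analytically
-- on the point, so it is a generator on the whole patch.
variable (M) in
theorem exists_generator : ∃ L, M.IsGenerator L := by
  refine ⟨fun x => cross (M.conjJac x), fun x hx => ?_, fun x hx => ⟨?_, ?_⟩⟩
  · refine analyticAt_pi_iff.2 fun k => analyticAt_const.mul (analyticAt_det fun i j => ?_)
    exact analyticAt_conj (analyticAt_pi_iff.1 (analyticAt_fderiv_apply (M.analytic x hx) _) i)
  · exact cross_ne_zero (conjJac_surjective hx)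
  · refine le_antisymm (fun v hv => ?_) ?_
    · obtain ⟨c, hc⟩ := mem_span_cross (conjJac_surjective hx) ((mem_T10_iff hx v).1 hv)
      exact Submodule.mem_span_singleton.2 ⟨c, hc.symm⟩
    · rw [Submodule.span_singleton_le_iff_mem, mem_T10_iff hx]
      exact mulVec_cross _

end Patch

/-! ### The frame of a Class III₁ manifold -/

/-- `L` is analytic and generates a frame on the open set `U`. -/
structure Good (L : Base → CVec) (U : Set Base) : Prop where
  isOpen : IsOpen U
  analytic : AnalyticOnNhd ℝ L U
  det_ne : ∀ x ∈ U, (frameMatrix L x).det ≠ 0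

section frame

variable {L : Base → CVec} {x : Base}

theorem analyticAt_fieldT (h : AnalyticAt ℝ L x) : AnalyticAt ℝ (fieldT L) x :=
  (analyticAt_bracket h (analyticAt_conjField h)).const_smul (c := Complex.I)

theorem analyticAt_fieldS (h : AnalyticAt ℝ L x) : AnalyticAt ℝ (fieldS L) x :=
  analyticAt_bracket h (analyticAt_fieldT h)

theorem analyticAt_frame (h : AnalyticAt ℝ L x) (i : Fin 5) : AnalyticAt ℝ (frame L i) x := by
  fin_cases i
  · exact analyticAt_conjField (analyticAt_fieldS h)
  · exact analyticAt_fieldS h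
  · exact analyticAt_fieldT h
  · exact analyticAt_conjField h
  · exact h

theorem analyticAt_frameMatrix (h : AnalyticAt ℝ L x) (i j : Fin 5) :
    AnalyticAt ℝ (fun y => frameMatrix L y i j) x :=
  analyticAt_pi_iff.1 (analyticAt_frame h j) i

theorem bracket_L_conjL (x : Base) : bracket L (conjField L) x = -Complex.I • fieldT L x := by
  simp [fieldT, smul_smul]

theorem conjField_fieldT (h : AnalyticAt ℝ L x) : conjField (fieldT L) x = fieldT L x := by
  have e := bracket_conj h.differentiableAt (analyticAt_conjField h).differentiableAt
  rw [conjField_conjField, bracket_anticomm] at e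
  funext k
  have e' := congrFun e k
  simp only [conjField, Pi.neg_apply] at e'
  simp only [conjField, fieldT, Pi.smul_apply, smul_eq_mul, map_mul, Complex.conj_I]
  rw [← e']
  ring

/-- Conjugate of the definition of S, since T is a real field near the point. -/
theorem bracket_conjL_T (h : AnalyticAt ℝ L x) :
    bracket (conjField L) (fieldT L) x = conjField (fieldS L) x := by
  rw [fieldS, ← bracket_conj h.differentiableAt (analyticAt_fieldT h).differentiableAt]
  refine bracket_congr (Filter.EventuallyEq.refl _ _) ?_
  filter_upwards [h.eventually_analyticAt] with y hy
  exact (conjField_fieldT hy).symm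

theorem span_frame_eq_range (L : Base → CVec) (x : Base) :
    Submodule.span ℂ (Set.range fun i => frame L i x) =
      LinearMap.range (frameMatrix L x).mulVecLin := by
  rw [Matrix.range_mulVecLin]
  rfl

theorem det_frameMatrix_ne_zero_iff : (frameMatrix L x).det ≠ 0 ↔
    Submodule.span ℂ (Set.range fun i => frame L i x) = ⊤ := by
  rw [span_frame_eq_range, LinearMap.range_eq_top, ← isUnit_iff_ne_zero,
    ← Matrix.isUnit_iff_isUnit_det, ← Matrix.mulVec_surjective_iff_isUnit]
  rfl

end frame

namespace Patch

variable {M : Patch} {L : Base → CVec} {x : Base}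

/-- The coefficient is a quotient of components at an index where L does not vanish; this exhibits
it as analytic. -/
theorem IsSection10.eq_smul (hL : M.IsGenerator L) (hx : x ∈ M.dom) {X : Base → CVec}
    (hX : M.IsSection10 X x) :
    ∃ f : Base → ℂ, AnalyticAt ℝ f x ∧ ∀ᶠ y in 𝓝 x, X y = f y • L y := by
  obtain ⟨k, hk⟩ : ∃ k, L x k ≠ 0 := by
    by_contra! h
    exact (hL.2 x hx).1 (funext h)
  have hLk := analyticAt_pi_iff.1 (hL.1 x hx) k
  refine ⟨fun y => X y k / L y k, (analyticAt_pi_iff.1 hX.1 k).div hLk hk, ?_⟩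
  filter_upwards [hX.2, hLk.continuousAt.eventually_ne hk, M.isOpen_dom.mem_nhds hx] with y h1 h2 h3
  rw [(hL.2 y h3).2] at h1
  obtain ⟨c, hc⟩ := Submodule.mem_span_singleton.1 h1
  rw [← hc]
  simp [h2]

theorem IsSection01.eq_smul (hL : M.IsGenerator L) (hx : x ∈ M.dom) {X : Base → CVec}
    (hX : M.IsSection01 X x) :
    ∃ f : Base → ℂ, AnalyticAt ℝ f x ∧ ∀ᶠ y in 𝓝 x, X y = f y • conjField L y := by
  obtain ⟨f, hf, h⟩ := IsSection10.eq_smul hL hx hX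
  refine ⟨fun y => conj (f y), analyticAt_conj hf, ?_⟩
  filter_upwards [h] with y hy
  funext k
  have := congrArg (starRingEnd ℂ) (congrFun hy k)
  simpa [conjField] using this

/-- Each generating vector in the definition of the class lies in the span F of the five frame
vectors, so these already span. In length-three brackets the derivative terms produce only T, L and
L̄. -/
theorem IsClassIII1.good (hM : M.IsClassIII1) (hL : M.IsGenerator L) : Good L M.dom := by
  refine ⟨M.isOpen_dom, hL.1, fun x hx => ?_⟩
  rw [det_frameMatrix_ne_zero_iff, eq_top_iff, ← hM x hx, Submodule.span_le]
  have aL := hL.1 x hx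
  have dL := aL.differentiableAt
  have dLb := (analyticAt_conjField aL).differentiableAt
  have aT := analyticAt_fieldT aL
  set F := Submodule.span ℂ (Set.range fun i => frame L i x) with hF
  have m : ∀ i, frame L i x ∈ F := fun i => Submodule.subset_span ⟨i, rfl⟩
  have mL : L x ∈ F := m 4
  have mLb : conjField L x ∈ F := m 3
  have mT : fieldT L x ∈ F := m 2
  have mS : fieldS L x ∈ F := m 1
  have mSb : conjField (fieldS L) x ∈ F := m 0
  have mB : bracket L (conjField L) x ∈ F := by
    rw [bracket_L_conjL]
    exact F.smul_mem _ mT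
  -- The inner bracket must be written with analytic coefficients on a neighbourhood, because the
  -- outer bracket differentiates them.
  have key : ∀ {Y Z : Base → CVec}, M.IsSection10 Y x → M.IsSection01 Z x →
      ∃ a : Fin 3 → Base → ℂ, (∀ i, AnalyticAt ℝ (a i) x) ∧ ∀ᶠ y in 𝓝 x,
        bracket Y Z y = ∑ i, a i y • (![fieldT L, L, conjField L] : Fin 3 → Base → CVec) i y := by
    intro Y Z hY hZ
    obtain ⟨f, hf, hY'⟩ := hY.eq_smul hL hx
    obtain ⟨g, hg, hZ'⟩ := IsSection01.eq_smul hL hx hZ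
    refine ⟨![fun y => -Complex.I * (f y * g y), fun y => -(g y * cderiv f y (conjField L y)),
      fun y => f y * cderiv g y (L y)], ?_, ?_⟩
    · intro i
      fin_cases i
      · exact analyticAt_const.mul (hf.mul hg)
      · exact (hg.mul (analyticAt_cderiv hf (analyticAt_conjField aL))).neg
      · exact hf.mul (analyticAt_cderiv hg aL)
    · filter_upwards [hY'.eventually_nhds, hZ'.eventually_nhds, aL.eventually_analyticAt,
        hf.eventually_analyticAt, hg.eventually_analyticAt] with y h1 h2 h3 h4 h5
      rw [bracket_congr h1 h2, bracket_smul_smul h4.differentiableAt h5.differentiableAt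
        h3.differentiableAt (analyticAt_conjField h3).differentiableAt, bracket_L_conjL]
      simp [Fin.sum_univ_three]
      module
  have key2 : ∀ {X : Base → CVec} {a : Fin 3 → Base → ℂ}, (∀ i, AnalyticAt ℝ (a i) x) →
      bracket X (fieldT L) x ∈ F → bracket X L x ∈ F → bracket X (conjField L) x ∈ F →
      bracket X (fun y => ∑ i, a i y •
        (![fieldT L, L, conjField L] : Fin 3 → Base → CVec) i y) x ∈ F := by
    intro X a ha h1 h2 h3
    rw [bracket_sum_right _ (fun i => (ha i).differentiableAt)
      (by intro i; fin_cases i; exacts [aT.differentiableAt, dL, dLb])]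
    refine F.sum_mem fun i _ => F.add_mem (F.smul_mem _ ?_) (F.smul_mem _ ?_)
    · fin_cases i <;> assumption
    · fin_cases i <;> assumption
  have swap : ∀ {V W : Base → CVec}, bracket V W x ∈ F → bracket W V x ∈ F := by
    intro V W h
    rw [bracket_anticomm]
    exact F.neg_mem h
  have zero : ∀ V, bracket V V x ∈ F := fun V => by simp
  have mS' : bracket L (fieldT L) x ∈ F := mS
  have mSb' : bracket (conjField L) (fieldT L) x ∈ F := by rwa [bracket_conjL_T aL]
  have scale : ∀ {V W X : Base → CVec} {f : Base → ℂ}, AnalyticAt ℝ f x →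
      DifferentiableAt ℝ V x → (∀ᶠ y in 𝓝 x, X y = f y • V y) → V x ∈ F →
      bracket V W x ∈ F → bracket X W x ∈ F := by
    intro V W X f hf hV hX h1 h2
    rw [bracket_congr (V' := fun y => f y • V y) hX (Filter.EventuallyEq.refl _ W),
      bracket_smul_left hf.differentiableAt hV]
    exact F.sub_mem (F.smul_mem _ h2) (F.smul_mem _ h1)
  rintro v ((((⟨X, hX, rfl⟩ | ⟨X, hX, rfl⟩) | ⟨X, Y, hX, hY, rfl⟩) | ⟨X, Y, Z, hX, hY, hZ, rfl⟩) |
    ⟨X, Y, Z, hX, hY, hZ, rfl⟩)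
  · obtain ⟨f, -, h⟩ := hX.eq_smul hL hx
    rw [h.self_of_nhds]
    exact F.smul_mem _ mL
  · obtain ⟨f, -, h⟩ := IsSection01.eq_smul hL hx hX
    rw [h.self_of_nhds]
    exact F.smul_mem _ mLb
  · obtain ⟨a, -, h⟩ := key hX hY
    rw [h.self_of_nhds]
    refine F.sum_mem fun i _ => F.smul_mem _ ?_
    fin_cases i <;> assumption
  · obtain ⟨f, hf, hX'⟩ := hX.eq_smul hL hx
    obtain ⟨a, ha, h⟩ := key hY hZ
    rw [bracket_congr (Filter.EventuallyEq.refl _ X) h]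
    have s : ∀ {W}, bracket L W x ∈ F → bracket X W x ∈ F := scale hf dL hX' mL
    exact key2 ha (s mS') (s (zero _)) (s mB)
  · obtain ⟨f, hf, hX'⟩ := IsSection01.eq_smul hL hx hX
    obtain ⟨a, ha, h⟩ := key hY hZ
    rw [bracket_congr (Filter.EventuallyEq.refl _ X) h]
    have s : ∀ {W}, bracket (conjField L) W x ∈ F → bracket X W x ∈ F := scale hf dLb hX' mLb
    exact key2 ha (s mSb') (s (swap mB)) (s (zero _))

end Patch

end ClassIII

namespace ClassIII

/-! ### Exterior derivatives -/

section dForm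

variable {F : Type*} [NormedAddCommGroup F] [NormedSpace ℝ F]

theorem dForm_apply {ω : F → F →L[ℝ] ℂ} {p : F} (hω : DifferentiableAt ℝ ω p) (X Y : F) :
    dForm ω p X Y = fderiv ℝ ω p X Y - fderiv ℝ ω p Y X := by
  have h1 : DifferentiableAt ℝ
      (fun q => ContinuousAlternatingMap.ofSubsingleton ℝ F ℂ (0 : Fin 1) (ω q)) p :=
    ((ContinuousAlternatingMap.ofSubsingletonLIE (𝕜 := ℝ) (E := F) (F := ℂ)
      (0 : Fin 1)).toContinuousLinearEquiv.differentiableAt).comp p hω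
  have h2 : ∀ X Y : F, fderiv ℝ (fun q => ω q Y) p X = fderiv ℝ ω p X Y := fun X Y => by
    rw [fderiv_clm_apply hω (differentiableAt_const Y)]
    simp
  rw [dForm, extDeriv_apply h1]
  simp [Fin.sum_univ_two, Fin.removeNth, h2, sub_eq_add_neg]

theorem dForm_add {ω η : F → F →L[ℝ] ℂ} {p : F} (hω : DifferentiableAt ℝ ω p)
    (hη : DifferentiableAt ℝ η p) :
    dForm (fun q => ω q + η q) p = dForm ω p + dForm η p := by
  funext X Y
  simp only [Pi.add_apply]
  rw [dForm_apply (hω.fun_add hη), dForm_apply hω, dForm_apply hη, fderiv_fun_add hω hη]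
  simp only [_root_.add_apply]
  ring

theorem dForm_smul {f : F → ℂ} {ω : F → F →L[ℝ] ℂ} {p : F} (hf : DifferentiableAt ℝ f p)
    (hω : DifferentiableAt ℝ ω p) :
    dForm (fun q => f q • ω q) p = fderiv ℝ f p ⋏ ω p + f p • dForm ω p := by
  funext X Y
  simp only [Pi.add_apply, Pi.smul_apply, wedge]
  rw [dForm_apply (hf.fun_smul hω), dForm_apply hω, fderiv_fun_smul hf hω]
  simp only [_root_.add_apply, _root_.smul_apply, ContinuousLinearMap.smulRight_apply,
    smul_eq_mul]
  ring

theorem dForm_comp_clm {G : Type*} [NormedAddCommGroup G] [NormedSpace ℝ G] (A : F →L[ℝ] G)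
    {ω : G → G →L[ℝ] ℂ} {p : F} (hω : DifferentiableAt ℝ ω (A p)) (X Y : F) :
    dForm (fun q => (ω (A q)).comp A) p X Y = dForm ω (A p) (A X) (A Y) := by
  have h : HasFDerivAt (fun q => (ω (A q)).comp A)
      ((ContinuousLinearMap.compL ℝ F G ℂ).flip A ∘L (fderiv ℝ ω (A p) ∘L A)) p :=
    ((ContinuousLinearMap.compL ℝ F G ℂ).flip A).hasFDerivAt.comp p
      (hω.hasFDerivAt.comp p A.hasFDerivAt)
  rw [dForm_apply h.differentiableAt, dForm_apply hω, h.fderiv]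
  simp

theorem dForm_congr {ω η : F → F →L[ℝ] ℂ} {p : F} (h : ω =ᶠ[𝓝 p] η) :
    dForm ω p = dForm η p := by
  funext X Y
  unfold dForm
  rw [Filter.EventuallyEq.extDeriv_eq (ω₂ := fun q =>
    ContinuousAlternatingMap.ofSubsingleton ℝ F ℂ (0 : Fin 1) (η q))
    (h.mono fun q hq => by simp [hq])]

end dForm

/-! ### The complex bilinear extension of the exterior derivative. -/

section dFormC

variable {ω : Base → Base →L[ℝ] ℂ} {x : Base} {V W : Base → CVec}

theorem dFormC_sum {ι : Type*} [Fintype ι] (a b : ι → ℂ) (E : ι → CVec) :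
    dFormC ω x (∑ i, a i • E i) (∑ i, b i • E i) =
      ∑ i, ∑ j, a i * b j * dFormC ω x (E i) (E j) := by
  simp only [dFormC, Finset.sum_apply, Pi.smul_apply, smul_eq_mul, Finset.sum_mul,
    Finset.mul_sum]
  have h1 : ∀ k, ∑ l : Fin 5, ∑ i, ∑ j, a i * E i k * (b j * E j l) *
      dForm ω x (Pi.single k 1) (Pi.single l 1) = ∑ i, ∑ j, ∑ l : Fin 5, a i * E i k *
      (b j * E j l) * dForm ω x (Pi.single k 1) (Pi.single l 1) := by
    intro k
    rw [Finset.sum_comm]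
    exact Finset.sum_congr rfl fun i _ => Finset.sum_comm
  calc _ = ∑ k : Fin 5, ∑ l : Fin 5, ∑ i, ∑ j, a i * E i k * (b j * E j l) *
        dForm ω x (Pi.single k 1) (Pi.single l 1) := by
        refine Finset.sum_congr rfl fun k _ => Finset.sum_congr rfl fun l _ => ?_
        rw [Finset.sum_comm]
    _ = _ := by
        simp only [h1]
        rw [Finset.sum_comm]
        refine Finset.sum_congr rfl fun i _ => ?_
        rw [Finset.sum_comm]
        refine Finset.sum_congr rfl fun j _ => Finset.sum_congr rfl fun k _ =>
          Finset.sum_congr rfl fun l _ => ?_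
        ring

theorem dForm_eq_dFormC (hω : DifferentiableAt ℝ ω x) (X Y : Base) :
    dForm ω x X Y = dFormC ω x (toC X) (toC Y) := by
  conv_lhs => rw [pi_eq_sum_univ' X, pi_eq_sum_univ' Y]
  simp only [dFormC, dForm_apply hω, map_sum, map_smul, _root_.sum_apply, _root_.smul_apply, toC,
    Complex.real_smul, mul_sub, Finset.sum_sub_distrib, Finset.mul_sum]
  congr 1
  · rw [Finset.sum_comm]
    refine Finset.sum_congr rfl fun k _ => Finset.sum_congr rfl fun l _ => ?_
    ring
  · refine Finset.sum_congr rfl fun k _ => Finset.sum_congr rfl fun l _ => ?_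
    ring

theorem dFormC_antisymm (hω : DifferentiableAt ℝ ω x) (v w : CVec) :
    dFormC ω x v w = -dFormC ω x w v := by
  simp only [dFormC, dForm_apply hω]
  rw [Finset.sum_comm, ← Finset.sum_neg_distrib]
  refine Finset.sum_congr rfl fun k _ => ?_
  rw [← Finset.sum_neg_distrib]
  refine Finset.sum_congr rfl fun l _ => ?_
  ring

/-- Cartan's formula. -/
theorem dFormC_eq (hω : DifferentiableAt ℝ ω x) (hV : DifferentiableAt ℝ V x)
    (hW : DifferentiableAt ℝ W x) :
    dFormC ω x (V x) (W x) = cderiv (fun y => cext (ω y) (W y)) x (V x) -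
      cderiv (fun y => cext (ω y) (V y)) x (W x) - cext (ω x) (bracket V W x) := by
  have h1 : ∀ v : CVec, ∀ l : Fin 5, cderiv (fun y => ω y (Pi.single l 1)) x v =
      ∑ k, v k * fderiv ℝ ω x (Pi.single k 1) (Pi.single l 1) := by
    intro v l
    refine Finset.sum_congr rfl fun k _ => ?_
    rw [fderiv_clm_apply hω (differentiableAt_const _)]
    simp
  have h2 : ∀ {U : Base → CVec}, DifferentiableAt ℝ U x → ∀ v : CVec,
      cderiv (fun y => cext (ω y) (U y)) x v = (∑ l, U x l * cderiv (fun y => ω y (Pi.single l 1)) x v)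
        + ∑ l, cderiv (fun y => U y l) x v * ω x (Pi.single l 1) := by
    intro U hU v
    have d1 : ∀ l : Fin 5, DifferentiableAt ℝ (fun y => U y l) x := differentiableAt_pi.1 hU
    have d2 : ∀ l : Fin 5, DifferentiableAt ℝ (fun y => ω y (Pi.single l 1)) x := fun l =>
      hω.clm_apply (differentiableAt_const _)
    simp only [cext_apply]
    rw [cderiv_sum (f := fun l y => U y l * ω y (Pi.single l 1)) _
      (fun l _ => (d1 l).mul (d2 l)), ← Finset.sum_add_distrib]
    refine Finset.sum_congr rfl fun l _ => ?_
    rw [cderiv_mul (d1 l) (d2 l)]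
    ring
  rw [h2 hV, h2 hW]
  simp only [h1]
  have h3 : cext (ω x) (bracket V W x) =
      (∑ l, cderiv (fun y => W y l) x (V x) * ω x (Pi.single l 1)) -
        ∑ l, cderiv (fun y => V y l) x (W x) * ω x (Pi.single l 1) := by
    simp only [cext_apply, bracket, sub_mul, Finset.sum_sub_distrib]
  rw [h3]
  simp only [dFormC, dForm_apply hω, mul_sub, Finset.sum_sub_distrib, Finset.mul_sum]
  rw [Finset.sum_comm]
  have e1 : ∀ k l : Fin 5, V x l * W x k * fderiv ℝ ω x (Pi.single l 1) (Pi.single k 1) =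
    W x k * (V x l * fderiv ℝ ω x (Pi.single l 1) (Pi.single k 1)) := fun k l => by ring
  have e2 : ∀ k l : Fin 5, V x k * W x l * fderiv ℝ ω x (Pi.single l 1) (Pi.single k 1) =
    V x k * (W x l * fderiv ℝ ω x (Pi.single l 1) (Pi.single k 1)) := fun k l => by ring
  simp only [e1, e2]
  ring

end dFormC

/-! ### The structure group -/

theorem groupMatrix_mul (a b c d e a' b' c' d' e' : ℂ) :
    groupMatrix a b c d e * groupMatrix a' b' c' d' e' =
      groupMatrix (a * a') (a * conj a * b' + b * a') (a * a * conj a * c' + c * (a' * conj a'))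
        (a * a * conj a * d' + c * conj b' + d * conj a')
        (a * a * conj a * e' + c * b' + e * a') := by
  ext i j
  fin_cases i <;> fin_cases j <;>
    simp [groupMatrix, Matrix.mul_apply, Fin.sum_univ_five, -mul_eq_mul_left_iff,
      -mul_eq_mul_right_iff] <;> ring

theorem groupMatrix_one : groupMatrix 1 0 0 0 0 = 1 := by
  ext i j
  fin_cases i <;> fin_cases j <;> simp [groupMatrix]

/-- The inverse keeps the shape of the group, so the dual frame has explicit coefficients polynomial
in the parameters and their conjugates. -/
theorem groupMatrix_inv (b c d e : ℂ) : (groupMatrix 1 b c d e)⁻¹ =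
    groupMatrix 1 (-b) (-c) (-d + c * conj b) (-e + c * b) := by
  refine Matrix.inv_eq_right_inv ?_
  rw [groupMatrix_mul, ← groupMatrix_one]
  congr 1 <;> simp

theorem groupMatrix_det (a b c d e : ℂ) : (groupMatrix a b c d e).det =
    (a * conj a * conj a) * (a * a * conj a) * (a * conj a) * conj a * a := by
  have h : (groupMatrix a b c d e).BlockTriangular id := by
    intro i j hij
    fin_cases i <;> fin_cases j <;> simp_all [groupMatrix]
  rw [Matrix.det_of_isUpperTriangular h]
  simp [Fin.prod_univ_five, groupMatrix]

theorem isUnit_groupMatrix {a : ℂ} (ha : a ≠ 0) (b c d e : ℂ) :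
    IsUnit (groupMatrix a b c d e).det := by
  rw [groupMatrix_det, isUnit_iff_ne_zero]
  simp [ha]

/-! ### Duality -/

section duality

variable {L : Base → CVec} {x : Base} {b c d e : Base → ℂ}

theorem cext_coframe₀ (L : Base → CVec) (i : Fin 5) (x : Base) (v : CVec) :
    cext (coframe₀ L i x) v = comp L x v i := by
  simp only [coframe₀, cext_sum, cext_smul, comp, Matrix.mulVec, dotProduct]
  refine Finset.sum_congr rfl fun k _ => ?_
  congr 1
  simp [cext_apply, Pi.single_apply, apply_ite Complex.ofReal]

theorem comp_frame (h : (frameMatrix L x).det ≠ 0) (i j : Fin 5) :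
    comp L x (frame L j x) i = if i = j then 1 else 0 := by
  have e : (frameMatrix L x)⁻¹ * frameMatrix L x = 1 :=
    Matrix.nonsing_inv_mul _ (isUnit_iff_ne_zero.2 h)
  have := congrFun (congrFun e i) j
  rw [Matrix.mul_apply, Matrix.one_apply] at this
  rw [← this]
  rfl

theorem sum_comp_frame (h : (frameMatrix L x).det ≠ 0) (v : CVec) :
    ∑ i, comp L x v i • frame L i x = v := by
  have e : frameMatrix L x * (frameMatrix L x)⁻¹ = 1 :=
    Matrix.mul_nonsing_inv _ (isUnit_iff_ne_zero.2 h)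
  have h2 : frameMatrix L x *ᵥ ((frameMatrix L x)⁻¹ *ᵥ v) = v := by
    rw [Matrix.mulVec_mulVec, e, Matrix.one_mulVec]
  conv_rhs => rw [← h2]
  funext k
  simp [Matrix.mulVec, dotProduct, comp, frameMatrix, mul_comm]

theorem analyticAt_coframe₀ (hL : AnalyticAt ℝ L x) (h : (frameMatrix L x).det ≠ 0) (i : Fin 5) :
    AnalyticAt ℝ (coframe₀ L i) x :=
  Finset.analyticAt_fun_sum _ fun k _ =>
    (analyticAt_matrix_inv (analyticAt_frameMatrix hL) h i k).smul analyticAt_const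

theorem analyticAt_comp (hL : AnalyticAt ℝ L x) (h : (frameMatrix L x).det ≠ 0) (i : Fin 5)
    {V : Base → CVec} (hV : AnalyticAt ℝ V x) : AnalyticAt ℝ (fun y => comp L y (V y) i) x :=
  Finset.analyticAt_fun_sum Finset.univ (f := fun k y => (frameMatrix L y)⁻¹ i k * V y k)
    fun k _ => (analyticAt_matrix_inv (analyticAt_frameMatrix hL) h i k).mul
      (analyticAt_pi_iff.1 hV k)

theorem cext_adapted (i : Fin 5) (v : CVec) : cext (adapted L b c d e i x) v =
    ∑ j, groupMatrix 1 (b x) (c x) (d x) (e x) j i * comp L x v j := by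
  simp [adapted, cext_sum, cext_smul, cext_coframe₀]

/-- The transposed matrix acts on coframes and the inverse on frames, so duality of the initial pair
is preserved. -/
theorem cext_adapted_adaptedFrame (h : (frameMatrix L x).det ≠ 0) (i j : Fin 5) :
    cext (adapted L b c d e i x) (adaptedFrame L b c d e j x) = if i = j then 1 else 0 := by
  have e' := Matrix.nonsing_inv_mul _ (isUnit_groupMatrix one_ne_zero (b x) (c x) (d x) (e x))
  have := congrFun (congrFun e' j) i
  rw [Matrix.mul_apply, Matrix.one_apply] at this
  simp only [eq_comm (a := i), ← this, cext_adapted, ← cext_coframe₀, adaptedFrame, map_sum,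
    map_smul]
  refine Finset.sum_congr rfl fun k _ => ?_
  simp [cext_coframe₀, comp_frame h, mul_comm]

theorem sum_smul_sum_of_mul_eq_one {g g' : Matrix (Fin 5) (Fin 5) ℂ} (h : g * g' = 1)
    (c : Fin 5 → ℂ) (f : Fin 5 → CVec) :
    ∑ i, (∑ j, g j i * c j) • ∑ k, g' i k • f k = ∑ j, c j • f j := by
  simp only [Finset.smul_sum, smul_smul]
  rw [Finset.sum_comm]
  refine Finset.sum_congr rfl fun k _ => ?_
  rw [← Finset.sum_smul]
  congr 1
  simp only [Finset.sum_mul]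
  rw [Finset.sum_comm]
  have : ∀ j, ∑ i, g j i * c j * g' i k = (1 : Matrix (Fin 5) (Fin 5) ℂ) j k * c j := by
    intro j
    rw [← h, Matrix.mul_apply, Finset.sum_mul]
    exact Finset.sum_congr rfl fun i _ => by ring
  simp [this, Matrix.one_apply]

theorem sum_adapted_adaptedFrame (h : (frameMatrix L x).det ≠ 0) (v : CVec) :
    ∑ i, cext (adapted L b c d e i x) v • adaptedFrame L b c d e i x = v := by
  have e' := Matrix.mul_nonsing_inv _ (isUnit_groupMatrix one_ne_zero (b x) (c x) (d x) (e x))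
  conv_rhs => rw [← sum_comp_frame h v]
  simp only [cext_adapted, adaptedFrame]
  exact sum_smul_sum_of_mul_eq_one e' _ _

theorem eq_of_cext_adapted (h : (frameMatrix L x).det ≠ 0) {v w : CVec}
    (hvw : ∀ i, cext (adapted L b c d e i x) v = cext (adapted L b c d e i x) w) : v = w := by
  rw [← sum_adapted_adaptedFrame (b := b) (c := c) (d := d) (e := e) h v,
    ← sum_adapted_adaptedFrame (b := b) (c := c) (d := d) (e := e) h w]
  simp only [hvw]

theorem analyticAt_groupMatrix {E : Type*} [NormedAddCommGroup E] [NormedSpace ℝ E] {p : E}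
    {a b c d e : E → ℂ} (ha : AnalyticAt ℝ a p) (hb : AnalyticAt ℝ b p) (hc : AnalyticAt ℝ c p)
    (hd : AnalyticAt ℝ d p) (he : AnalyticAt ℝ e p) (i j : Fin 5) :
    AnalyticAt ℝ (fun y => groupMatrix (a y) (b y) (c y) (d y) (e y) i j) p := by
  have cj : ∀ {f : E → ℂ}, AnalyticAt ℝ f p → AnalyticAt ℝ (fun y => conj (f y)) p :=
    fun h => ((Complex.conjCLE : ℂ →L[ℝ] ℂ).analyticAt _).comp h
  have ha' := cj ha
  have hb' := cj hb
  have hc' := cj hc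
  have hd' := cj hd
  have he' := cj he
  fin_cases i <;> fin_cases j <;> simp [groupMatrix] <;> fun_prop

theorem analyticAt_adapted (hL : AnalyticAt ℝ L x) (h : (frameMatrix L x).det ≠ 0)
    (hb : AnalyticAt ℝ b x) (hc : AnalyticAt ℝ c x) (hd : AnalyticAt ℝ d x)
    (he : AnalyticAt ℝ e x) (i : Fin 5) : AnalyticAt ℝ (adapted L b c d e i) x :=
  Finset.analyticAt_fun_sum _ fun j _ =>
    (analyticAt_groupMatrix analyticAt_const hb hc hd he j i).smul (analyticAt_coframe₀ hL h j)

theorem analyticAt_adaptedFrame (hL : AnalyticAt ℝ L x) 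
    (hb : AnalyticAt ℝ b x) (hc : AnalyticAt ℝ c x) (hd : AnalyticAt ℝ d x)
    (he : AnalyticAt ℝ e x) (i : Fin 5) : AnalyticAt ℝ (adaptedFrame L b c d e i) x := by
  unfold adaptedFrame
  simp only [groupMatrix_inv]
  have hb' := analyticAt_conj hb
  refine Finset.analyticAt_fun_sum _ fun j _ =>
    (analyticAt_groupMatrix analyticAt_const ?_ ?_ ?_ ?_ i j).smul (analyticAt_frame hL j)
  all_goals fun_prop

/-- The torsion coefficients in terms of brackets. -/
theorem torsion_eq (hL : AnalyticAt ℝ L x) (h : (frameMatrix L x).det ≠ 0)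
    (hb : AnalyticAt ℝ b x) (hc : AnalyticAt ℝ c x) (hd : AnalyticAt ℝ d x)
    (he : AnalyticAt ℝ e x) (k i j : Fin 5) : torsion L b c d e k i j x =
      -cext (adapted L b c d e k x)
        (bracket (adaptedFrame L b c d e i) (adaptedFrame L b c d e j) x) := by
  rw [torsion, dFormC_eq (analyticAt_adapted hL h hb hc hd he k).differentiableAt
    (analyticAt_adaptedFrame hL hb hc hd he i).differentiableAt
    (analyticAt_adaptedFrame hL hb hc hd he j).differentiableAt]
  -- The pairings are constant near the point by duality, so only the bracket term of Cartan's
  -- formula survives.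
  have key : ∀ j : Fin 5, ∀ v : CVec, cderiv (fun y => cext (adapted L b c d e k y)
      (adaptedFrame L b c d e j y)) x v = 0 := by
    intro j v
    rw [cderiv_congr (g := fun _ => if k = j then 1 else 0), cderiv_const]
    filter_upwards [(analyticAt_det (analyticAt_frameMatrix hL)).continuousAt.eventually_ne h]
      with y hy
    exact cext_adapted_adaptedFrame hy k j
  rw [key, key]
  ring

theorem sum_antisymm (t : Fin 5 → Fin 5 → ℂ) (ht : ∀ i j, t i j = -t j i) (a b : Fin 5 → ℂ) :
    ∑ i, ∑ j, a i * b j * t i j =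
      ∑ i, ∑ j ∈ Finset.Ioi i, t i j * (a i * b j - b i * a j) := by
  have h0 : ∀ i, t i i = 0 := fun i => by
    have := ht i i
    linear_combination this / 2
  have i0 : Finset.Ioi (0 : Fin 5) = {1, 2, 3, 4} := by decide
  have i1 : Finset.Ioi (1 : Fin 5) = {2, 3, 4} := by decide
  have i2 : Finset.Ioi (2 : Fin 5) = {3, 4} := by decide
  have i3 : Finset.Ioi (3 : Fin 5) = {4} := by decide
  have i4 : Finset.Ioi (4 : Fin 5) = ∅ := by decide
  simp [Fin.sum_univ_five, i0, i1, i2, i3, i4, h0]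
  rw [ht 1 0, ht 2 0, ht 3 0, ht 4 0, ht 2 1, ht 3 1, ht 4 1, ht 3 2, ht 4 2, ht 4 3]
  ring

/-- Expand both arguments in the dual frame and fold the antisymmetric double sum. Although the
frame is complex, it may be evaluated on real vectors through the bilinear extension. -/
theorem dForm_adapted {ω : Base → Base →L[ℝ] ℂ} (h : (frameMatrix L x).det ≠ 0)
    (hω : DifferentiableAt ℝ ω x) (X Y : Base) :
    dForm ω x X Y = ∑ i, ∑ j ∈ Finset.Ioi i,
      dFormC ω x (adaptedFrame L b c d e i x) (adaptedFrame L b c d e j x) *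
        (adapted L b c d e i x ⋏ adapted L b c d e j x) X Y := by
  rw [dForm_eq_dFormC hω]
  conv_lhs => rw [← sum_adapted_adaptedFrame (b := b) (c := c) (d := d) (e := e) h (toC X),
    ← sum_adapted_adaptedFrame (b := b) (c := c) (d := d) (e := e) h (toC Y)]
  rw [dFormC_sum, sum_antisymm _ (fun i j => dFormC_antisymm hω _ _)]
  simp only [cext_toC, wedge]

end duality

end ClassIII

namespace ClassIII

/-! ### Structure functions -/

theorem conj_three : conj (3 : ℂ) = 3 := map_ofNat _ 3

theorem conj_bracket {V W V' W' : Base → CVec} {x : Base} (hV : DifferentiableAt ℝ V x)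
    (hW : DifferentiableAt ℝ W x) (eV : conjField V =ᶠ[𝓝 x] V') (eW : conjField W =ᶠ[𝓝 x] W') :
    (fun l => conj (bracket V W x l)) = bracket V' W' x := by
  rw [← bracket_congr eV eW, bracket_conj hV hW]
  rfl

/-- The structure functions of the initial frame. -/
noncomputable def structFn (L : Base → CVec) (i j k : Fin 5) (x : Base) : ℂ :=
  comp L x (bracket (frame L i) (frame L j) x) k

/-- The permutation of indices induced by complex conjugation. -/
def conjIdx : Fin 5 → Fin 5 := ![1, 0, 2, 4, 3]

theorem conjIdx_conjIdx (i : Fin 5) : conjIdx (conjIdx i) = i := by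
  fin_cases i <;> rfl

theorem sum_conjIdx {M : Type*} [AddCommMonoid M] (f : Fin 5 → M) :
    ∑ i, f (conjIdx i) = ∑ i, f i :=
  Equiv.sum_comp (⟨conjIdx, conjIdx, conjIdx_conjIdx, conjIdx_conjIdx⟩ : Fin 5 ≃ Fin 5) f

theorem conj_groupMatrix (b c d e : ℂ) (i j : Fin 5) :
    conj (groupMatrix 1 b c d e i j) = groupMatrix 1 b c d e (conjIdx i) (conjIdx j) := by
  fin_cases i <;> fin_cases j <;> simp [groupMatrix, conjIdx]

section

variable {L : Base → CVec} {x : Base} {b c d e : Base → ℂ}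

theorem conjField_frame (hL : AnalyticAt ℝ L x) (i : Fin 5) :
    conjField (frame L i) x = frame L (conjIdx i) x := by
  fin_cases i
  · exact congrFun (conjField_conjField (fieldS L)) x
  · rfl
  · exact conjField_fieldT hL
  · exact congrFun (conjField_conjField L) x
  · rfl

theorem comp_sum_frame (h : (frameMatrix L x).det ≠ 0) (a : Fin 5 → ℂ) (k : Fin 5) :
    comp L x (∑ i, a i • frame L i x) k = a k := by
  rw [← cext_coframe₀, map_sum]
  simp [cext_coframe₀, comp_frame h]

theorem conj_comp (hL : AnalyticAt ℝ L x) (h : (frameMatrix L x).det ≠ 0) (v : CVec)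
    (k : Fin 5) : conj (comp L x v k) = comp L x (fun l => conj (v l)) (conjIdx k) := by
  have : (fun l => conj (v l)) =
      ∑ i, conj (comp L x v (conjIdx i)) • frame L i x := by
    rw [← sum_conjIdx]
    conv_lhs => rw [← sum_comp_frame h v]
    funext l
    simp only [Finset.sum_apply, Pi.smul_apply, smul_eq_mul, map_sum, map_mul, conjIdx_conjIdx]
    refine Finset.sum_congr rfl fun i _ => ?_
    rw [← conjField_frame hL]
    rfl
  rw [this, comp_sum_frame h, conjIdx_conjIdx]

theorem differentiableAt_frame (hL : AnalyticAt ℝ L x) (i : Fin 5) :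
    DifferentiableAt ℝ (frame L i) x := (analyticAt_frame hL i).differentiableAt

/-- The frame is closed under conjugation up to the index permutation, and the bracket is real. -/
theorem conj_structFn (hL : AnalyticAt ℝ L x) (h : (frameMatrix L x).det ≠ 0) (i j k : Fin 5) :
    conj (structFn L i j k x) = structFn L (conjIdx i) (conjIdx j) (conjIdx k) x := by
  rw [structFn, conj_comp hL h, structFn]
  rw [conj_bracket (differentiableAt_frame hL i) (differentiableAt_frame hL j)
    (hL.eventually_analyticAt.mono fun y hy => conjField_frame hy i)
    (hL.eventually_analyticAt.mono fun y hy => conjField_frame hy j)]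

theorem structFn_antisymm (i j k : Fin 5) : structFn L i j k x = -structFn L j i k x := by
  rw [structFn, bracket_anticomm, structFn, ← cext_coframe₀, ← cext_coframe₀, map_neg]

theorem structFn_self (i k : Fin 5) : structFn L i i k x = 0 := by
  have := structFn_antisymm (L := L) (x := x) i i k
  linear_combination this / 2

theorem structFn_4_3 (h : (frameMatrix L x).det ≠ 0) (k : Fin 5) :
    structFn L 4 3 k x = if k = 2 then -Complex.I else 0 := by
  have : bracket (frame L 4) (frame L 3) x = -Complex.I • frame L 2 x := bracket_L_conjL x
  rw [structFn, this, ← cext_coframe₀, map_smul, cext_coframe₀, comp_frame h]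
  split_ifs <;> simp

theorem structFn_4_2 (h : (frameMatrix L x).det ≠ 0) (k : Fin 5) :
    structFn L 4 2 k x = if k = 1 then 1 else 0 :=
  comp_frame h k 1

theorem structFn_3_2 (hL : AnalyticAt ℝ L x) (h : (frameMatrix L x).det ≠ 0) (k : Fin 5) :
    structFn L 3 2 k x = if k = 0 then 1 else 0 := by
  have : bracket (frame L 3) (frame L 2) x = frame L 0 x := bracket_conjL_T hL
  rw [structFn, this, comp_frame h]

/-- `[L̄, S] = [L, S̄]`. -/
theorem bracket_conjL_S (hL : AnalyticAt ℝ L x) :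
    bracket (conjField L) (fieldS L) x = bracket L (conjField (fieldS L)) x := by
  have h := bracket_jacobi (analyticAt_conjField hL) hL (analyticAt_fieldT hL)
  -- The inner bracket is iT, which commutes with T; Jacobi then equates the two remaining terms.
  have h1 : bracket (bracket (conjField L) L) (fieldT L) x = 0 := by
    rw [bracket_congr (V' := fun y => Complex.I • fieldT L y) (W' := fieldT L)
      (Filter.Eventually.of_forall fun y => by
        rw [bracket_anticomm, bracket_L_conjL]; simp) (Filter.EventuallyEq.refl _ _),
      bracket_smul_left (f := fun _ => Complex.I) (differentiableAt_const _)
        (analyticAt_fieldT hL).differentiableAt]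
    simp
  have h2 : bracket L (bracket (conjField L) (fieldT L)) x =
      bracket L (conjField (fieldS L)) x :=
    bracket_congr (Filter.EventuallyEq.refl _ _)
      (hL.eventually_analyticAt.mono fun y hy => bracket_conjL_T hy)
  rw [h1, h2, zero_add] at h
  exact h

theorem structFn_4_0 (hL : AnalyticAt ℝ L x) (k : Fin 5) :
    structFn L 4 0 k x = structFn L 3 1 k x := by
  rw [structFn, structFn]
  exact congrArg (fun v => comp L x v k) (bracket_conjL_S hL).symm

theorem fnQ_eq : fnQ L x = structFn L 4 1 1 x := rfl
theorem fnR_eq : fnR L x = structFn L 4 1 0 x := rfl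
theorem fnB_eq : fnB L x = structFn L 3 1 1 x := rfl
theorem fnG_eq : fnG L x = structFn L 2 1 0 x := rfl

theorem analyticAt_structFn (hL : AnalyticAt ℝ L x) (h : (frameMatrix L x).det ≠ 0)
    (i j k : Fin 5) : AnalyticAt ℝ (structFn L i j k) x :=
  analyticAt_comp hL h k (analyticAt_bracket (analyticAt_frame hL i) (analyticAt_frame hL j))

/-- The entries of the inverse of the unipotent group matrix. -/
noncomputable def invEntry (b c d e : Base → ℂ) (i j : Fin 5) (y : Base) : ℂ :=
  groupMatrix 1 (-b y) (-c y) (-d y + c y * conj (b y)) (-e y + c y * b y) i j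

theorem adaptedFrame_eq (i : Fin 5) : adaptedFrame L b c d e i =
    fun y => ∑ j, invEntry b c d e i j y • frame L j y := by
  funext y
  simp only [adaptedFrame, groupMatrix_inv, invEntry]

theorem analyticAt_invEntry (hb : AnalyticAt ℝ b x) (hc : AnalyticAt ℝ c x)
    (hd : AnalyticAt ℝ d x) (he : AnalyticAt ℝ e x) (i j : Fin 5) :
    AnalyticAt ℝ (invEntry b c d e i j) x := by
  have hb' := analyticAt_conj hb
  refine analyticAt_groupMatrix analyticAt_const ?_ ?_ ?_ ?_ i j
  all_goals fun_prop

theorem torsion_formula (hL : AnalyticAt ℝ L x) (h : (frameMatrix L x).det ≠ 0)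
    (hb : AnalyticAt ℝ b x) (hc : AnalyticAt ℝ c x) (hd : AnalyticAt ℝ d x)
    (he : AnalyticAt ℝ e x) (k i j : Fin 5) : torsion L b c d e k i j x =
      -∑ l, groupMatrix 1 (b x) (c x) (d x) (e x) l k *
        ((∑ p, ∑ q, invEntry b c d e i p x * invEntry b c d e j q x * structFn L p q l x) +
          cderiv (invEntry b c d e j l) x (adaptedFrame L b c d e i x) -
          cderiv (invEntry b c d e i l) x (adaptedFrame L b c d e j x)) := by
  rw [torsion_eq hL h hb hc hd he, cext_adapted]
  congr 1
  refine Finset.sum_congr rfl fun l _ => ?_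
  congr 1
  have hm := fun i j => (analyticAt_invEntry hb hc hd he i j).differentiableAt
  rw [adaptedFrame_eq i, adaptedFrame_eq j, bracket_sum_sum (hm i) (hm j)
    (fun i => (analyticAt_frame hL i).differentiableAt), ← cext_coframe₀]
  simp only [map_add, map_sub, map_sum, map_smul, cext_coframe₀, comp_frame h, smul_eq_mul,
    mul_ite, mul_one, mul_zero, Finset.sum_ite_eq, Finset.mem_univ, if_true]
  rfl

/-! ### Explicit torsion coefficients of dσ and dρ in an arbitrary adapted coframe. -/

section torsion

variable (hL : AnalyticAt ℝ L x) (h : (frameMatrix L x).det ≠ 0)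
  (hb : AnalyticAt ℝ b x) (hc : AnalyticAt ℝ c x) (hd : AnalyticAt ℝ d x)
  (he : AnalyticAt ℝ e x)

include hL h hb hc hd he

/-- The coefficients in `dσ`. -/
theorem torsion_sigma (i j : Fin 5) : torsion L b c d e 1 i j x =
    -∑ p, ∑ q, invEntry b c d e i p x * invEntry b c d e j q x * structFn L p q 1 x := by
  -- The σ-column of the group matrix is constant when a = 1, so dσ contains no derivatives of the
  -- parameters.
  have h1 : ∀ i, invEntry b c d e i 1 = fun _ => if i = 1 then 1 else 0 := by
    intro i
    funext y
    fin_cases i <;> simp [invEntry, groupMatrix]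
  have hg : ∀ l, groupMatrix 1 (b x) (c x) (d x) (e x) l 1 = ![0, 1, 0, 0, 0] l := by
    intro l
    fin_cases l <;> simp [groupMatrix]
  rw [torsion_formula hL h hb hc hd he, Finset.sum_congr rfl fun l _ => by rw [hg l],
    Fin.sum_univ_five]
  simp only [h1, cderiv_const]
  simp

theorem torsion_1_3_4 : torsion L b c d e 1 3 4 x = 0 := by
  rw [torsion_sigma hL h hb hc hd he]
  simp [Fin.sum_univ_five, invEntry, groupMatrix, structFn_antisymm 3 4, structFn_4_3 h]

theorem torsion_1_2_4 : torsion L b c d e 1 2 4 x = 1 := by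
  rw [torsion_sigma hL h hb hc hd he]
  simp [Fin.sum_univ_five, invEntry, groupMatrix, structFn_antisymm 3 4, structFn_4_3 h,
    structFn_antisymm 2 4, structFn_4_2 h, structFn_self]

theorem torsion_1_2_3 : torsion L b c d e 1 2 3 x = 0 := by
  rw [torsion_sigma hL h hb hc hd he]
  simp [Fin.sum_univ_five, invEntry, groupMatrix, structFn_4_3 h,
    structFn_antisymm 2 3, structFn_3_2 hL h, structFn_self]

theorem torsion_1_0_3 : torsion L b c d e 1 0 3 x = conj (fnR L x) := by
  rw [torsion_sigma hL h hb hc hd he, fnR_eq, conj_structFn hL h]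
  simp [Fin.sum_univ_five, invEntry, groupMatrix, structFn_4_3 h, conjIdx,
    structFn_antisymm 2 3, structFn_3_2 hL h, structFn_self, structFn_antisymm 0 3]

/-- Annihilating this coefficient determines c. -/
theorem torsion_1_0_4 : torsion L b c d e 1 0 4 x = fnB L x - conj (c x) := by
  rw [torsion_sigma hL h hb hc hd he, fnB_eq]
  simp [Fin.sum_univ_five, invEntry, groupMatrix, structFn_4_3 h, structFn_antisymm 3 4,
    structFn_antisymm 2 4, structFn_4_2 h, structFn_self, structFn_antisymm 0 4,
    structFn_4_0 hL]
  ring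

theorem torsion_1_1_4 : torsion L b c d e 1 1 4 x = fnQ L x - c x := by
  rw [torsion_sigma hL h hb hc hd he, fnQ_eq]
  simp [Fin.sum_univ_five, invEntry, groupMatrix, structFn_4_3 h, structFn_antisymm 3 4,
    structFn_antisymm 2 4, structFn_4_2 h, structFn_self, structFn_antisymm 1 4]
  ring

theorem torsion_1_1_3 : torsion L b c d e 1 1 3 x = fnB L x := by
  rw [torsion_sigma hL h hb hc hd he, fnB_eq]
  simp [Fin.sum_univ_five, invEntry, groupMatrix, structFn_4_3 h,
    structFn_antisymm 2 3, structFn_3_2 hL h, structFn_self, structFn_antisymm 1 3]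

/-- With b known, annihilating this coefficient determines d. -/
theorem torsion_1_0_2 : torsion L b c d e 1 0 2 x =
    conj (fnG L x) - b x * fnB L x - conj (b x) * conj (fnR L x) + conj (d x) := by
  rw [torsion_sigma hL h hb hc hd he, fnB_eq, fnR_eq, fnG_eq, conj_structFn hL h,
    conj_structFn hL h]
  simp [Fin.sum_univ_five, invEntry, groupMatrix, structFn_4_3 h, structFn_antisymm 3 4,
    structFn_antisymm 2 4, structFn_4_2 h, structFn_antisymm 2 3, structFn_3_2 hL h,
    structFn_self, structFn_antisymm 0 4, structFn_antisymm 0 3, structFn_antisymm 0 2,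
    structFn_4_0 hL, conjIdx]
  ring

/-- The coefficients in `dρ`. -/
theorem torsion_rho (i j : Fin 5) : torsion L b c d e 2 i j x =
    -((∑ p, ∑ q, invEntry b c d e i p x * invEntry b c d e j q x * (conj (c x) *
        structFn L p q 0 x + c x * structFn L p q 1 x + structFn L p q 2 x)) +
      cderiv (invEntry b c d e j 2) x (adaptedFrame L b c d e i x) -
      cderiv (invEntry b c d e i 2) x (adaptedFrame L b c d e j x)) := by
  have h0 : ∀ i, invEntry b c d e i 0 = fun _ => if i = 0 then 1 else 0 := by
    intro i
    funext y
    fin_cases i <;> simp [invEntry, groupMatrix]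
  have h1 : ∀ i, invEntry b c d e i 1 = fun _ => if i = 1 then 1 else 0 := by
    intro i
    funext y
    fin_cases i <;> simp [invEntry, groupMatrix]
  rw [torsion_formula hL h hb hc hd he]
  have hg : ∀ l, groupMatrix 1 (b x) (c x) (d x) (e x) l 2 = ![conj (c x), c x, 1, 0, 0] l := by
    intro l
    fin_cases l <;> simp [groupMatrix]
  have hs : ∑ p, ∑ q, invEntry b c d e i p x * invEntry b c d e j q x * (conj (c x) *
        structFn L p q 0 x + c x * structFn L p q 1 x + structFn L p q 2 x) =
      conj (c x) * ∑ p, ∑ q, invEntry b c d e i p x * invEntry b c d e j q x *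
        structFn L p q 0 x +
      c x * ∑ p, ∑ q, invEntry b c d e i p x * invEntry b c d e j q x * structFn L p q 1 x +
      ∑ p, ∑ q, invEntry b c d e i p x * invEntry b c d e j q x * structFn L p q 2 x := by
    simp only [Finset.mul_sum, ← Finset.sum_add_distrib]
    refine Finset.sum_congr rfl fun p _ => Finset.sum_congr rfl fun q _ => ?_
    ring
  rw [hs, Finset.sum_congr rfl fun l _ => by rw [hg l], Fin.sum_univ_five]
  simp only [h0, h1, cderiv_const]
  simp
  ring

/-- With c known, prescribing this coefficient determines b. -/
theorem torsion_2_2_4 : torsion L b c d e 2 2 4 x = c x + Complex.I * conj (b x) := by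
  have h4 : invEntry b c d e 4 2 = fun _ => 0 := by
    funext y
    simp [invEntry, groupMatrix]
  have h2 : invEntry b c d e 2 2 = fun _ => 1 := by
    funext y
    simp [invEntry, groupMatrix]
  rw [torsion_rho hL h hb hc hd he]
  simp only [h4, h2, cderiv_const]
  simp [Fin.sum_univ_five, invEntry, groupMatrix, structFn_4_3 h, structFn_antisymm 3 4,
    structFn_antisymm 2 4, structFn_4_2 h, structFn_self]
  ring

theorem torsion_2_3_4 : torsion L b c d e 2 3 4 x = -Complex.I := by
  have h4 : invEntry b c d e 4 2 = fun _ => 0 := by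
    funext y
    simp [invEntry, groupMatrix]
  have h3 : invEntry b c d e 3 2 = fun _ => 0 := by
    funext y
    simp [invEntry, groupMatrix]
  rw [torsion_rho hL h hb hc hd he]
  simp only [h4, h3, cderiv_const]
  simp [Fin.sum_univ_five, invEntry, groupMatrix, structFn_4_3 h, structFn_antisymm 3 4]

/-- The parameter e enters dρ here only through the L̄-component of the first dual vector, whose
bracket with L gives T; it is never differentiated. The coefficient is therefore affine in ē, and e
is determined by the value at e = 0. -/
theorem torsion_2_0_4 : torsion L b c d e 2 0 4 x =
    torsion L b c d 0 2 0 4 x + Complex.I * conj (e x) := by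
  have h4 : ∀ e : Base → ℂ, invEntry b c d e 4 2 = fun _ => 0 := by
    intro e
    funext y
    simp [invEntry, groupMatrix]
  have h0 : ∀ e : Base → ℂ, invEntry b c d e 0 2 = fun y => -conj (c y) := by
    intro e
    funext y
    simp [invEntry, groupMatrix]
  have hE : ∀ e : Base → ℂ, adaptedFrame L b c d e 4 x = L x := by
    intro e
    simp [adaptedFrame_eq, Fin.sum_univ_five, invEntry, groupMatrix, frame]
  rw [torsion_rho hL h hb hc hd he, torsion_rho hL h hb hc hd (e := 0) analyticAt_const]
  simp only [h4, h0, cderiv_const, hE]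
  simp [Fin.sum_univ_five, invEntry, groupMatrix, structFn_4_3 h, structFn_antisymm 3 4,
    structFn_antisymm 2 4, structFn_4_2 h, structFn_self]
  ring

end torsion

/-! ### Conjugation symmetry and analyticity of the torsion. -/

theorem conjField_adaptedFrame (hL : AnalyticAt ℝ L x) (i : Fin 5) :
    conjField (adaptedFrame L b c d e i) x = adaptedFrame L b c d e (conjIdx i) x := by
  simp only [adaptedFrame_eq, invEntry]
  rw [← sum_conjIdx]
  funext k
  simp only [conjField, Finset.sum_apply, Pi.smul_apply, smul_eq_mul, map_sum, map_mul,
    conj_groupMatrix]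
  refine Finset.sum_congr rfl fun j _ => ?_
  rw [← conjField_frame hL]
  rfl

theorem conj_cext_adapted (hL : AnalyticAt ℝ L x) (h : (frameMatrix L x).det ≠ 0) (k : Fin 5)
    (v : CVec) : conj (cext (adapted L b c d e k x) v) =
      cext (adapted L b c d e (conjIdx k) x) (fun l => conj (v l)) := by
  simp only [cext_adapted, map_sum, map_mul, conj_groupMatrix, conj_comp hL h]
  exact sum_conjIdx fun j => groupMatrix 1 (b x) (c x) (d x) (e x) j (conjIdx k) *
    comp L x (fun l => conj (v l)) j

theorem conj_adapted (hL : AnalyticAt ℝ L x) (h : (frameMatrix L x).det ≠ 0) (k : Fin 5)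
    (v : Base) : conj (adapted L b c d e k x v) = adapted L b c d e (conjIdx k) x v := by
  rw [← cext_toC, conj_cext_adapted hL h, ← cext_toC]
  congr 1
  funext l
  simp [toC]

theorem conj_torsion (hL : AnalyticAt ℝ L x) (h : (frameMatrix L x).det ≠ 0)
    (hb : AnalyticAt ℝ b x) (hc : AnalyticAt ℝ c x) (hd : AnalyticAt ℝ d x)
    (he : AnalyticAt ℝ e x) (k i j : Fin 5) : conj (torsion L b c d e k i j x) =
      torsion L b c d e (conjIdx k) (conjIdx i) (conjIdx j) x := by
  rw [torsion_eq hL h hb hc hd he, torsion_eq hL h hb hc hd he, map_neg,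
    conj_cext_adapted hL h, conj_bracket
      (analyticAt_adaptedFrame hL hb hc hd he i).differentiableAt
      (analyticAt_adaptedFrame hL hb hc hd he j).differentiableAt
      (hL.eventually_analyticAt.mono fun y hy => conjField_adaptedFrame hy i)
      (hL.eventually_analyticAt.mono fun y hy => conjField_adaptedFrame hy j)]

theorem eventually_det_ne (hL : AnalyticAt ℝ L x) (h : (frameMatrix L x).det ≠ 0) :
    ∀ᶠ y in 𝓝 x, (frameMatrix L y).det ≠ 0 :=
  (analyticAt_det (analyticAt_frameMatrix hL)).continuousAt.eventually_ne h

theorem analyticAt_torsion (hL : AnalyticAt ℝ L x) (h : (frameMatrix L x).det ≠ 0)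
    (hb : AnalyticAt ℝ b x) (hc : AnalyticAt ℝ c x) (hd : AnalyticAt ℝ d x)
    (he : AnalyticAt ℝ e x) (k i j : Fin 5) : AnalyticAt ℝ (torsion L b c d e k i j) x := by
  have h1 := analyticAt_bracket (analyticAt_adaptedFrame hL hb hc hd he i)
    (analyticAt_adaptedFrame hL hb hc hd he j)
  have h2 := analyticAt_adapted hL h hb hc hd he k
  have : AnalyticAt ℝ (fun y => -cext (adapted L b c d e k y)
      (bracket (adaptedFrame L b c d e i) (adaptedFrame L b c d e j) y)) x := by
    simp only [cext_apply]
    refine (Finset.analyticAt_fun_sum _ fun k _ => ?_).neg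
    exact (analyticAt_pi_iff.1 h1 k).mul
      (((ContinuousLinearMap.apply ℝ ℂ (Pi.single k 1 : Base)).analyticAt _).comp h2)
  refine this.congr ?_
  filter_upwards [hL.eventually_analyticAt, eventually_det_ne hL h, hb.eventually_analyticAt,
    hc.eventually_analyticAt, hd.eventually_analyticAt, he.eventually_analyticAt]
    with y h1 h2 h3 h4 h5 h6
  exact (torsion_eq h1 h2 h3 h4 h5 h6 k i j).symm

/-! ### The normalized coframe -/

section norm

variable (hL : AnalyticAt ℝ L x) (h : (frameMatrix L x).det ≠ 0)
include hL h

theorem analyticAt_fnR : AnalyticAt ℝ (fnR L) x := analyticAt_structFn hL h 4 1 0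

theorem analyticAt_normC : AnalyticAt ℝ (normC L) x :=
  analyticAt_conj (analyticAt_structFn hL h 3 1 1)

theorem analyticAt_normB : AnalyticAt ℝ (normB L) x :=
  (analyticAt_const.mul (analyticAt_conj (analyticAt_structFn hL h 4 1 1))).sub
    (analyticAt_const.mul (analyticAt_structFn hL h 3 1 1))

theorem analyticAt_normD : AnalyticAt ℝ (normD L) x := by
  have hQ : AnalyticAt ℝ (fnQ L) x := analyticAt_structFn hL h 4 1 1
  have hR : AnalyticAt ℝ (fnR L) x := analyticAt_structFn hL h 4 1 0
  have hB : AnalyticAt ℝ (fnB L) x := analyticAt_structFn hL h 3 1 1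
  have hG : AnalyticAt ℝ (fnG L) x := analyticAt_structFn hL h 2 1 0
  have hQ' := analyticAt_conj hQ
  have hB' := analyticAt_conj hB
  unfold normD
  fun_prop

theorem analyticAt_normE : AnalyticAt ℝ (normE L) x :=
  analyticAt_const.mul (analyticAt_conj (analyticAt_torsion hL h (analyticAt_normB hL h)
    (analyticAt_normC hL h) (analyticAt_normD hL h) analyticAt_const 2 0 4))

theorem analyticAt_redTorsion (k i j : Fin 5) : AnalyticAt ℝ (redTorsion L k i j) x :=
  analyticAt_torsion hL h (analyticAt_normB hL h) (analyticAt_normC hL h)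
    (analyticAt_normD hL h) (analyticAt_normE hL h) k i j

theorem analyticAt_reduced (i : Fin 5) : AnalyticAt ℝ (reduced L i) x :=
  analyticAt_adapted hL h (analyticAt_normB hL h) (analyticAt_normC hL h)
    (analyticAt_normD hL h) (analyticAt_normE hL h) i

theorem conj_redTorsion (k i j : Fin 5) : conj (redTorsion L k i j x) =
    redTorsion L (conjIdx k) (conjIdx i) (conjIdx j) x :=
  conj_torsion hL h (analyticAt_normB hL h) (analyticAt_normC hL h)
    (analyticAt_normD hL h) (analyticAt_normE hL h) k i j

theorem redTorsion_1_3_4 : redTorsion L 1 3 4 x = 0 :=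
  torsion_1_3_4 hL h (analyticAt_normB hL h) (analyticAt_normC hL h)
    (analyticAt_normD hL h) (analyticAt_normE hL h)

theorem redTorsion_1_2_4 : redTorsion L 1 2 4 x = 1 :=
  torsion_1_2_4 hL h (analyticAt_normB hL h) (analyticAt_normC hL h)
    (analyticAt_normD hL h) (analyticAt_normE hL h)

theorem redTorsion_1_2_3 : redTorsion L 1 2 3 x = 0 :=
  torsion_1_2_3 hL h (analyticAt_normB hL h) (analyticAt_normC hL h)
    (analyticAt_normD hL h) (analyticAt_normE hL h)

theorem redTorsion_1_0_3 : redTorsion L 1 0 3 x = conj (fnR L x) :=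
  torsion_1_0_3 hL h (analyticAt_normB hL h) (analyticAt_normC hL h)
    (analyticAt_normD hL h) (analyticAt_normE hL h)

theorem redTorsion_1_0_4 : redTorsion L 1 0 4 x = 0 := by
  rw [redTorsion, torsion_1_0_4 hL h (analyticAt_normB hL h) (analyticAt_normC hL h)
    (analyticAt_normD hL h) (analyticAt_normE hL h), normC]
  simp

theorem redTorsion_1_0_2 : redTorsion L 1 0 2 x = 0 := by
  rw [redTorsion, torsion_1_0_2 hL h (analyticAt_normB hL h) (analyticAt_normC hL h)
    (analyticAt_normD hL h) (analyticAt_normE hL h), normD, normB]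
  simp [conj_three]
  ring

theorem redTorsion_2_3_4 : redTorsion L 2 3 4 x = -Complex.I :=
  torsion_2_3_4 hL h (analyticAt_normB hL h) (analyticAt_normC hL h)
    (analyticAt_normD hL h) (analyticAt_normE hL h)

theorem redTorsion_2_0_4 : redTorsion L 2 0 4 x = 0 := by
  rw [redTorsion, torsion_2_0_4 hL h (analyticAt_normB hL h) (analyticAt_normC hL h)
    (analyticAt_normD hL h) (analyticAt_normE hL h), normE]
  simp [← mul_assoc]

/-- Compatibility of the two absorptions. If λ has ζ-coefficient E and ζ̄-coefficient D, then dσ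
requires 2E + D̄ = -x₇ and 2D + Ē = -x₆, whence 3(E + D̄) = -(x₇ + x̄₆), while dρ requires E + D̄ to
be minus the coefficient considered here. -/
theorem redTorsion_2_2_4 : redTorsion L 2 2 4 x =
    (redTorsion L 1 1 4 x + conj (redTorsion L 1 1 3 x)) / 3 := by
  have hB := analyticAt_normB hL h
  have hC := analyticAt_normC hL h
  have hD := analyticAt_normD hL h
  have hE := analyticAt_normE hL h
  rw [redTorsion, torsion_2_2_4 hL h hB hC hD hE, torsion_1_1_4 hL h hB hC hD hE,
    torsion_1_1_3 hL h hB hC hD hE, normB, normC]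
  simp [conj_three]
  linear_combination (-(fnQ L x) / 3 + conj (fnB L x)) * Complex.I_mul_I

end norm

/-- The normalizations are determined by the vanishing of the torsion coefficients. -/
theorem eq_norm_of_torsion (hL : AnalyticAt ℝ L x) (h : (frameMatrix L x).det ≠ 0)
    (hb : AnalyticAt ℝ b x) (hc : AnalyticAt ℝ c x) (hd : AnalyticAt ℝ d x)
    (he : AnalyticAt ℝ e x)
    (ht : ∀ᶠ y in 𝓝 x, torsion L b c d e 1 0 4 y = 0 ∧ torsion L b c d e 1 0 2 y = 0 ∧
      torsion L b c d e 2 0 4 y = 0 ∧ torsion L b c d e 2 2 4 y =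
        (torsion L b c d e 1 1 4 y + conj (torsion L b c d e 1 1 3 y)) / 3) :
    b =ᶠ[𝓝 x] normB L ∧ c =ᶠ[𝓝 x] normC L ∧ d =ᶠ[𝓝 x] normD L ∧ e =ᶠ[𝓝 x] normE L := by
  have key : ∀ᶠ y in 𝓝 x, b y = normB L y ∧ c y = normC L y ∧ d y = normD L y := by
    filter_upwards [ht, hL.eventually_analyticAt, eventually_det_ne hL h,
      hb.eventually_analyticAt, hc.eventually_analyticAt, hd.eventually_analyticAt,
      he.eventually_analyticAt] with y ⟨t1, t2, t3, t4⟩ hL h hb hc hd he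
    rw [torsion_1_0_4 hL h hb hc hd he] at t1
    rw [torsion_1_0_2 hL h hb hc hd he] at t2
    rw [torsion_2_2_4 hL h hb hc hd he, torsion_1_1_4 hL h hb hc hd he,
      torsion_1_1_3 hL h hb hc hd he] at t4
    have t1' := congrArg (starRingEnd ℂ) t1
    have t2' := congrArg (starRingEnd ℂ) t2
    have t4' := congrArg (starRingEnd ℂ) t4
    simp [conj_three] at t1' t2' t4'
    -- The first condition yields c; eliminating it from the conjugate of the fourth leaves a linear
    -- equation for b.
    have eb : b y = normB L y := by
      rw [normB]
      linear_combination Complex.I * t4' + (4 / 3) * Complex.I * t1 +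
        b y * Complex.I_mul_I
    refine ⟨eb, ?_, ?_⟩
    · rw [normC]
      linear_combination -t1'
    · rw [normB] at eb
      have eb' := congrArg (starRingEnd ℂ) eb
      simp [conj_three] at eb'
      rw [normD]
      linear_combination t2' + fnR L y * eb + conj (fnB L y) * eb'
  refine ⟨key.mono fun y hy => hy.1, key.mono fun y hy => hy.2.1,
    key.mono fun y hy => hy.2.2, ?_⟩
  filter_upwards [ht, hL.eventually_analyticAt, eventually_det_ne hL h,
    hb.eventually_analyticAt, hc.eventually_analyticAt, hd.eventually_analyticAt,
    he.eventually_analyticAt, key.eventually_nhds] with y ⟨t1, t2, t3, t4⟩ hL h hb hc hd he hk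
  rw [torsion_2_0_4 hL h hb hc hd he] at t3
  -- This coefficient contains a derivative of c, so equality of the parameters near the point is
  -- needed, not only at it.
  have : torsion L b c d 0 2 0 4 y = torsion L (normB L) (normC L) (normD L) 0 2 0 4 y := by
    have e1 : ∀ k, adapted L b c d 0 k =ᶠ[𝓝 y] adapted L (normB L) (normC L) (normD L) 0 k :=
      fun k => hk.mono fun z hz => by simp only [adapted, hz]
    have e2 : ∀ k, adaptedFrame L b c d 0 k y =
        adaptedFrame L (normB L) (normC L) (normD L) 0 k y :=
      fun k => by simp only [adaptedFrame, hk.self_of_nhds]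
    simp only [torsion, e2, dFormC, dForm_congr (e1 2)]
  rw [this] at t3
  have t3' := congrArg (starRingEnd ℂ) t3
  simp at t3'
  rw [normE]
  linear_combination Complex.I * t3' + e y * Complex.I_mul_I

end

end ClassIII

namespace ClassIII

theorem conj_two : conj (2 : ℂ) = 2 := map_ofNat _ 2

/-! ### The lifted forms -/

/-- The weights of the lifted coframe with respect to the reduced coframe. -/
noncomputable def weight (i : Fin 5) (a : ℂ) : ℂ :=
  (![a * conj a * conj a, a * a * conj a, a * conj a, conj a, a] : Fin 5 → ℂ) i

theorem weight_ne_zero (i : Fin 5) {a : ℂ} (ha : a ≠ 0) : weight i a ≠ 0 := by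
  fin_cases i <;> simp [weight, ha]

theorem conj_weight (i : Fin 5) (a : ℂ) : conj (weight i a) = weight (conjIdx i) a := by
  fin_cases i <;> simp [weight, conjIdx] <;> ring

/-- Pull-back to the bundle of a form on the base. -/
noncomputable def pull (ω : Base → Base →L[ℝ] ℂ) : Tot → Tot →L[ℝ] ℂ := fun p =>
  (ω p.1).comp (ContinuousLinearMap.fst ℝ Base ℂ)

theorem pull_apply (ω : Base → Base →L[ℝ] ℂ) (p X : Tot) : pull ω p X = ω p.1 X.1 := rfl

/-- The factors a, aā, ā, a in front of the normalized parameters are exactly those for which each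
column of the group matrix is a common monomial times its value at a = 1. -/
theorem lifted_eq (L : Base → CVec) (i : Fin 5) (p : Tot) :
    lifted L i p = weight i p.2 • pull (reduced L i) p := by
  simp only [lifted, pull, reduced, adapted]
  refine ContinuousLinearMap.ext fun X => ?_
  fin_cases i <;>
    simp [groupMatrix, Matrix.transpose_apply, Fin.sum_univ_five, weight] <;> ring

theorem analyticAt_pull {ω : Base → Base →L[ℝ] ℂ} {p : Tot} (h : AnalyticAt ℝ ω p.1) :
    AnalyticAt ℝ (pull ω) p :=
  (((ContinuousLinearMap.compL ℝ Tot Base ℂ).flip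
    (ContinuousLinearMap.fst ℝ Base ℂ)).analyticAt _).comp (h.comp analyticAt_fst)

theorem dForm_pull {ω : Base → Base →L[ℝ] ℂ} {p : Tot} (h : DifferentiableAt ℝ ω p.1)
    (X Y : Tot) : dForm (pull ω) p X Y = dForm ω p.1 X.1 Y.1 :=
  dForm_comp_clm (ContinuousLinearMap.fst ℝ Base ℂ) h X Y

theorem analyticAt_conj_snd (p : Tot) : AnalyticAt ℝ (fun q : Tot => conj q.2) p :=
  ((Complex.conjCLE : ℂ →L[ℝ] ℂ).analyticAt _).comp analyticAt_snd

theorem analyticAt_weight (i : Fin 5) (p : Tot) :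
    AnalyticAt ℝ (fun q : Tot => weight i q.2) p := by
  have h1 := analyticAt_conj_snd p
  have h2 : AnalyticAt ℝ (fun q : Tot => q.2) p := analyticAt_snd
  fin_cases i
  · exact (h2.mul h1).mul h1
  · exact (h2.mul h2).mul h1
  · exact h2.mul h1
  · exact h1
  · exact h2

/-- The exponents of `a` and of its conjugate in the weights. -/
def weightExp : Fin 5 → ℂ × ℂ := ![(1, 2), (2, 1), (1, 1), (0, 1), (1, 0)]

/-- Logarithmic derivative of a monomial in a and ā; it makes da/a and its conjugate appear with the
exponents as coefficients. -/
theorem fderiv_weight (i : Fin 5) {p : Tot} (hp : p.2 ≠ 0) (X : Tot) :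
    fderiv ℝ (fun q : Tot => weight i q.2) p X = weight i p.2 *
      ((weightExp i).1 * (X.2 / p.2) + (weightExp i).2 * conj (X.2 / p.2)) := by
  have hp' : conj p.2 ≠ 0 := by simpa using hp
  have h2 : HasFDerivAt (fun q : Tot => q.2) (ContinuousLinearMap.snd ℝ Base ℂ) p :=
    hasFDerivAt_snd
  have h1 : HasFDerivAt (fun q : Tot => conj q.2)
      ((Complex.conjCLE : ℂ →L[ℝ] ℂ).comp (ContinuousLinearMap.snd ℝ Base ℂ)) p :=
    (Complex.conjCLE : ℂ →L[ℝ] ℂ).hasFDerivAt.comp p h2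
  fin_cases i
  · have : fderiv ℝ (fun q : Tot => weight 0 q.2) p = _ := ((h2.mul h1).mul h1).fderiv
    simp only [Fin.zero_eta, this]
    simp [weight, weightExp]
    field_simp
    ring
  · have : fderiv ℝ (fun q : Tot => weight 1 q.2) p = _ := ((h2.mul h2).mul h1).fderiv
    simp only [Fin.mk_one, this]
    simp [weight, weightExp]
    field_simp
    ring
  · have : fderiv ℝ (fun q : Tot => weight 2 q.2) p = _ := (h2.mul h1).fderiv
    simp only [Fin.reduceFinMk, this]
    simp [weight, weightExp]
    field_simp
    ring
  · have : fderiv ℝ (fun q : Tot => weight 3 q.2) p = _ := h1.fderiv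
    simp only [Fin.reduceFinMk, this]
    simp [weight, weightExp]
    field_simp
  · have : fderiv ℝ (fun q : Tot => weight 4 q.2) p = _ := h2.fderiv
    simp only [Fin.reduceFinMk, this]
    simp [weight, weightExp]
    field_simp

section

variable {L : Base → CVec}

theorem conj_reduced {x : Base} (hL : AnalyticAt ℝ L x) (h : (frameMatrix L x).det ≠ 0)
    (k : Fin 5) (v : Base) : conj (reduced L k x v) = reduced L (conjIdx k) x v :=
  conj_adapted hL h k v

/-- The base part of `λ`. -/
noncomputable def lamBase (L : Base → CVec) : Base → Base →L[ℝ] ℂ := fun x =>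
  ∑ i, absorption L x i • reduced L i x

theorem lam_apply (p X : Tot) : lam L p X = X.2 / p.2 + lamBase L p.1 X.1 := by
  simp [lam, lamBase, div_eq_inv_mul]

theorem lam_eq (p : Tot) : lam L p = p.2⁻¹ • ContinuousLinearMap.snd ℝ Base ℂ +
    pull (lamBase L) p := by
  refine ContinuousLinearMap.ext fun X => ?_
  rw [lam_apply]
  simp [pull_apply, div_eq_inv_mul]

variable {x : Base} (hL : AnalyticAt ℝ L x) (h : (frameMatrix L x).det ≠ 0)
include hL h

theorem analyticAt_absorption (i : Fin 5) : AnalyticAt ℝ (fun y => absorption L y i) x := by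
  have hr := analyticAt_redTorsion hL h
  have hr' := fun k i j => analyticAt_conj (hr k i j)
  fin_cases i
  · exact (hr 1 0 1).sub (hr 2 0 2)
  · exact analyticAt_conj ((analyticAt_const.mul (hr 2 0 2)).sub (hr 1 0 1))
  · exact ((hr' 1 1 2).sub (analyticAt_const.mul (hr 1 1 2))).div analyticAt_const (by simp)
  · exact ((hr' 1 1 4).sub (analyticAt_const.mul (hr 1 1 3))).div analyticAt_const (by simp)
  · exact ((hr' 1 1 3).sub (analyticAt_const.mul (hr 1 1 4))).div analyticAt_const (by simp)

theorem analyticAt_lamBase : AnalyticAt ℝ (lamBase L) x :=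
  Finset.analyticAt_fun_sum _ fun i _ =>
    (analyticAt_absorption hL h i).smul (analyticAt_reduced hL h i)

theorem analyticAt_lifted (a : ℂ) (i : Fin 5) : AnalyticAt ℝ (lifted L i) (x, a) := by
  rw [show lifted L i = _ from funext (lifted_eq L i)]
  exact (analyticAt_weight i _).smul (analyticAt_pull (analyticAt_reduced hL h i))

theorem conj_lifted (a : ℂ) (i : Fin 5) (X : Tot) :
    conj (lifted L i (x, a) X) = lifted L (conjIdx i) (x, a) X := by
  simp only [lifted_eq, _root_.smul_apply, smul_eq_mul, map_mul, conj_weight, pull_apply,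
    conj_reduced hL h]

theorem fiveForms_eq (a : ℂ) (i : Fin 5) : fiveForms L i (x, a) = lifted L i (x, a) := by
  refine ContinuousLinearMap.ext fun X => ?_
  fin_cases i
  · exact conj_lifted hL h a 1 X
  · rfl
  · rfl
  · exact conj_lifted hL h a 4 X
  · rfl

/-- Vertical terms come from the logarithmic derivative of the weight, all others from the torsion
of the reduced coframe on the base. -/
theorem dForm_lifted {a : ℂ} (ha : a ≠ 0) (k : Fin 5) (X Y : Tot) :
    dForm (lifted L k) (x, a) X Y = weight k a *
      (((weightExp k).1 * (X.2 / a) + (weightExp k).2 * conj (X.2 / a)) * reduced L k x Y.1 -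
        ((weightExp k).1 * (Y.2 / a) + (weightExp k).2 * conj (Y.2 / a)) * reduced L k x X.1 +
      ∑ i, ∑ j ∈ Finset.Ioi i, redTorsion L k i j x *
        (reduced L i x X.1 * reduced L j x Y.1 - reduced L i x Y.1 * reduced L j x X.1)) := by
  have hr := analyticAt_reduced hL h k
  rw [show lifted L k = _ from funext (lifted_eq L k),
    dForm_smul (analyticAt_weight k _).differentiableAt
      (analyticAt_pull (p := (x, a)) hr).differentiableAt]
  simp only [Pi.add_apply, Pi.smul_apply, wedge]
  rw [dForm_pull hr.differentiableAt, fderiv_weight k (p := (x, a)) ha,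
    fderiv_weight k (p := (x, a)) ha, dForm_adapted (b := normB L) (c := normC L) (d := normD L)
      (e := normE L) h hr.differentiableAt]
  simp only [pull_apply, wedge, smul_eq_mul]
  simp only [redTorsion, torsion, reduced]
  ring

/-! ### Structure equations for σ, ρ, ζ and λ. -/

omit hL h in
theorem sum_Ioi (t : Fin 5 → Fin 5 → ℂ) : ∑ i, ∑ j ∈ Finset.Ioi i, t i j =
    t 0 1 + t 0 2 + t 0 3 + t 0 4 + t 1 2 + t 1 3 + t 1 4 + t 2 3 + t 2 4 + t 3 4 := by
  have i0 : Finset.Ioi (0 : Fin 5) = {1, 2, 3, 4} := by decide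
  have i1 : Finset.Ioi (1 : Fin 5) = {2, 3, 4} := by decide
  have i2 : Finset.Ioi (2 : Fin 5) = {3, 4} := by decide
  have i3 : Finset.Ioi (3 : Fin 5) = {4} := by decide
  have i4 : Finset.Ioi (4 : Fin 5) = ∅ := by decide
  simp [Fin.sum_univ_five, i0, i1, i2, i3, i4]
  ring

omit hL h in
theorem lamBase_apply (v : Base) : lamBase L x v = absorption L x 0 * reduced L 0 x v +
    absorption L x 1 * reduced L 1 x v + absorption L x 2 * reduced L 2 x v +
    absorption L x 3 * reduced L 3 x v + absorption L x 4 * reduced L 4 x v := by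
  simp [lamBase, Fin.sum_univ_five]

theorem conj_lamBase_apply (v : Base) : conj (lamBase L x v) =
    conj (absorption L x 0) * reduced L 1 x v +
    conj (absorption L x 1) * reduced L 0 x v + conj (absorption L x 2) * reduced L 2 x v +
    conj (absorption L x 3) * reduced L 4 x v + conj (absorption L x 4) * reduced L 3 x v := by
  simp only [lamBase_apply, map_add, map_mul, conj_reduced hL h]
  rfl

/-- Six of the ten torsion coefficients are known: four vanish, one is 1 and one is R̄. The other
four multiply products containing σ and are absorbed by the base part of λ. -/
theorem dForm_sigma {a : ℂ} (ha : a ≠ 0) (X Y : Tot) :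
    dForm (sigma L) (x, a) X Y =
      ((2 * lam L (x, a) X + conj (lam L (x, a) X)) * lifted L 1 (x, a) Y -
        (2 * lam L (x, a) Y + conj (lam L (x, a) Y)) * lifted L 1 (x, a) X) +
      (a / conj a ^ 2 * conj (fnR L x)) * (lifted L 0 (x, a) X * lifted L 3 (x, a) Y -
        lifted L 0 (x, a) Y * lifted L 3 (x, a) X) +
      (lifted L 2 (x, a) X * lifted L 4 (x, a) Y -
        lifted L 2 (x, a) Y * lifted L 4 (x, a) X) := by
  have ha' : conj a ≠ 0 := by simpa using ha
  rw [sigma, dForm_lifted hL h ha, sum_Ioi]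
  simp only [redTorsion_1_3_4 hL h, redTorsion_1_2_4 hL h, redTorsion_1_2_3 hL h,
    redTorsion_1_0_3 hL h, redTorsion_1_0_4 hL h, redTorsion_1_0_2 hL h, lam_apply, map_add,
    conj_lamBase_apply hL h]
  simp only [lamBase_apply, lifted_eq, _root_.smul_apply, smul_eq_mul, pull_apply]
  simp only [absorption, weight, weightExp]
  simp [conj_three, conj_two]
  field_simp
  ring

/-- Reality of ρ pairs the coefficients by conjugation. The four products with ρ are absorbed by λ +
λ̄ thanks to the compatibility relation, and σ̄∧ζ drops out together with its conjugate. -/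
theorem dForm_rho {a : ℂ} (ha : a ≠ 0) (X Y : Tot) :
    dForm (rho L) (x, a) X Y =
      ((lam L (x, a) X + conj (lam L (x, a) X)) * lifted L 2 (x, a) Y -
        (lam L (x, a) Y + conj (lam L (x, a) Y)) * lifted L 2 (x, a) X) +
      (1 / (a ^ 2 * conj a ^ 2) * redTorsion L 2 0 1 x) *
        (lifted L 0 (x, a) X * lifted L 1 (x, a) Y -
        lifted L 0 (x, a) Y * lifted L 1 (x, a) X) +
      (1 / conj a ^ 2 * redTorsion L 2 0 3 x) * (lifted L 0 (x, a) X * lifted L 3 (x, a) Y -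
        lifted L 0 (x, a) Y * lifted L 3 (x, a) X) +
      (1 / a ^ 2 * conj (redTorsion L 2 0 3 x)) * (lifted L 1 (x, a) X * lifted L 4 (x, a) Y -
        lifted L 1 (x, a) Y * lifted L 4 (x, a) X) +
      Complex.I * (lifted L 4 (x, a) X * lifted L 3 (x, a) Y -
        lifted L 4 (x, a) Y * lifted L 3 (x, a) X) := by
  have ha' : conj a ≠ 0 := by simpa using ha
  have t12 : redTorsion L 2 1 2 x = conj (redTorsion L 2 0 2 x) :=
    (conj_redTorsion hL h 2 0 2).symm
  have t13 : redTorsion L 2 1 3 x = 0 := by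
    have := conj_redTorsion hL h 2 0 4
    rw [redTorsion_2_0_4 hL h, map_zero] at this
    exact this.symm
  have t14 : redTorsion L 2 1 4 x = conj (redTorsion L 2 0 3 x) :=
    (conj_redTorsion hL h 2 0 3).symm
  have t23 : redTorsion L 2 2 3 x = conj (redTorsion L 2 2 4 x) :=
    (conj_redTorsion hL h 2 2 4).symm
  rw [rho, dForm_lifted hL h ha, sum_Ioi]
  simp only [t12, t13, t14, t23, redTorsion_2_0_4 hL h, redTorsion_2_3_4 hL h,
    redTorsion_2_2_4 hL h, lam_apply, map_add,
    conj_lamBase_apply hL h]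
  simp only [lamBase_apply, lifted_eq, _root_.smul_apply, smul_eq_mul, pull_apply]
  simp only [absorption, weight, weightExp]
  simp [conj_three, conj_two]
  field_simp
  ring

/-- The coefficients in `dζ`. -/
noncomputable def zetaCoeff (L : Base → CVec) : Fin 10 → Base → ℂ :=
  ![redTorsion L 4 0 1, redTorsion L 4 0 2, redTorsion L 4 0 3,
    fun x => redTorsion L 4 0 4 x - absorption L x 0, redTorsion L 4 1 2, redTorsion L 4 1 3,
    fun x => redTorsion L 4 1 4 x - absorption L x 1, redTorsion L 4 2 3,
    fun x => redTorsion L 4 2 4 x - absorption L x 2,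
    fun x => redTorsion L 4 3 4 x - absorption L x 3]

theorem analyticAt_zetaCoeff (k : Fin 10) : AnalyticAt ℝ (zetaCoeff L k) x := by
  have hr := analyticAt_redTorsion hL h
  have hs := analyticAt_absorption hL h
  fin_cases k
  exacts [hr 4 0 1, hr 4 0 2, hr 4 0 3, (hr 4 0 4).sub (hs 0), hr 4 1 2, hr 4 1 3,
    (hr 4 1 4).sub (hs 1), hr 4 2 3, (hr 4 2 4).sub (hs 2), (hr 4 3 4).sub (hs 3)]

/-- No normalization enters: introducing λ only shifts the coefficients of the products with ζ, and
every power of a is a ratio of weights. -/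
theorem dForm_zeta {a : ℂ} (ha : a ≠ 0) (X Y : Tot) :
    dForm (zeta L) (x, a) X Y =
      (lam L (x, a) X * lifted L 4 (x, a) Y - lam L (x, a) Y * lifted L 4 (x, a) X) +
      (1 / (a ^ 2 * conj a ^ 3) * zetaCoeff L 0 x) * (lifted L 0 (x, a) X * lifted L 1 (x, a) Y -
        lifted L 0 (x, a) Y * lifted L 1 (x, a) X) +
      (1 / (a * conj a ^ 3) * zetaCoeff L 1 x) * (lifted L 0 (x, a) X * lifted L 2 (x, a) Y -
        lifted L 0 (x, a) Y * lifted L 2 (x, a) X) +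
      (1 / conj a ^ 3 * zetaCoeff L 2 x) * (lifted L 0 (x, a) X * lifted L 3 (x, a) Y -
        lifted L 0 (x, a) Y * lifted L 3 (x, a) X) +
      (1 / (a * conj a ^ 2) * zetaCoeff L 3 x) * (lifted L 0 (x, a) X * lifted L 4 (x, a) Y -
        lifted L 0 (x, a) Y * lifted L 4 (x, a) X) +
      (1 / (a ^ 2 * conj a ^ 2) * zetaCoeff L 4 x) * (lifted L 1 (x, a) X * lifted L 2 (x, a) Y -
        lifted L 1 (x, a) Y * lifted L 2 (x, a) X) +
      (1 / (a * conj a ^ 2) * zetaCoeff L 5 x) * (lifted L 1 (x, a) X * lifted L 3 (x, a) Y -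
        lifted L 1 (x, a) Y * lifted L 3 (x, a) X) +
      (1 / (a ^ 2 * conj a) * zetaCoeff L 6 x) * (lifted L 1 (x, a) X * lifted L 4 (x, a) Y -
        lifted L 1 (x, a) Y * lifted L 4 (x, a) X) +
      (1 / conj a ^ 2 * zetaCoeff L 7 x) * (lifted L 2 (x, a) X * lifted L 3 (x, a) Y -
        lifted L 2 (x, a) Y * lifted L 3 (x, a) X) +
      (1 / (a * conj a) * zetaCoeff L 8 x) * (lifted L 2 (x, a) X * lifted L 4 (x, a) Y -
        lifted L 2 (x, a) Y * lifted L 4 (x, a) X) +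
      (1 / conj a * zetaCoeff L 9 x) * (lifted L 3 (x, a) X * lifted L 4 (x, a) Y -
        lifted L 3 (x, a) Y * lifted L 4 (x, a) X) := by
  have ha' : conj a ≠ 0 := by simpa using ha
  rw [zeta, dForm_lifted hL h ha, sum_Ioi]
  simp only [lam_apply, lamBase_apply, lifted_eq, _root_.smul_apply, smul_eq_mul, pull_apply]
  simp only [weight, weightExp, zetaCoeff]
  simp
  field_simp
  ring

omit hL h in
theorem analyticAt_dFormC {ω : Base → Base →L[ℝ] ℂ} {V W : Base → CVec}
    (hω : AnalyticAt ℝ ω x) (hV : AnalyticAt ℝ V x) (hW : AnalyticAt ℝ W x) :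
    AnalyticAt ℝ (fun y => dFormC ω y (V y) (W y)) x := by
  have ha : ∀ k l : Fin 5, AnalyticAt ℝ
      (fun y => dForm ω y (Pi.single k 1) (Pi.single l 1)) x := by
    intro k l
    have h1 : ∀ k l : Fin 5,
        AnalyticAt ℝ (fun y => fderiv ℝ ω y (Pi.single k 1) (Pi.single l 1)) x := fun k l =>
      ((ContinuousLinearMap.apply ℝ ℂ (Pi.single l 1 : Base)).analyticAt _).comp
        (analyticAt_fderiv_apply hω (Pi.single k 1))
    refine ((h1 k l).sub (h1 l k)).congr ?_
    filter_upwards [hω.eventually_analyticAt] with y hy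
    exact (dForm_apply hy.differentiableAt _ _).symm
  exact Finset.analyticAt_fun_sum _ fun k _ => Finset.analyticAt_fun_sum _ fun l _ =>
    ((analyticAt_pi_iff.1 hV k).mul (analyticAt_pi_iff.1 hW l)).mul (ha k l)

/-- The coefficients in `dλ`. -/
noncomputable def lamCoeff (L : Base → CVec) (i j : Fin 5) (p : Tot) : ℂ :=
  dFormC (lamBase L) p.1 (adaptedFrame L (normB L) (normC L) (normD L) (normE L) i p.1)
    (adaptedFrame L (normB L) (normC L) (normD L) (normE L) j p.1) *
      (weight i p.2 * weight j p.2)⁻¹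

theorem analyticAt_reducedFrame (i : Fin 5) :
    AnalyticAt ℝ (adaptedFrame L (normB L) (normC L) (normD L) (normE L) i) x :=
  analyticAt_adaptedFrame hL (analyticAt_normB hL h) (analyticAt_normC hL h)
    (analyticAt_normD hL h) (analyticAt_normE hL h) i

theorem analyticAt_lamCoeff {a : ℂ} (ha : a ≠ 0) (i j : Fin 5) :
    AnalyticAt ℝ (lamCoeff L i j) (x, a) := by
  have h1 := analyticAt_dFormC (analyticAt_lamBase hL h) (analyticAt_reducedFrame hL h i)
    (analyticAt_reducedFrame hL h j)
  refine (AnalyticAt.comp (f := fun p : Tot => p.1) (x := (x, a)) h1 analyticAt_fst).mul ?_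
  exact ((analyticAt_weight i _).mul (analyticAt_weight j _)).inv
    (mul_ne_zero (weight_ne_zero i ha) (weight_ne_zero j ha))

/-- Since da/a is closed, only the derivative of the form pulled back from the base remains, and the
five lifted forms span the base directions. -/
theorem dForm_lam {a : ℂ} (ha : a ≠ 0) (X Y : Tot) : dForm (lam L) (x, a) X Y =
    ∑ i, ∑ j ∈ Finset.Ioi i, lamCoeff L i j (x, a) *
      (lifted L i (x, a) ⋏ lifted L j (x, a)) X Y := by
  have hl := analyticAt_lamBase hL h
  have hinv : HasFDerivAt (fun q : Tot => q.2⁻¹)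
      ((-(a ^ 2)⁻¹) • ContinuousLinearMap.snd ℝ Base ℂ) (x, a) := by
    have h1 : HasFDerivAt (fun z : ℂ => z⁻¹) _ a := (hasDerivAt_inv ha).hasFDerivAt.restrictScalars ℝ
    have h2 := h1.comp (x, a) (hasFDerivAt_snd (𝕜 := ℝ) (p := ((x, a) : Tot)))
    refine h2.congr_fderiv (ContinuousLinearMap.ext fun X => ?_)
    simp [mul_comm]
  have hsnd : DifferentiableAt ℝ
      (fun _ : Tot => (ContinuousLinearMap.snd ℝ Base ℂ : Tot →L[ℝ] ℂ)) (x, a) :=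
    differentiableAt_const _
  have hz : dForm (fun _ : Tot => (ContinuousLinearMap.snd ℝ Base ℂ : Tot →L[ℝ] ℂ)) (x, a) X Y =
      0 := by
    rw [dForm_apply hsnd]
    simp
  rw [show lam L = _ from funext lam_eq, dForm_add (hinv.differentiableAt.fun_smul hsnd)
    (analyticAt_pull (p := (x, a)) hl).differentiableAt,
    dForm_smul hinv.differentiableAt hsnd]
  simp only [Pi.add_apply, Pi.smul_apply, hz, wedge, hinv.fderiv]
  rw [dForm_pull hl.differentiableAt, dForm_adapted (b := normB L) (c := normC L) (d := normD L)
      (e := normE L) h hl.differentiableAt]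
  have : ∀ i j, lamCoeff L i j (x, a) * (lifted L i (x, a) X * lifted L j (x, a) Y -
      lifted L i (x, a) Y * lifted L j (x, a) X) =
      dFormC (lamBase L) x (adaptedFrame L (normB L) (normC L) (normD L) (normE L) i x)
        (adaptedFrame L (normB L) (normC L) (normD L) (normE L) j x) *
      (reduced L i x X.1 * reduced L j x Y.1 - reduced L i x Y.1 * reduced L j x X.1) := by
    intro i j
    have h1 := weight_ne_zero i ha
    have h2 := weight_ne_zero j ha
    simp only [lamCoeff, lifted_eq, _root_.smul_apply, smul_eq_mul, pull_apply]
    field_simp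
  simp only [this, reduced, wedge]
  simp
  ring

/-! ### The absolute parallelism -/

omit hL h in
theorem analyticAt_conjForm {ω : Tot → Tot →L[ℝ] ℂ} {p : Tot} (hω : AnalyticAt ℝ ω p) :
    AnalyticAt ℝ (conjForm ω) p :=
  ((ContinuousLinearMap.compL ℝ Tot ℂ ℂ (Complex.conjCLE : ℂ →L[ℝ] ℂ)).analyticAt _).comp hω

theorem analyticAt_lam {a : ℂ} (ha : a ≠ 0) : AnalyticAt ℝ (lam L) (x, a) := by
  rw [show lam L = _ from funext lam_eq]
  refine AnalyticAt.add (AnalyticAt.smul (AnalyticAt.inv analyticAt_snd ha) analyticAt_const) ?_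
  exact analyticAt_pull (p := (x, a)) (analyticAt_lamBase hL h)

theorem analyticAt_sevenForms {a : ℂ} (ha : a ≠ 0) (i : Fin 7) :
    AnalyticAt ℝ (sevenForms L i) (x, a) := by
  have h1 := analyticAt_lam hL h ha
  have h2 := analyticAt_lifted hL h a
  fin_cases i
  exacts [analyticAt_conjForm h1, h1, analyticAt_conjForm (h2 1), h2 1, h2 2,
    analyticAt_conjForm (h2 4), h2 4]

theorem sevenForms_eq (a : ℂ) : (fun i => sevenForms L i (x, a)) =
    ![conjForm (lam L) (x, a), lam L (x, a), lifted L 0 (x, a), lifted L 1 (x, a),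
      lifted L 2 (x, a), lifted L 3 (x, a), lifted L 4 (x, a)] := by
  funext i
  have h5 := fiveForms_eq hL h a
  fin_cases i
  exacts [rfl, rfl, h5 0, rfl, rfl, h5 3, rfl]

omit hL in
theorem eq_zero_of_sum_lifted {a : ℂ} (ha : a ≠ 0) (c : Fin 5 → ℂ)
    (h0 : ∀ v : Base, ∑ i, c i * lifted L i (x, a) (v, 0) = 0) (j : Fin 5) : c j = 0 := by
  have h1 : ∑ i, (c i * weight i a) • reduced L i x = 0 := by
    ext1 v
    have := h0 v
    simp only [lifted_eq, _root_.smul_apply, smul_eq_mul, pull_apply] at this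
    simp [this, mul_assoc]
  have h2 := cext_sum Finset.univ (fun i => (c i * weight i a) • reduced L i x)
    (adaptedFrame L (normB L) (normC L) (normD L) (normE L) j x)
  rw [h1] at h2
  simp only [cext_smul, reduced, cext_adapted_adaptedFrame h] at h2
  simp [cext_apply, weight_ne_zero j ha] at h2
  exact h2

/-- On vertical vectors only λ and λ̄ survive. The vectors a and ia give λ the values 1 and i, which
separates it from its conjugate; horizontal vectors then leave a relation among five dual forms. -/
theorem linearIndependent_sevenForms {a : ℂ} (ha : a ≠ 0) :
    LinearIndependent ℂ (fun i => sevenForms L i (x, a)) := by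
  rw [sevenForms_eq hL h, Fintype.linearIndependent_iff]
  intro c hc
  have hX : ∀ X : Tot, c 0 * conj (lam L (x, a) X) + c 1 * lam L (x, a) X +
      ∑ i : Fin 5, c (Fin.natAdd 2 i) * lifted L i (x, a) X = 0 := by
    intro X
    have := congrArg (fun ω : Tot →L[ℝ] ℂ => ω X) hc
    simp only [Fin.sum_univ_succ (n := 6), Fin.sum_univ_six] at this
    simp only [Fin.sum_univ_five]
    simp [conjForm] at this
    rw [← this]
    simp
    ring_nf
  have e1 := hX (0, a)
  have e2 := hX (0, Complex.I * a)
  simp [lam_apply, lifted_eq, pull_apply, ha] at e1 e2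
  have c0 : c 0 = 0 := by
    linear_combination (1 / 2) * e1 + (Complex.I / 2) * e2 + (c 0 / 2 - c 1 / 2) * Complex.I_mul_I
  have c1 : c 1 = 0 := by linear_combination e1 - c0
  have c5 := eq_zero_of_sum_lifted h ha (fun i => c (Fin.natAdd 2 i)) (by
    intro v
    simpa [c0, c1] using hX (v, 0))
  intro i
  fin_cases i
  exacts [c0, c1, c5 0, c5 1, c5 2, c5 3, c5 4]

end

/-- Evaluation on a real basis embeds the complexified cotangent space into a complex space of
dimension 7. -/
theorem span_eq_top_of_linearIndependent {Θ : Fin 7 → Tot →L[ℝ] ℂ}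
    (hΘ : LinearIndependent ℂ Θ) : Submodule.span ℂ (Set.range Θ) = ⊤ := by
  let ev : (Tot →L[ℝ] ℂ) →ₗ[ℂ] (Fin 5 ⊕ Fin 2 → ℂ) :=
    { toFun := fun ω => Sum.elim (fun k => ω (Pi.single k 1, 0)) (fun i => ω (0, ![1, Complex.I] i))
      map_add' := fun ω η => by funext i; rcases i with i | i <;> simp
      map_smul' := fun c ω => by funext i; rcases i with i | i <;> simp }
  have hinj : Function.Injective ev := by
    rw [injective_iff_map_eq_zero]
    intro ω hω
    have h1 : ∀ k, ω (Pi.single k 1, 0) = 0 := fun k => congrFun hω (Sum.inl k)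
    have h2 : ω (0, 1) = 0 := congrFun hω (Sum.inr 0)
    have h3 : ω (0, Complex.I) = 0 := congrFun hω (Sum.inr 1)
    refine ContinuousLinearMap.ext fun X => ?_
    have : X = (∑ k, X.1 k • ((Pi.single k 1 : Base), (0 : ℂ))) + X.2.re • ((0 : Base), (1 : ℂ)) +
        X.2.im • ((0 : Base), Complex.I) := by
      ext1
      · simp [Prod.fst_sum]
        exact pi_eq_sum_univ' X.1
      · simp [Prod.snd_sum]
    rw [this]
    simp only [map_add, map_sum, map_smul, h1, h2, h3]
    simp
  have : FiniteDimensional ℂ (Tot →L[ℝ] ℂ) := FiniteDimensional.of_injective ev hinj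
  refine hΘ.span_eq_top_of_card_eq_finrank' (le_antisymm hΘ.fintype_card_le_finrank ?_)
  have := LinearMap.finrank_le_finrank_of_injective hinj
  simpa using this

theorem isAbsoluteParallelism_sevenForms {L : Base → CVec} {U : Set Base}
    (hU : Good L U) : IsAbsoluteParallelism (sevenForms L) (U ×ˢ {a : ℂ | a ≠ 0}) := by
  refine ⟨fun i => ?_, ?_⟩
  · rintro ⟨x, a⟩ ⟨hx, ha⟩
    exact analyticAt_sevenForms (hU.analytic x hx) (hU.det_ne x hx) ha i
  · rintro ⟨x, a⟩ ⟨hx, ha⟩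
    have := linearIndependent_sevenForms (hU.analytic x hx) (hU.det_ne x hx) ha
    exact ⟨this, span_eq_top_of_linearIndependent this⟩

end ClassIII

namespace ClassIII

/-! ### Change of generator -/

theorem conj_groupMatrix_apply (a b c d e : ℂ) (i j : Fin 5) :
    conj (groupMatrix a b c d e i j) = groupMatrix a b c d e (conjIdx i) (conjIdx j) := by
  fin_cases i <;> fin_cases j <;> simp [groupMatrix, conjIdx] <;> ring

theorem groupMatrix_eq_weight_mul {a : ℂ} (ha : a ≠ 0) (b c d e : ℂ) (i j : Fin 5) :
    groupMatrix a b c d e i j = weight i a * groupMatrix 1 (b / (a * conj a))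
      (c / (a * a * conj a)) (d / (a * a * conj a)) (e / (a * a * conj a)) i j := by
  have ha' : conj a ≠ 0 := by simpa using ha
  fin_cases i <;> fin_cases j <;> simp [groupMatrix, weight] <;> field_simp

section

variable {L : Base → CVec} {f : Base → ℂ} {x : Base}

/-- The coefficient `b` in the change of frame. -/
noncomputable def scaleB (L : Base → CVec) (f : Base → ℂ) (y : Base) : ℂ :=
  -Complex.I * conj (f y) * cderiv f y (conjField L y)

theorem analyticAt_scaleB (hL : AnalyticAt ℝ L x) (hf : AnalyticAt ℝ f x) :
    AnalyticAt ℝ (scaleB L f) x :=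
  (analyticAt_const.mul (analyticAt_conj hf)).mul
    (analyticAt_cderiv hf (analyticAt_conjField hL))

theorem conjField_smulField (f : Base → ℂ) (L : Base → CVec) :
    conjField (fun y => f y • L y) = fun y => conj (f y) • conjField L y := by
  funext y k
  simp [conjField]

/-- Expand [fL, f̄L̄]. The two derivative terms are conjugate after multiplication by i, as reality
of T requires. -/
theorem fieldT_smulField (hL : AnalyticAt ℝ L x) (hf : AnalyticAt ℝ f x) :
    fieldT (fun y => f y • L y) x = (f x * conj (f x)) • fieldT L x +
      conj (scaleB L f x) • conjField L x + scaleB L f x • L x := by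
  have hc := cderiv_conj hf.differentiableAt (conjField L x)
  have hLL : (fun k => conj (conjField L x k)) = L x := by
    funext k
    simp [conjField]
  rw [hLL] at hc
  rw [fieldT, conjField_smulField, bracket_smul_smul hf.differentiableAt
    (analyticAt_conj hf).differentiableAt hL.differentiableAt
    (analyticAt_conjField hL).differentiableAt, bracket_L_conjL, hc, scaleB]
  simp only [map_mul, map_neg, Complex.conj_I, Complex.conj_conj]
  funext k
  simp only [Pi.add_apply, Pi.sub_apply, Pi.smul_apply, smul_eq_mul]
  linear_combination (-(f x * conj (f x)) * fieldT L x k) * Complex.I_mul_I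

/-- This is where the initial structure group comes from: its matrices record the freedom of the
generator. The parameters are read off from brackets of fL and remain analytic. -/
theorem frame_smulField (hL : AnalyticAt ℝ L x) (hf : AnalyticAt ℝ f x) :
    ∃ b c d e : Base → ℂ, AnalyticAt ℝ b x ∧ AnalyticAt ℝ c x ∧ AnalyticAt ℝ d x ∧
      AnalyticAt ℝ e x ∧ ∀ᶠ y in 𝓝 x, ∀ i, frame (fun y => f y • L y) i y =
        ∑ j, groupMatrix (f y) (b y) (c y) (d y) (e y) i j • frame L j y := by
  set L' : Base → CVec := fun y => f y • L y with hL'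
  have aL' : AnalyticAt ℝ L' x := hf.smul hL
  have ab := analyticAt_scaleB hL hf
  have ab' := analyticAt_conj ab
  have aw : AnalyticAt ℝ (fun y => f y * conj (f y)) x := hf.mul (analyticAt_conj hf)
  refine ⟨scaleB L f, fun y => f y * (cderiv (fun z => f z * conj (f z)) y (L y) -
      Complex.I * conj (scaleB L f y)),
    fun y => f y * cderiv (fun z => conj (scaleB L f z)) y (L y),
    fun y => f y * cderiv (scaleB L f) y (L y) - cderiv f y (fieldT L' y),
    ab, hf.mul ((analyticAt_cderiv aw hL).sub (analyticAt_const.mul ab')),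
    hf.mul (analyticAt_cderiv ab' hL),
    (hf.mul (analyticAt_cderiv ab hL)).sub (analyticAt_cderiv hf (analyticAt_fieldT aL')), ?_⟩
  filter_upwards [hL.eventually_analyticAt, hf.eventually_analyticAt] with y hL hf
  have aL' : AnalyticAt ℝ L' y := hf.smul hL
  have ab := analyticAt_scaleB hL hf
  have ab' := analyticAt_conj ab
  have aw : AnalyticAt ℝ (fun y => f y * conj (f y)) y := hf.mul (analyticAt_conj hf)
  have hT := fieldT_smulField hL hf
  have hS : fieldS L' y = (f y * f y * conj (f y)) • fieldS L y +
      (f y * (cderiv (fun z => f z * conj (f z)) y (L y) -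
        Complex.I * conj (scaleB L f y))) • fieldT L y +
      (f y * cderiv (fun z => conj (scaleB L f z)) y (L y)) • conjField L y +
      (f y * cderiv (scaleB L f) y (L y) - cderiv f y (fieldT L' y)) • L y := by
    have e : fieldT L' =ᶠ[𝓝 y] fun z => ∑ i : Fin 3,
        (![fun z => f z * conj (f z), fun z => conj (scaleB L f z), scaleB L f] :
          Fin 3 → Base → ℂ) i z • (![fieldT L, conjField L, L] : Fin 3 → Base → CVec) i z := by
      filter_upwards [hL.eventually_analyticAt, hf.eventually_analyticAt] with z h1 h2
      rw [hL', fieldT_smulField h1 h2]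
      simp [Fin.sum_univ_three]
    have dL := hL.differentiableAt
    have dLb := (analyticAt_conjField hL).differentiableAt
    have dT := (analyticAt_fieldT hL).differentiableAt
    rw [fieldS, hL', bracket_smul_left hf.differentiableAt hL.differentiableAt, ← hL',
      bracket_congr (Filter.EventuallyEq.refl _ L) e, bracket_sum_right]
    · simp only [Fin.sum_univ_three, Matrix.cons_val_zero, Matrix.cons_val_one, Matrix.cons_val,
        bracket_L_conjL, bracket_self]
      rw [show bracket L (fieldT L) y = fieldS L y from rfl]
      module
    · intro i
      fin_cases i
      exacts [aw.differentiableAt, ab'.differentiableAt, ab.differentiableAt]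
    · intro i
      fin_cases i
      exacts [dT, dLb, dL]
  -- Only S, T and L require a computation; the remaining rows follow by conjugation.
  have main : ∀ i : Fin 5, (i = 1 ∨ i = 2 ∨ i = 4) → frame L' i y =
      ∑ j, groupMatrix (f y) (scaleB L f y) (f y * (cderiv (fun z => f z * conj (f z)) y (L y) -
        Complex.I * conj (scaleB L f y)))
      (f y * cderiv (fun z => conj (scaleB L f z)) y (L y))
      (f y * cderiv (scaleB L f) y (L y) - cderiv f y (fieldT L' y)) i j • frame L j y := by
    rintro i (rfl | rfl | rfl)
    · simpa [Fin.sum_univ_five, groupMatrix, frame] using hS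
    · simpa [Fin.sum_univ_five, groupMatrix, frame] using hT
    · simp [Fin.sum_univ_five, groupMatrix, frame, hL']
  have conj_main : ∀ i : Fin 5, (i = 1 ∨ i = 2 ∨ i = 4) → frame L' (conjIdx i) y =
      ∑ j, groupMatrix (f y) (scaleB L f y) (f y * (cderiv (fun z => f z * conj (f z)) y (L y) -
        Complex.I * conj (scaleB L f y)))
      (f y * cderiv (fun z => conj (scaleB L f z)) y (L y))
      (f y * cderiv (scaleB L f) y (L y) - cderiv f y (fieldT L' y)) (conjIdx i) j •
        frame L j y := by
    intro i hi
    rw [← conjField_frame aL', ← sum_conjIdx]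
    funext k
    simp only [conjField, main i hi, Finset.sum_apply, Pi.smul_apply, smul_eq_mul, map_sum,
      map_mul, conj_groupMatrix_apply]
    refine Finset.sum_congr rfl fun j _ => ?_
    rw [← conjField_frame hL]
    rfl
  intro i
  fin_cases i
  exacts [conj_main 1 (by simp), main 1 (by simp), main 2 (by simp), conj_main 4 (by simp),
    main 4 (by simp)]

theorem frameMatrix_of_frame_eq {L L' : Base → CVec} {y : Base} {g : Matrix (Fin 5) (Fin 5) ℂ}
    (h : ∀ i, frame L' i y = ∑ j, g i j • frame L j y) :
    frameMatrix L' y = frameMatrix L y * gᵀ := by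
  ext k i
  simp [frameMatrix, h, Matrix.mul_apply, mul_comm]

theorem coframe₀_of_frame_eq {L L' : Base → CVec} {y : Base} {g : Matrix (Fin 5) (Fin 5) ℂ}
    (h : ∀ i, frame L' i y = ∑ j, g i j • frame L j y) (h' : (frameMatrix L' y).det ≠ 0)
    (h0 : (frameMatrix L y).det ≠ 0) (j : Fin 5) :
    coframe₀ L j y = ∑ i, gᵀ j i • coframe₀ L' i y := by
  refine cext_injective fun v => ?_
  rw [cext_sum]
  conv_lhs => rw [← sum_comp_frame h' v]
  simp only [cext_smul, map_sum, map_smul, cext_coframe₀, h, Matrix.transpose_apply, smul_eq_mul]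
  refine Finset.sum_congr rfl fun i _ => ?_
  simp only [comp_frame h0]
  simp [mul_comm]

theorem det_smulField (hL : AnalyticAt ℝ L x) (h : (frameMatrix L x).det ≠ 0)
    (hf : AnalyticAt ℝ f x) (f0 : f x ≠ 0) :
    (frameMatrix (fun y => f y • L y) x).det ≠ 0 := by
  obtain ⟨b, c, d, e, -, -, -, -, H⟩ := frame_smulField hL hf
  rw [frameMatrix_of_frame_eq H.self_of_nhds, Matrix.det_mul, Matrix.det_transpose]
  exact mul_ne_zero h (isUnit_groupMatrix f0 _ _ _ _).ne_zero

/-- Composing the inverse of the given unipotent matrix with the change of frame gives a group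
element with diagonal f. Splitting off the weights leaves a unipotent matrix. -/
theorem adaptedFrame_smulField (hL : AnalyticAt ℝ L x)
    (hf : AnalyticAt ℝ f x) (f0 : f x ≠ 0) {b' c' d' e' : Base → ℂ} (hb' : AnalyticAt ℝ b' x)
    (hc' : AnalyticAt ℝ c' x) (hd' : AnalyticAt ℝ d' x) (he' : AnalyticAt ℝ e' x) :
    ∃ b c d e : Base → ℂ, AnalyticAt ℝ b x ∧ AnalyticAt ℝ c x ∧ AnalyticAt ℝ d x ∧
      AnalyticAt ℝ e x ∧ ∀ᶠ y in 𝓝 x, ∀ i, adaptedFrame (fun y => f y • L y) b' c' d' e' i y =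
        weight i (f y) • adaptedFrame L b c d e i y := by
  obtain ⟨b, c, d, e, hb, hc, hd, he, H⟩ := frame_smulField hL hf
  have hf' := analyticAt_conj hf
  have f0' : conj (f x) ≠ 0 := by simpa using f0
  have n1 : f x * conj (f x) ≠ 0 := mul_ne_zero f0 f0'
  have n2 : f x * f x * conj (f x) ≠ 0 := mul_ne_zero (mul_ne_zero f0 f0) f0'
  have kb' := analyticAt_conj hb'
  have kb := analyticAt_conj hb
  set b₁ : Base → ℂ := fun y => (b y - b' y * f y) / (f y * conj (f y)) with hb₁
  set c₁ : Base → ℂ := fun y => (c y - c' y * (f y * conj (f y))) / (f y * f y * conj (f y))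
    with hc₁
  set d₁ : Base → ℂ := fun y => (d y - c' y * conj (b y) + (-d' y + c' y * conj (b' y)) *
    conj (f y)) / (f y * f y * conj (f y)) with hd₁
  set e₁ : Base → ℂ := fun y => (e y - c' y * b y + (-e' y + c' y * b' y) * f y) /
    (f y * f y * conj (f y)) with he₁
  have ab₁ : AnalyticAt ℝ b₁ x :=
    (hb.sub (hb'.mul hf)).div (hf.mul hf') n1
  have ac₁ : AnalyticAt ℝ c₁ x :=
    (hc.sub (hc'.mul (hf.mul hf'))).div ((hf.mul hf).mul hf') n2
  have ad₁ : AnalyticAt ℝ d₁ x :=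
    ((hd.sub (hc'.mul kb)).add ((hd'.neg.add (hc'.mul kb')).mul hf')).div
      ((hf.mul hf).mul hf') n2
  have ae₁ : AnalyticAt ℝ e₁ x :=
    ((he.sub (hc'.mul hb)).add ((he'.neg.add (hc'.mul hb')).mul hf)).div
      ((hf.mul hf).mul hf') n2
  have kb₁ := analyticAt_conj ab₁
  -- Adapted frames are defined through the inverse matrix, so the witnesses are the parameters of
  -- the inverse of the unipotent factor.
  refine ⟨fun y => -b₁ y, fun y => -c₁ y, fun y => -d₁ y + c₁ y * conj (b₁ y),
    fun y => -e₁ y + c₁ y * b₁ y, ab₁.neg, ac₁.neg, ad₁.neg.add (ac₁.mul kb₁),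
    ae₁.neg.add (ac₁.mul ab₁), ?_⟩
  filter_upwards [H, hf.continuousAt.eventually_ne f0] with y H f0 i
  have hinv : (groupMatrix 1 (-b₁ y) (-c₁ y) (-d₁ y + c₁ y * conj (b₁ y))
      (-e₁ y + c₁ y * b₁ y))⁻¹ = groupMatrix 1 (b₁ y) (c₁ y) (d₁ y) (e₁ y) := by
    rw [← groupMatrix_inv, Matrix.nonsing_inv_nonsing_inv _ (isUnit_groupMatrix one_ne_zero _ _ _ _)]
  have hmul : (groupMatrix 1 (b' y) (c' y) (d' y) (e' y))⁻¹ *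
      groupMatrix (f y) (b y) (c y) (d y) (e y) = groupMatrix (f y) (b y - b' y * f y)
      (c y - c' y * (f y * conj (f y)))
      (d y - c' y * conj (b y) + (-d' y + c' y * conj (b' y)) * conj (f y))
      (e y - c' y * b y + (-e' y + c' y * b' y) * f y) := by
    rw [groupMatrix_inv, groupMatrix_mul]
    congr 1 <;> simp <;> ring
  simp only [adaptedFrame, hinv, H, Finset.smul_sum, smul_smul]
  rw [Finset.sum_comm]
  refine Finset.sum_congr rfl fun j _ => ?_
  rw [← Finset.sum_smul, ← Matrix.mul_apply, hmul, groupMatrix_eq_weight_mul f0]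

theorem adapted_of_adaptedFrame {L L' : Base → CVec} {y : Base} {b c d e b' c' d' e' : Base → ℂ}
    {w : Fin 5 → ℂ} (h : (frameMatrix L y).det ≠ 0) (h' : (frameMatrix L' y).det ≠ 0)
    (H : ∀ i, adaptedFrame L' b' c' d' e' i y = w i • adaptedFrame L b c d e i y) (k : Fin 5)
    (v : CVec) : w k * cext (adapted L' b' c' d' e' k y) v = cext (adapted L b c d e k y) v := by
  conv_rhs => rw [← sum_adapted_adaptedFrame (b := b') (c := c') (d := d') (e := e') h' v]
  simp [H, cext_adapted_adaptedFrame h, mul_comm]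

theorem cderiv_weight (hf : DifferentiableAt ℝ f x) (f0 : f x ≠ 0) (i : Fin 5) (v : CVec) :
    cderiv (fun y => weight i (f y)) x v = weight i (f x) * ((weightExp i).1 *
      (cderiv f x v / f x) + (weightExp i).2 *
        (cderiv (fun y => conj (f y)) x v / conj (f x))) := by
  have f0' : conj (f x) ≠ 0 := by simpa using f0
  have hf' : DifferentiableAt ℝ (fun y => conj (f y)) x :=
    (Complex.conjCLE : ℂ →L[ℝ] ℂ).differentiableAt.comp x hf
  fin_cases i
  · have : cderiv (fun y => weight 0 (f y)) x v = _ :=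
      cderiv_mul (hf.fun_mul hf') hf' v
    simp only [Fin.zero_eta, this]
    rw [cderiv_mul hf hf']
    simp [weight, weightExp]
    field_simp
    ring
  · have : cderiv (fun y => weight 1 (f y)) x v = _ :=
      cderiv_mul (hf.fun_mul hf) hf' v
    simp only [Fin.mk_one, this]
    rw [cderiv_mul hf hf]
    simp [weight, weightExp]
    field_simp
    ring
  · have : cderiv (fun y => weight 2 (f y)) x v = _ := cderiv_mul hf hf' v
    simp only [Fin.reduceFinMk, this]
    simp [weight, weightExp]
    field_simp
    ring
  · simp [weight, weightExp]
    field_simp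
  · simp [weight, weightExp]
    field_simp

theorem analyticAt_weight_comp (hf : AnalyticAt ℝ f x) (i : Fin 5) :
    AnalyticAt ℝ (fun y => weight i (f y)) x := by
  have hf' := analyticAt_conj hf
  fin_cases i
  exacts [(hf.mul hf').mul hf', (hf.mul hf).mul hf', hf.mul hf', hf', hf]

/-- Rescaling frame fields by functions alters the bracket by multiples of the two fields
themselves. Hence derivatives of f enter only when the form is dual to one of them; all other
torsion is just rescaled. -/
theorem torsion_smulField (hL : AnalyticAt ℝ L x) (h : (frameMatrix L x).det ≠ 0)
    (hf : AnalyticAt ℝ f x) (f0 : f x ≠ 0) {b c d e b' c' d' e' : Base → ℂ}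
    (hb : AnalyticAt ℝ b x)
    (hc : AnalyticAt ℝ c x) (hd : AnalyticAt ℝ d x) (he : AnalyticAt ℝ e x)
    (hb' : AnalyticAt ℝ b' x)
    (hc' : AnalyticAt ℝ c' x) (hd' : AnalyticAt ℝ d' x) (he' : AnalyticAt ℝ e' x)
    (H : ∀ᶠ y in 𝓝 x, ∀ i, adaptedFrame (fun y => f y • L y) b' c' d' e' i y =
        weight i (f y) • adaptedFrame L b c d e i y) (k i j : Fin 5) :
    weight k (f x) * torsion (fun y => f y • L y) b' c' d' e' k i j x =
      weight i (f x) * weight j (f x) * torsion L b c d e k i j x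
      - (if k = j then weight i (f x) *
          cderiv (fun y => weight j (f y)) x (adaptedFrame L b c d e i x) else 0)
      + (if k = i then weight j (f x) *
          cderiv (fun y => weight i (f y)) x (adaptedFrame L b c d e j x) else 0) := by
  have h' := det_smulField hL h hf f0
  have aw := fun i => (analyticAt_weight_comp hf i).differentiableAt
  have aE := fun i => (analyticAt_adaptedFrame hL hb hc hd he i).differentiableAt
  rw [torsion_eq (hf.fun_smul hL) h' hb' hc' hd' he', mul_neg,
    adapted_of_adaptedFrame h h' H.self_of_nhds, bracket_congr (H.mono fun y hy => hy i)
      (H.mono fun y hy => hy j), bracket_smul_smul (aw i) (aw j) (aE i) (aE j),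
    torsion_eq hL h hb hc hd he]
  simp only [map_add, map_sub, map_smul, cext_adapted_adaptedFrame h, smul_eq_mul]
  split_ifs <;> ring

/-! ### Torsion under change of generator, according to coincidence of indices. -/

section

variable (hL : AnalyticAt ℝ L x) (h : (frameMatrix L x).det ≠ 0)
    (hf : AnalyticAt ℝ f x) (f0 : f x ≠ 0) {b c d e b' c' d' e' : Base → ℂ}
    (hb : AnalyticAt ℝ b x)
    (hc : AnalyticAt ℝ c x) (hd : AnalyticAt ℝ d x) (he : AnalyticAt ℝ e x)
    (hb' : AnalyticAt ℝ b' x)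
    (hc' : AnalyticAt ℝ c' x) (hd' : AnalyticAt ℝ d' x) (he' : AnalyticAt ℝ e' x)
    (H : ∀ᶠ y in 𝓝 x, ∀ i, adaptedFrame (fun y => f y • L y) b' c' d' e' i y =
        weight i (f y) • adaptedFrame L b c d e i y)
include hL h hf f0 hb hc hd he hb' hc' hd' he' H

theorem torsion_smulField_ne {k i j : Fin 5} (hi : k ≠ i) (hj : k ≠ j) :
    weight k (f x) * torsion (fun y => f y • L y) b' c' d' e' k i j x =
      weight i (f x) * weight j (f x) * torsion L b c d e k i j x := by
  rw [torsion_smulField hL h hf f0 hb hc hd he hb' hc' hd' he' H, if_neg hi, if_neg hj]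
  ring

theorem torsion_smulField_left {i j : Fin 5} (hij : i ≠ j) :
    torsion (fun y => f y • L y) b' c' d' e' i i j x =
      weight j (f x) * (torsion L b c d e i i j x + ((weightExp i).1 *
        (cderiv f x (adaptedFrame L b c d e j x) / f x) + (weightExp i).2 *
        (cderiv (fun y => conj (f y)) x (adaptedFrame L b c d e j x) / conj (f x)))) := by
  have := torsion_smulField hL h hf f0 hb hc hd he hb' hc' hd' he' H i i j
  rw [if_neg hij, if_pos rfl, cderiv_weight hf.differentiableAt f0] at this
  refine mul_left_cancel₀ (weight_ne_zero i f0) ?_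
  rw [this]
  ring

theorem torsion_smulField_right {i j : Fin 5} (hij : j ≠ i) :
    torsion (fun y => f y • L y) b' c' d' e' j i j x =
      weight i (f x) * (torsion L b c d e j i j x - ((weightExp j).1 *
        (cderiv f x (adaptedFrame L b c d e i x) / f x) + (weightExp j).2 *
        (cderiv (fun y => conj (f y)) x (adaptedFrame L b c d e i x) / conj (f x)))) := by
  have := torsion_smulField hL h hf f0 hb hc hd he hb' hc' hd' he' H j i j
  rw [if_neg hij, if_pos rfl, cderiv_weight hf.differentiableAt f0] at this
  refine mul_left_cancel₀ (weight_ne_zero j f0) ?_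
  rw [this]
  ring

end

theorem adaptedFrame_congr {b c d e b' c' d' e' : Base → ℂ} {y : Base} (hb : b y = b' y)
    (hc : c y = c' y) (hd : d y = d' y) (he : e y = e' y) (i : Fin 5) :
    adaptedFrame L b c d e i y = adaptedFrame L b' c' d' e' i y := by
  simp only [adaptedFrame, hb, hc, hd, he]

theorem conj_cderiv_adaptedFrame (hL : AnalyticAt ℝ L x) (hf : DifferentiableAt ℝ f x)
    {b c d e : Base → ℂ} (i : Fin 5) : conj (cderiv f x (adaptedFrame L b c d e i x)) =
      cderiv (fun y => conj (f y)) x (adaptedFrame L b c d e (conjIdx i) x) := by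
  rw [← cderiv_conj hf, ← conjField_adaptedFrame hL]
  rfl

/-- The reduced frame is equivariant under a change of generator. -/
theorem reducedFrame_smulField (hL : AnalyticAt ℝ L x) (h : (frameMatrix L x).det ≠ 0)
    (hf : AnalyticAt ℝ f x) (f0 : f x ≠ 0) : ∀ᶠ y in 𝓝 x, ∀ i,
      adaptedFrame (fun y => f y • L y) (normB (fun y => f y • L y)) (normC (fun y => f y • L y))
        (normD (fun y => f y • L y)) (normE (fun y => f y • L y)) i y =
      weight i (f y) • adaptedFrame L (normB L) (normC L) (normD L) (normE L) i y := by
  set L' : Base → CVec := fun y => f y • L y with hL'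
  have aL' : AnalyticAt ℝ L' x := hf.smul hL
  have h' := det_smulField hL h hf f0
  obtain ⟨b, c, d, e, hb, hc, hd, he, H⟩ := adaptedFrame_smulField hL hf f0
    (analyticAt_normB aL' h') (analyticAt_normC aL' h') (analyticAt_normD aL' h')
    (analyticAt_normE aL' h')
  -- The normalized frame of fL, rescaled, is some adapted frame of L. It inherits the three
  -- vanishing conditions, and in the fourth both sides acquire the same derivative terms, so
  -- uniqueness identifies it with the reduced frame.
  obtain ⟨eb, ec, ed, ee⟩ := eq_norm_of_torsion hL h hb hc hd he (by
    filter_upwards [H.eventually_nhds, hL.eventually_analyticAt, eventually_det_ne hL h,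
      hf.eventually_analyticAt, hf.continuousAt.eventually_ne f0, hb.eventually_analyticAt,
      hc.eventually_analyticAt, hd.eventually_analyticAt, he.eventually_analyticAt]
      with y H hL h hf f0 hb hc hd he
    have aL' : AnalyticAt ℝ L' y := hf.smul hL
    have h' := det_smulField hL h hf f0
    have f0' : conj (f y) ≠ 0 := by simpa using f0
    have nB := analyticAt_normB aL' h'
    have nC := analyticAt_normC aL' h'
    have nD := analyticAt_normD aL' h'
    have nE := analyticAt_normE aL' h'
    have w := fun i => weight_ne_zero i f0
    have t1 := torsion_smulField_ne hL h hf f0 hb hc hd he nB nC nD nE H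
      (k := 1) (i := 0) (j := 4) (by decide) (by decide)
    have t2 := torsion_smulField_ne hL h hf f0 hb hc hd he nB nC nD nE H
      (k := 1) (i := 0) (j := 2) (by decide) (by decide)
    have t3 := torsion_smulField_ne hL h hf f0 hb hc hd he nB nC nD nE H
      (k := 2) (i := 0) (j := 4) (by decide) (by decide)
    have t4 := torsion_smulField_left hL h hf f0 hb hc hd he nB nC nD nE H
      (i := 2) (j := 4) (by decide)
    have t5 := torsion_smulField_left hL h hf f0 hb hc hd he nB nC nD nE H
      (i := 1) (j := 4) (by decide)
    have t6 := torsion_smulField_left hL h hf f0 hb hc hd he nB nC nD nE H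
      (i := 1) (j := 3) (by decide)
    change _ * redTorsion L' _ _ _ _ = _ at t1 t2 t3
    change redTorsion L' _ _ _ _ = _ at t4 t5 t6
    rw [redTorsion_1_0_4 aL' h'] at t1
    rw [redTorsion_1_0_2 aL' h'] at t2
    rw [redTorsion_2_0_4 aL' h'] at t3
    rw [redTorsion_2_2_4 aL' h', t5, t6] at t4
    simp [w] at t1 t2 t3
    refine ⟨t1, t2, t3, ?_⟩
    refine mul_left_cancel₀ (w 4) ?_
    have c1 := conj_cderiv_adaptedFrame (b := b) (c := c) (d := d) (e := e) hL
      hf.differentiableAt 3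
    have c2 := conj_cderiv_adaptedFrame (b := b) (c := c) (d := d) (e := e) hL
      (analyticAt_conj hf).differentiableAt 3
    simp only [Complex.conj_conj, show conjIdx 3 = 4 from rfl] at c1 c2
    rw [map_mul, conj_weight, show conjIdx 3 = 4 from rfl] at t4
    simp only [map_add, map_mul, map_div₀, c1, c2, Complex.conj_conj] at t4
    simp [weightExp, conj_two] at t4
    linear_combination -t4)
  filter_upwards [H, eb, ec, ed, ee] with y H eb ec ed ee i
  rw [H, adaptedFrame_congr eb ec ed ee]

theorem reduced_smulField (hL : AnalyticAt ℝ L x) (h : (frameMatrix L x).det ≠ 0)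
    (hf : AnalyticAt ℝ f x) (f0 : f x ≠ 0) (k : Fin 5) :
    weight k (f x) • reduced (fun y => f y • L y) k x = reduced L k x := by
  refine cext_injective fun v => ?_
  rw [cext_smul]
  exact adapted_of_adaptedFrame h (det_smulField hL h hf f0)
    (reducedFrame_smulField hL h hf f0).self_of_nhds k v

/-- The linear combinations defining the absorption cancel the derivatives of f̄ and leave exactly
one copy of df/f: λ behaves like a connection form. -/
theorem absorption_smulField (hL : AnalyticAt ℝ L x) (h : (frameMatrix L x).det ≠ 0)
    (hf : AnalyticAt ℝ f x) (f0 : f x ≠ 0) (i : Fin 5) :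
    absorption (fun y => f y • L y) x i = weight i (f x) * (absorption L x i -
      cderiv f x (adaptedFrame L (normB L) (normC L) (normD L) (normE L) i x) / f x) := by
  set L' : Base → CVec := fun y => f y • L y with hL'
  have aL' : AnalyticAt ℝ L' x := hf.smul hL
  have h' := det_smulField hL h hf f0
  have H := reducedFrame_smulField hL h hf f0
  have hb := analyticAt_normB hL h
  have hc := analyticAt_normC hL h
  have hd := analyticAt_normD hL h
  have he := analyticAt_normE hL h
  have nB := analyticAt_normB aL' h'
  have nC := analyticAt_normC aL' h'
  have nD := analyticAt_normD aL' h'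
  have nE := analyticAt_normE aL' h'
  have x1 := torsion_smulField_right hL h hf f0 hb hc hd he nB nC nD nE H
    (i := 0) (j := 1) (by decide)
  have y2 := torsion_smulField_right hL h hf f0 hb hc hd he nB nC nD nE H
    (i := 0) (j := 2) (by decide)
  have x5 := torsion_smulField_left hL h hf f0 hb hc hd he nB nC nD nE H
    (i := 1) (j := 2) (by decide)
  have x6 := torsion_smulField_left hL h hf f0 hb hc hd he nB nC nD nE H
    (i := 1) (j := 3) (by decide)
  have x7 := torsion_smulField_left hL h hf f0 hb hc hd he nB nC nD nE H
    (i := 1) (j := 4) (by decide)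
  change redTorsion L' _ _ _ _ = _ * (redTorsion L _ _ _ _ - _) at x1 y2
  change redTorsion L' _ _ _ _ = _ * (redTorsion L _ _ _ _ + _) at x5 x6 x7
  have cf := fun i => conj_cderiv_adaptedFrame (b := normB L) (c := normC L) (d := normD L)
    (e := normE L) hL hf.differentiableAt i
  have cg := fun i => conj_cderiv_adaptedFrame (b := normB L) (c := normC L) (d := normD L)
    (e := normE L) hL (analyticAt_conj hf).differentiableAt i
  simp only [Complex.conj_conj] at cg
  have i0 : conjIdx 0 = 1 := rfl
  have i2 : conjIdx 2 = 2 := rfl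
  have i3 : conjIdx 3 = 4 := rfl
  have i4 : conjIdx 4 = 3 := rfl
  fin_cases i
  · change redTorsion L' 1 0 1 x - redTorsion L' 2 0 2 x =
      _ * (redTorsion L 1 0 1 x - redTorsion L 2 0 2 x - _)
    rw [x1, y2]
    simp [weightExp]
    ring
  · change conj (2 * redTorsion L' 2 0 2 x - redTorsion L' 1 0 1 x) =
      _ * (conj (2 * redTorsion L 2 0 2 x - redTorsion L 1 0 1 x) - _)
    rw [x1, y2]
    simp only [map_add, map_sub, map_mul, map_div₀, cf, cg, conj_weight, i0, Complex.conj_conj,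
      conj_two]
    simp [weightExp, conj_two]
    ring
  · change (conj (redTorsion L' 1 1 2 x) - 2 * redTorsion L' 1 1 2 x) / 3 =
      _ * ((conj (redTorsion L 1 1 2 x) - 2 * redTorsion L 1 1 2 x) / 3 - _)
    rw [x5]
    simp only [map_add, map_mul, map_div₀, cf, cg, conj_weight, i2, Complex.conj_conj]
    simp [weightExp, conj_two]
    ring
  · change (conj (redTorsion L' 1 1 4 x) - 2 * redTorsion L' 1 1 3 x) / 3 =
      _ * ((conj (redTorsion L 1 1 4 x) - 2 * redTorsion L 1 1 3 x) / 3 - _)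
    rw [x6, x7]
    simp only [map_add, map_mul, map_div₀, cf, cg, conj_weight, i4, Complex.conj_conj]
    simp [weightExp, conj_two]
    ring
  · change (conj (redTorsion L' 1 1 3 x) - 2 * redTorsion L' 1 1 4 x) / 3 =
      _ * ((conj (redTorsion L 1 1 3 x) - 2 * redTorsion L 1 1 4 x) / 3 - _)
    rw [x6, x7]
    simp only [map_add, map_mul, map_div₀, cf, cg, conj_weight, i3, Complex.conj_conj]
    simp [weightExp, conj_two]
    ring

/-- Gauge law: the term -df/f cancels the contribution of f to da'/a' for a' = af. -/
theorem lamBase_smulField (hL : AnalyticAt ℝ L x) (h : (frameMatrix L x).det ≠ 0)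
    (hf : AnalyticAt ℝ f x) (f0 : f x ≠ 0) (v : Base) :
    lamBase (fun y => f y • L y) x v = lamBase L x v - fderiv ℝ f x v / f x := by
  have e1 : fderiv ℝ f x v = ∑ i, reduced L i x v *
      cderiv f x (adaptedFrame L (normB L) (normC L) (normD L) (normE L) i x) := by
    rw [← cext_toC, ← sum_adapted_adaptedFrame (b := normB L) (c := normC L) (d := normD L)
      (e := normE L) h (toC v), map_sum]
    simp only [map_smul, smul_eq_mul, cext_toC, cderiv_eq_cext]
    rfl
  rw [e1, Finset.sum_div]
  simp only [lamBase, _root_.sum_apply, _root_.smul_apply, smul_eq_mul]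
  rw [← Finset.sum_sub_distrib]
  refine Finset.sum_congr rfl fun i _ => ?_
  rw [absorption_smulField hL h hf f0, ← reduced_smulField hL h hf f0 i]
  simp only [_root_.smul_apply, smul_eq_mul]
  ring

end

end ClassIII

namespace ClassIII

/-! ### Naturality -/

/-- `h` is analytic at `x` and relates the generators `L` and `L'` of frames. -/
structure GenRelated (h : Base → Base) (L L' : Base → CVec) (x : Base) : Prop where
  map : AnalyticAt ℝ h x
  left : AnalyticAt ℝ L x
  det_left : (frameMatrix L x).det ≠ 0
  right : AnalyticAt ℝ L' (h x)
  det_right : (frameMatrix L' (h x)).det ≠ 0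
  rel : Related h L L' x

namespace GenRelated

variable {h : Base → Base} {L L' : Base → CVec} {x : Base}

theorem eventually (H : GenRelated h L L' x) : ∀ᶠ y in 𝓝 x, GenRelated h L L' y := by
  have hc := H.map.continuousAt
  filter_upwards [H.map.eventually_analyticAt, H.left.eventually_analyticAt,
    eventually_det_ne H.left H.det_left, hc.eventually H.right.eventually_analyticAt,
    hc.eventually (eventually_det_ne H.right H.det_right), H.rel.eventually_nhds]
    with y h1 h2 h3 h4 h5 h6
  exact ⟨h1, h2, h3, h4, h5, h6⟩

theorem frame (H : GenRelated h L L' x) (i : Fin 5) :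
    Related h (frame L i) (ClassIII.frame L' i) x := by
  have hT : Related h (fieldT L) (fieldT L') x :=
    (Related.bracket H.map H.left (analyticAt_conjField H.left) H.right
      (analyticAt_conjField H.right) H.rel (H.rel.conj H.map)).smul Complex.I
  have hS : Related h (fieldS L) (fieldS L') x :=
    Related.bracket H.map H.left (analyticAt_fieldT H.left) H.right
      (analyticAt_fieldT H.right) H.rel hT
  fin_cases i
  exacts [hS.conj H.map, hS, hT, H.rel.conj H.map, H.rel]

/-- Corresponding frame vectors are related, so components are unchanged. All pointwise naturality
statements reduce to this. -/
theorem comp_push (H : GenRelated h L L' x) (v : CVec) (i : Fin 5) :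
    comp L' (h x) (push h x v) i = comp L x v i := by
  conv_lhs => rw [← sum_comp_frame H.det_left v]
  rw [map_sum]
  simp only [map_smul]
  rw [Finset.sum_congr rfl fun j _ => by rw [← (H.frame j).self_of_nhds], comp_sum_frame H.det_right]

theorem coframe₀ (H : GenRelated h L L' x) (i : Fin 5) :
    (ClassIII.coframe₀ L' i (h x)).comp (fderiv ℝ h x) = ClassIII.coframe₀ L i x := by
  refine cext_injective fun v => ?_
  rw [cext_comp H.map.differentiableAt, cext_coframe₀, cext_coframe₀, H.comp_push]

theorem structFn (H : GenRelated h L L' x) (i j k : Fin 5) :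
    ClassIII.structFn L' i j k (h x) = ClassIII.structFn L i j k x := by
  rw [ClassIII.structFn, (Related.bracket H.map (analyticAt_frame H.left i)
    (analyticAt_frame H.left j) (analyticAt_frame H.right i) (analyticAt_frame H.right j)
    (H.frame i) (H.frame j)).self_of_nhds, H.comp_push]
  rfl

section torsion

variable {b c d e b' c' d' e' : Base → ℂ}

theorem adaptedFrame (H : GenRelated h L L' x) (eb : ∀ᶠ y in 𝓝 x, b' (h y) = b y)
    (ec : ∀ᶠ y in 𝓝 x, c' (h y) = c y) (ed : ∀ᶠ y in 𝓝 x, d' (h y) = d y)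
    (ee : ∀ᶠ y in 𝓝 x, e' (h y) = e y) (i : Fin 5) :
    Related h (adaptedFrame L b c d e i) (ClassIII.adaptedFrame L' b' c' d' e' i) x := by
  filter_upwards [H.eventually, eb, ec, ed, ee] with y H eb ec ed ee
  simp only [ClassIII.adaptedFrame, eb, ec, ed, ee, map_sum, map_smul]
  refine Finset.sum_congr rfl fun j _ => ?_
  rw [(H.frame j).self_of_nhds]

theorem adapted (H : GenRelated h L L' x) (eb : b' (h x) = b x)
    (ec : c' (h x) = c x) (ed : d' (h x) = d x) (ee : e' (h x) = e x) (i : Fin 5) :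
    (adapted L' b' c' d' e' i (h x)).comp (fderiv ℝ h x) = ClassIII.adapted L b c d e i x := by
  refine cext_injective fun v => ?_
  rw [cext_comp H.map.differentiableAt, cext_adapted, cext_adapted]
  simp only [H.comp_push, eb, ec, ed, ee]

/-- Torsion is a bracket component and brackets respect relatedness. The parameters have to
correspond on a neighbourhood, since they are differentiated. -/
theorem torsion (H : GenRelated h L L' x)
    (hb : AnalyticAt ℝ b x) (hc : AnalyticAt ℝ c x) (hd : AnalyticAt ℝ d x)
    (he : AnalyticAt ℝ e x) (hb' : AnalyticAt ℝ b' (h x)) (hc' : AnalyticAt ℝ c' (h x))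
    (hd' : AnalyticAt ℝ d' (h x)) (he' : AnalyticAt ℝ e' (h x))
    (eb : ∀ᶠ y in 𝓝 x, b' (h y) = b y)
    (ec : ∀ᶠ y in 𝓝 x, c' (h y) = c y) (ed : ∀ᶠ y in 𝓝 x, d' (h y) = d y)
    (ee : ∀ᶠ y in 𝓝 x, e' (h y) = e y) (k i j : Fin 5) :
    ClassIII.torsion L' b' c' d' e' k i j (h x) = ClassIII.torsion L b c d e k i j x := by
  rw [torsion_eq H.right H.det_right hb' hc' hd' he', torsion_eq H.left H.det_left hb hc hd he,
    (Related.bracket H.map (analyticAt_adaptedFrame H.left hb hc hd he i)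
      (analyticAt_adaptedFrame H.left hb hc hd he j)
      (analyticAt_adaptedFrame H.right hb' hc' hd' he' i)
      (analyticAt_adaptedFrame H.right hb' hc' hd' he' j)
      (H.adaptedFrame eb ec ed ee i) (H.adaptedFrame eb ec ed ee j)).self_of_nhds,
    ← cext_comp H.map.differentiableAt, H.adapted eb.self_of_nhds ec.self_of_nhds
      ed.self_of_nhds ee.self_of_nhds]

end torsion

theorem normC (H : GenRelated h L L' x) : normC L' (h x) = ClassIII.normC L x := by
  simp only [ClassIII.normC, fnB_eq, H.structFn]

theorem normB (H : GenRelated h L L' x) : normB L' (h x) = ClassIII.normB L x := by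
  simp only [ClassIII.normB, fnB_eq, fnQ_eq, H.structFn]

theorem normD (H : GenRelated h L L' x) : normD L' (h x) = ClassIII.normD L x := by
  simp only [ClassIII.normD, fnB_eq, fnQ_eq, fnR_eq, fnG_eq, H.structFn]

theorem normE (H : GenRelated h L L' x) : normE L' (h x) = ClassIII.normE L x := by
  simp only [ClassIII.normE]
  rw [H.torsion (e := 0) (e' := 0) (analyticAt_normB H.left H.det_left) (analyticAt_normC H.left H.det_left)
    (analyticAt_normD H.left H.det_left) analyticAt_const
    (analyticAt_normB H.right H.det_right) (analyticAt_normC H.right H.det_right)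
    (analyticAt_normD H.right H.det_right) analyticAt_const
    (H.eventually.mono fun _ hy => hy.normB) (H.eventually.mono fun _ hy => hy.normC)
    (H.eventually.mono fun _ hy => hy.normD) (Filter.Eventually.of_forall fun _ => rfl)]

theorem reduced (H : GenRelated h L L' x) (i : Fin 5) :
    (reduced L' i (h x)).comp (fderiv ℝ h x) = ClassIII.reduced L i x :=
  H.adapted H.normB H.normC H.normD H.normE i

theorem redTorsion (H : GenRelated h L L' x) (k i j : Fin 5) :
    redTorsion L' k i j (h x) = ClassIII.redTorsion L k i j x :=
  H.torsion (analyticAt_normB H.left H.det_left) (analyticAt_normC H.left H.det_left)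
    (analyticAt_normD H.left H.det_left) (analyticAt_normE H.left H.det_left)
    (analyticAt_normB H.right H.det_right) (analyticAt_normC H.right H.det_right)
    (analyticAt_normD H.right H.det_right) (analyticAt_normE H.right H.det_right)
    (H.eventually.mono fun _ hy => hy.normB) (H.eventually.mono fun _ hy => hy.normC)
    (H.eventually.mono fun _ hy => hy.normD) (H.eventually.mono fun _ hy => hy.normE) k i j

theorem lamBase (H : GenRelated h L L' x) (v : Base) :
    lamBase L' (h x) (fderiv ℝ h x v) = ClassIII.lamBase L x v := by
  have e : absorption L' (h x) = absorption L x := by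
    simp only [absorption, H.redTorsion]
  simp only [ClassIII.lamBase, _root_.sum_apply, _root_.smul_apply, e, ← H.reduced]
  rfl

end GenRelated

end ClassIII

namespace ClassIII

/-! ### Analytic local inverses -/

section LocalInverse

variable {𝕜 E F : Type*} [RCLike 𝕜] [NormedAddCommGroup E] [NormedSpace 𝕜 E] [CompleteSpace E]
  [NormedAddCommGroup F] [NormedSpace 𝕜 F] [CompleteSpace F]

/-- The analytic inverse function theorem. -/
theorem exists_analytic_openPartialHomeomorph {f : E → F} {x : E} (hf : AnalyticAt 𝕜 f x)
    {i : E ≃L[𝕜] F} (hi : fderiv 𝕜 f x = i) {N : Set E} (hN : N ∈ 𝓝 x) :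
    ∃ e : OpenPartialHomeomorph E F, x ∈ e.source ∧ e.source ⊆ N ∧ (e : E → F) = f ∧
      AnalyticOnNhd 𝕜 e e.source ∧ AnalyticOnNhd 𝕜 e.symm e.target := by
  have hs : HasStrictFDerivAt f (i : E →L[𝕜] F) x := hi ▸ hf.hasStrictFDerivAt
  have h1 : ∀ᶠ y in 𝓝 x, fderiv 𝕜 f y ∈ Set.range ((↑) : (E ≃L[𝕜] F) → E →L[𝕜] F) :=
    hf.fderiv.continuousAt.eventually (hi ▸ ContinuousLinearEquiv.nhds i)
  -- Shrink to points where the map is analytic with invertible derivative, so that the inverse is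
  -- analytic on the entire target.
  obtain ⟨U, hU, hUo, hxU⟩ := mem_nhds_iff.1
    (Filter.inter_mem hN (hf.eventually_analyticAt.and h1))
  refine ⟨(hs.toOpenPartialHomeomorph f).restrOpen U hUo,
    ⟨hs.mem_toOpenPartialHomeomorph_source, hxU⟩, fun y hy => (hU hy.2).1, rfl,
    fun y hy => (hU hy.2).2.1, fun z hz => ?_⟩
  set e := (hs.toOpenPartialHomeomorph f).restrOpen U hUo with he
  have hz' := e.map_target hz
  obtain ⟨j, hj⟩ := (hU hz'.2).2.2
  exact e.analyticAt_symm hz (hU hz'.2).2.1 hj.symm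

end LocalInverse

/-- An analytic immersion has an analytic local left inverse. -/
theorem exists_analytic_leftInverse {E F : Type*} [NormedAddCommGroup E] [NormedSpace ℝ E]
    [FiniteDimensional ℝ E] [NormedAddCommGroup F] [NormedSpace ℝ F] [FiniteDimensional ℝ F]
    {f : E → F} {x : E} (hf : AnalyticAt ℝ f x) (hi : Function.Injective (fderiv ℝ f x)) :
    ∃ g : F → E, AnalyticAt ℝ g (f x) ∧ ∀ᶠ y in 𝓝 x, g (f y) = y := by
  have : CompleteSpace E := FiniteDimensional.complete ℝ E
  obtain ⟨π, hπ⟩ := (fderiv ℝ f x : E →ₗ[ℝ] F).exists_leftInverse_of_injective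
    (LinearMap.ker_eq_bot.2 hi)
  let p : F →L[ℝ] E := LinearMap.toContinuousLinearMap π
  -- Composing with a linear left inverse of the derivative gives a map with identity derivative;
  -- its local inverse after this projection is the desired left inverse.
  have hd : fderiv ℝ (fun y => p (f y)) x = (ContinuousLinearEquiv.refl ℝ E : E →L[ℝ] E) := by
    have := (p.hasFDerivAt.comp x hf.differentiableAt.hasFDerivAt).fderiv
    refine this.trans ?_
    ext v
    exact LinearMap.congr_fun hπ v
  have hpf : AnalyticAt ℝ (fun y => p (f y)) x :=
    AnalyticAt.comp (g := p) (p.analyticAt _) hf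
  obtain ⟨e, hx, -, he, -, ha⟩ := exists_analytic_openPartialHomeomorph hpf hd Filter.univ_mem
  refine ⟨fun z => e.symm (p z), ?_, ?_⟩
  · refine AnalyticAt.comp (g := e.symm) ?_ (p.analyticAt _)
    have := ha _ (e.map_source hx)
    rwa [he] at this
  · filter_upwards [e.open_source.mem_nhds hx] with y hy
    have := e.left_inv hy
    rwa [he] at this

namespace Patch

variable {M M' : Patch} {x : Base}

theorem injOn_param (M : Patch) : Set.InjOn M.param M.dom := by
  have := M.embedding.injective
  exact Set.injOn_iff_injective.2 this

/-- This is the embedding hypothesis: points of M close in the ambient space are close in the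
parameter. -/
theorem exists_nhds_param (hx : x ∈ M.dom) {N : Set Base} (hN : N ∈ 𝓝 x) :
    ∃ O ∈ 𝓝 (M.param x), ∀ y ∈ M.dom, M.param y ∈ O → y ∈ N := by
  have h := M.embedding.isInducing.nhds_eq_comap ⟨x, hx⟩
  have h1 : ((↑) : M.dom → Base) ⁻¹' N ∈ 𝓝 (⟨x, hx⟩ : M.dom) :=
    continuous_subtype_val.continuousAt.preimage_mem_nhds hN
  rw [h] at h1
  obtain ⟨O, hO, hs⟩ := Filter.mem_comap.1 h1
  exact ⟨O, hO, fun y hy hyO => hs (a := ⟨y, hy⟩) hyO⟩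

theorem exists_leftInverse (hx : x ∈ M.dom) :
    ∃ ψ : Amb → Base, AnalyticAt ℝ ψ (M.param x) ∧ ∀ᶠ y in 𝓝 x, ψ (M.param y) = y :=
  exists_analytic_leftInverse (M.analytic x hx) (M.immersion x hx)

/-- The part of the coordinate domain which is mapped into `s`. -/
def part (M : Patch) (s : Set Amb) : Set Base := {x | x ∈ M.dom ∧ M.param x ∈ s}

theorem isOpen_part (M : Patch) {s : Set Amb} (hs : IsOpen s) : IsOpen (M.part s) :=
  M.analytic.continuousOn.isOpen_inter_preimage M.isOpen_dom hs

end Patch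

/-! ### The coordinate map induced by an ambient biholomorphism. -/

section Induced

variable {M M' : Patch} {H : OpenPartialHomeomorph Amb Amb} {x : Base}

theorem IsBiholEquiv.symm (hH : IsBiholEquiv M M' H) : IsBiholEquiv M' M H.symm :=
  ⟨hH.2.1, by simpa using hH.1, hH.2.2.symm⟩

/-- The expression in coordinates of the map between submanifolds induced by `H`. -/
noncomputable def induced (M M' : Patch) (H : OpenPartialHomeomorph Amb Amb) (x : Base) : Base :=
  Function.invFunOn M'.param M'.dom (H (M.param x))

theorem IsBiholEquiv.induced_spec (hH : IsBiholEquiv M M' H) (hx : x ∈ M.part H.source) :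
    induced M M' H x ∈ M'.part H.target ∧ M'.param (induced M M' H x) = H (M.param x) := by
  have h : H (M.param x) ∈ M'.param '' M'.dom := (hH.2.2 hx.2).2 ⟨x, hx.1, rfl⟩
  have h1 : M'.param (induced M M' H x) = H (M.param x) := Function.invFunOn_eq h
  exact ⟨⟨Function.invFunOn_mem h, h1 ▸ H.map_source hx.2⟩, h1⟩

theorem IsBiholEquiv.induced_induced (hH : IsBiholEquiv M M' H) (hx : x ∈ M.part H.source) :
    induced M' M H.symm (induced M M' H x) = x := by
  obtain ⟨h1, h2⟩ := hH.induced_spec hx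
  obtain ⟨h3, h4⟩ := hH.symm.induced_spec (x := induced M M' H x) h1
  exact M.injOn_param h3.1 hx.1 (by rw [h4, h2, H.left_inv hx.2])

/-- Near the point the induced map equals ψ ∘ H ∘ `M.param` with ψ an analytic left inverse of the
second embedding. The embedding property ensures that the chosen preimages lie where ψ inverts it.
-/
theorem IsBiholEquiv.analyticAt_induced (hH : IsBiholEquiv M M' H) (hx : x ∈ M.part H.source) :
    AnalyticAt ℝ (induced M M' H) x := by
  obtain ⟨h1, h2⟩ := hH.induced_spec hx
  obtain ⟨ψ, hψ, hl⟩ := Patch.exists_leftInverse h1.1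
  obtain ⟨O, hO, hs⟩ := Patch.exists_nhds_param h1.1 hl
  have hHx : AnalyticAt ℝ (fun y => H (M.param y)) x :=
    AnalyticAt.comp (g := H) ((hH.1 _ hx.2).restrictScalars) (M.analytic x hx.1)
  rw [h2] at hψ hO
  have h3 : AnalyticAt ℝ (fun y => ψ (H (M.param y))) x := AnalyticAt.comp (g := ψ) hψ hHx
  refine h3.congr ?_
  filter_upwards [hHx.continuousAt.preimage_mem_nhds hO,
    (M.isOpen_part H.open_source).mem_nhds hx] with y hy hyU
  obtain ⟨h4, h5⟩ := hH.induced_spec hyU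
  have := hs _ h4.1 (by rw [h5]; exact hy)
  simp only [Set.mem_ofPred_eq, h5] at this
  exact this

/-- The diffeomorphism between open parts of the submanifolds induced by `H`. -/
noncomputable def IsBiholEquiv.inducedHomeomorph (hH : IsBiholEquiv M M' H) :
    OpenPartialHomeomorph Base Base where
  toFun := induced M M' H
  invFun := induced M' M H.symm
  source := M.part H.source
  target := M'.part H.target
  map_source' _ hx := (hH.induced_spec hx).1
  map_target' _ hx := (hH.symm.induced_spec hx).1
  left_inv' _ hx := hH.induced_induced hx
  right_inv' _ hx := hH.symm.induced_induced hx
  open_source := M.isOpen_part H.open_source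
  open_target := M'.isOpen_part H.open_target
  continuousOn_toFun _ hx := (hH.analyticAt_induced hx).continuousAt.continuousWithinAt
  continuousOn_invFun _ hx := (hH.symm.analyticAt_induced hx).continuousAt.continuousWithinAt

end Induced

/-! ### Injective differentials and locality of the frame construction. -/

/-- The derivative of a map with a differentiable local left inverse is injective. -/
theorem fderiv_injective_of_leftInverse {E F : Type*} [NormedAddCommGroup E] [NormedSpace ℝ E]
    [NormedAddCommGroup F] [NormedSpace ℝ F] {f : E → F} {g : F → E} {x : E}
    (hf : DifferentiableAt ℝ f x) (hg : DifferentiableAt ℝ g (f x))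
    (h : ∀ᶠ y in 𝓝 x, g (f y) = y) : Function.Injective (fderiv ℝ f x) := by
  have h1 : fderiv ℝ (fun y => g (f y)) x = (fderiv ℝ g (f x)).comp (fderiv ℝ f x) :=
    fderiv_comp x hg hf
  have h2 : fderiv ℝ (fun y => g (f y)) x = ContinuousLinearMap.id ℝ E :=
    (Filter.EventuallyEq.fderiv_eq h).trans fderiv_id
  refine Function.LeftInverse.injective (g := fderiv ℝ g (f x)) fun v => ?_
  exact DFunLike.congr_fun (h1.symm.trans h2) v

theorem push_injective {h : Base → Base} {x : Base} (hh : DifferentiableAt ℝ h x)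
    (hi : Function.Injective (fderiv ℝ h x)) : Function.Injective (push h x) := by
  obtain ⟨π, hπ⟩ := (fderiv ℝ h x : Base →ₗ[ℝ] Base).exists_leftInverse_of_injective
    (LinearMap.ker_eq_bot.2 hi)
  have key : ∀ v k, v k = cext ((coordC k).comp (LinearMap.toContinuousLinearMap π))
      (push h x v) := by
    intro v k
    rw [← cext_comp hh]
    have : ((coordC k).comp (LinearMap.toContinuousLinearMap π)).comp (fderiv ℝ h x) =
        coordC k := by
      ext v
      exact congrArg (coordC k) (LinearMap.congr_fun hπ v)
    rw [this, cext_apply]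
    simp [coordC, Pi.single_apply, apply_ite Complex.ofReal]
  intro v w hvw
  funext k
  rw [key v k, key w k, hvw]

theorem frame_congr {L L' : Base → CVec} {x : Base} (hL : L =ᶠ[𝓝 x] L') (i : Fin 5) :
    frame L i =ᶠ[𝓝 x] frame L' i := by
  have hc : ∀ {V V' : Base → CVec}, V =ᶠ[𝓝 x] V' → conjField V =ᶠ[𝓝 x] conjField V' :=
    fun h => h.mono fun y hy => by unfold conjField; rw [hy]
  have hb : ∀ {V V' W W' : Base → CVec}, V =ᶠ[𝓝 x] V' → W =ᶠ[𝓝 x] W' →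
      bracket V W =ᶠ[𝓝 x] bracket V' W' := fun h h' => by
    filter_upwards [h.eventuallyEq_nhds, h'.eventuallyEq_nhds] with y hy hy'
    exact bracket_congr hy hy'
  have hT : fieldT L =ᶠ[𝓝 x] fieldT L' :=
    (hb hL (hc hL)).mono fun y hy => congrArg (Complex.I • ·) hy
  fin_cases i
  exacts [hc (hb hL hT), hb hL hT, hT, hc hL, hL]

/-! ### Maps which preserve the line spanned by the generator -/

/-- `h` is an analytic immersion at `x` which maps the line spanned by `L` to that spanned
by `L'`. -/
structure LineRelated (h : Base → Base) (L L' : Base → CVec) (x : Base) : Prop where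
  map : AnalyticAt ℝ h x
  injective : Function.Injective (fderiv ℝ h x)
  left : AnalyticAt ℝ L x
  det_left : (frameMatrix L x).det ≠ 0
  right : AnalyticAt ℝ L' (h x)
  det_right : (frameMatrix L' (h x)).det ≠ 0
  rel : ∀ᶠ y in 𝓝 x, push h y (L y) ∈ Submodule.span ℂ {L' (h y)}

/-- The factor by which `L` has to be multiplied in order to be `h`-related to `L'`. -/
noncomputable def scale (h : Base → Base) (L L' : Base → CVec) (y : Base) : ℂ :=
  (comp L' (h y) (push h y (L y)) 4)⁻¹

theorem ne_zero_of_det {L : Base → CVec} {x : Base} (h : (frameMatrix L x).det ≠ 0) :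
    L x ≠ 0 := by
  intro h0
  have := comp_frame h 4 4
  have e : frame L 4 x = 0 := h0
  rw [e] at this
  simp [comp] at this

theorem comp_smul_generator {L : Base → CVec} {x : Base} (h : (frameMatrix L x).det ≠ 0) (c : ℂ) :
    comp L x (c • L x) 4 = c := by
  have := comp_frame h 4 4
  have e : frame L 4 x = L x := rfl
  rw [e, if_pos rfl] at this
  rw [comp, Matrix.mulVec_smul, Pi.smul_apply, smul_eq_mul]
  rw [comp] at this
  rw [this, mul_one]

namespace LineRelated

variable {h : Base → Base} {L L' : Base → CVec} {x : Base}

theorem comp_ne_zero (H : LineRelated h L L' x) : comp L' (h x) (push h x (L x)) 4 ≠ 0 := by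
  obtain ⟨c, hc⟩ := Submodule.mem_span_singleton.1 H.rel.self_of_nhds
  rw [← hc, comp_smul_generator H.det_right]
  rintro rfl
  rw [zero_smul] at hc
  exact ne_zero_of_det H.det_left
    (push_injective H.map.differentiableAt H.injective (hc.symm.trans (map_zero _).symm))

theorem scale_ne_zero (H : LineRelated h L L' x) : scale h L L' x ≠ 0 :=
  inv_ne_zero H.comp_ne_zero

theorem analyticAt_scale (H : LineRelated h L L' x) : AnalyticAt ℝ (scale h L L') x := by
  have h1 : AnalyticAt ℝ (fun y => coframe₀ L' 4 (h y)) x :=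
    (analyticAt_coframe₀ H.right H.det_right 4).comp H.map
  have h2 : AnalyticAt ℝ (fun y => ∑ k, L y k *
      coframe₀ L' 4 (h y) (fderiv ℝ h y (Pi.single k 1))) x := by
    refine Finset.analyticAt_fun_sum _ fun k _ => (analyticAt_pi_iff.1 H.left k).mul ?_
    exact ((ContinuousLinearMap.id ℝ (Base →L[ℝ] ℂ)).analyticAt_bilinear _).comp₂ h1
      (analyticAt_fderiv_apply H.map _)
  have h3 : ∀ᶠ y in 𝓝 x, ∑ k, L y k * coframe₀ L' 4 (h y) (fderiv ℝ h y (Pi.single k 1)) =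
      comp L' (h y) (push h y (L y)) 4 := by
    filter_upwards [H.map.eventually_analyticAt] with y hy
    rw [← cext_coframe₀, ← cext_comp hy.differentiableAt]
    rfl
  exact (h2.congr h3).inv H.comp_ne_zero

/-- Preserving the CR line becomes preservation of the generator after rescaling, which makes
naturality and the change-of-generator laws applicable together. -/
theorem genRelated (H : LineRelated h L L' x) :
    GenRelated h (fun y => scale h L L' y • L y) L' x := by
  refine ⟨H.map, H.analyticAt_scale.smul H.left,
    det_smulField H.left H.det_left H.analyticAt_scale H.scale_ne_zero, H.right, H.det_right, ?_⟩
  filter_upwards [H.rel, H.map.continuousAt.eventually (eventually_det_ne H.right H.det_right),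
    H.analyticAt_scale.continuousAt.eventually_ne H.scale_ne_zero] with y hy hd h0
  obtain ⟨c, hc⟩ := Submodule.mem_span_singleton.1 hy
  have hs : scale h L L' y = c⁻¹ := by rw [scale, ← hc, comp_smul_generator hd]
  rw [hs] at h0
  rw [map_smul, ← hc, hs, smul_smul, inv_mul_cancel₀ (by simpa using h0), one_smul]

theorem reduced (H : LineRelated h L L' x) (i : Fin 5) :
    weight i (scale h L L' x) • (reduced L' i (h x)).comp (fderiv ℝ h x) =
      ClassIII.reduced L i x := by
  rw [H.genRelated.reduced,
    reduced_smulField H.left H.det_left H.analyticAt_scale H.scale_ne_zero]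

theorem lamBase (H : LineRelated h L L' x) (v : Base) :
    lamBase L' (h x) (fderiv ℝ h x v) =
      ClassIII.lamBase L x v - fderiv ℝ (scale h L L') x v / scale h L L' x := by
  rw [H.genRelated.lamBase,
    lamBase_smulField H.left H.det_left H.analyticAt_scale H.scale_ne_zero]

/-- The pull-back is exactly the initial coframe of φL. Since L is φ⁻¹ times φL, the frame of L is a
group multiple of the frame of φL; dualizing gives the required transposed matrix. -/
theorem coframe₀ (H : LineRelated h L L' x) : ∃ g ∈ GIII1, ∀ i,
    (coframe₀ L' i (h x)).comp (fderiv ℝ h x) = ∑ j, gᵀ i j • ClassIII.coframe₀ L j x := by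
  set φ := scale h L L'
  have hφ : AnalyticAt ℝ φ x := H.analyticAt_scale
  have h0 : φ x ≠ 0 := H.scale_ne_zero
  have hi : AnalyticAt ℝ (fun y => (φ y)⁻¹) x := hφ.inv h0
  obtain ⟨b, c, d, e, -, -, -, -, hf⟩ := frame_smulField H.genRelated.left hi
  refine ⟨_, ⟨_, b x, c x, d x, e x, inv_ne_zero h0, rfl⟩, fun i => ?_⟩
  have hL : (fun y => (φ y)⁻¹ • φ y • L y) =ᶠ[𝓝 x] L := by
    filter_upwards [hφ.continuousAt.eventually_ne h0] with y hy
    rw [smul_smul, inv_mul_cancel₀ hy, one_smul]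
  rw [H.genRelated.coframe₀]
  have hfr : ∀ i, frame (fun y => (φ y)⁻¹ • φ y • L y) i x = frame L i x := fun i => (frame_congr hL i).self_of_nhds
  refine coframe₀_of_frame_eq (fun i => ?_) H.det_left H.genRelated.det_left i
  rw [← hfr]
  exact hf.self_of_nhds i

end LineRelated

/-! ### Biholomorphisms preserve the CR line. -/

section Induced

variable {M M' : Patch} {H : OpenPartialHomeomorph Amb Amb} {x : Base}

theorem cderiv_comp_holomorphic {G : Amb → ℂ} (hx : x ∈ M.dom)
    (hG : DifferentiableAt ℂ G (M.param x)) (v : CVec) :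
    cderiv (fun y => G (M.param y)) x v =
      ∑ j, fderiv ℂ G (M.param x) (Pi.single j 1) * cderiv (fun y => M.param y j) x v := by
  have h1 := ((hG.hasFDerivAt.restrictScalars ℝ).comp x
    (M.analytic x hx).differentiableAt.hasFDerivAt).fderiv
  have h2 : fderiv ℝ (fun y => G (M.param y)) x =
      ∑ j, fderiv ℂ G (M.param x) (Pi.single j 1) • fderiv ℝ (fun y => M.param y j) x := by
    refine h1.trans ?_
    ext v
    simp only [_root_.sum_apply, _root_.smul_apply, Patch.fderiv_param_coord hx,
      ContinuousLinearMap.comp_apply, ContinuousLinearMap.coe_restrictScalars']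
    conv_lhs => rw [pi_eq_sum_univ' (fderiv ℝ M.param x v)]
    simp [map_sum, mul_comm]
  rw [cderiv_eq_cext, h2, cext_sum]
  simp only [cext_smul, cderiv_eq_cext]

/-- By the holomorphic chain rule the conjugated components of H depend only on the conjugated
coordinates of M, which v annihilates. -/
theorem IsBiholEquiv.push_mem (hH : IsBiholEquiv M M' H) (hx : x ∈ M.part H.source) {v : CVec}
    (hv : v ∈ M.T10 x) : push (induced M M' H) x v ∈ M'.T10 (induced M M' H x) := by
  intro j
  obtain ⟨h1, h2⟩ := hH.induced_spec hx
  have hHx := (hH.1 _ hx.2)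
  have ha := (hH.analyticAt_induced hx).differentiableAt
  have hHj : DifferentiableAt ℂ (fun z => H z j) (M.param x) :=
    (analyticAt_pi_iff.1 hHx j).differentiableAt
  rw [← cderiv_comp (analyticAt_conj (Patch.analyticAt_param_coord h1.1 j)).differentiableAt ha]
  have e : ∀ᶠ y in 𝓝 x, conj (M'.param (induced M M' H y) j) = conj (H (M.param y) j) := by
    filter_upwards [(M.isOpen_part H.open_source).mem_nhds hx] with y hy
    rw [(hH.induced_spec hy).2]
  have hc : DifferentiableAt ℝ (fun y => H (M.param y) j) x :=
    (hHj.restrictScalars ℝ).comp x (M.analytic x hx.1).differentiableAt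
  have hcv := cderiv_conj hc (fun k => conj (v k))
  simp only [Complex.conj_conj] at hcv
  rw [cderiv_congr e, hcv, cderiv_comp_holomorphic hx.1 hHj, Finset.sum_eq_zero, map_zero]
  intro k _
  have := cderiv_conj (Patch.analyticAt_param_coord hx.1 k).differentiableAt (fun k => conj (v k))
  simp only [Complex.conj_conj] at this
  rw [hv k] at this
  rw [(map_eq_zero_iff _ (starRingEnd ℂ).injective).1 this.symm, mul_zero]

theorem IsBiholEquiv.lineRelated (hH : IsBiholEquiv M M' H) {L L' : Base → CVec}
    (hL : M.IsGenerator L) (hL' : M'.IsGenerator L') (gL : Good L M.dom) (gL' : Good L' M'.dom)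
    (hx : x ∈ M.part H.source) : LineRelated (induced M M' H) L L' x := by
  obtain ⟨h1, h2⟩ := hH.induced_spec hx
  refine ⟨hH.analyticAt_induced hx, ?_, gL.analytic x hx.1, gL.det_ne x hx.1,
    gL'.analytic _ h1.1, gL'.det_ne _ h1.1, ?_⟩
  · refine fderiv_injective_of_leftInverse (hH.analyticAt_induced hx).differentiableAt
      (hH.symm.analyticAt_induced (x := induced M M' H x) h1).differentiableAt ?_
    filter_upwards [(M.isOpen_part H.open_source).mem_nhds hx] with y hy
    exact hH.induced_induced hy
  · filter_upwards [(M.isOpen_part H.open_source).mem_nhds hx] with y hy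
    rw [← (hL'.2 _ (hH.induced_spec hy).1.1).2]
    refine hH.push_mem hy ?_
    rw [(hL.2 _ hy.1).2]
    exact Submodule.mem_span_singleton_self _

end Induced

end ClassIII

namespace ClassIII

/-! ### Complexification of real analytic maps -/

/-- The inclusion of the real points. -/
noncomputable def realPt (n : ℕ) : (Fin n → ℝ) →L[ℝ] (Fin n → ℂ) :=
  ContinuousLinearMap.pi fun i => Complex.ofRealCLM.comp (ContinuousLinearMap.proj i)

theorem realPt_apply {n : ℕ} (x : Fin n → ℝ) (i : Fin n) : realPt n x i = x i := rfl

section Complexification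

variable {n : ℕ} {E : Type*} [NormedAddCommGroup E] [NormedSpace ℂ E]

/-- The complex multilinear extension of a multilinear map on `ℝⁿ`. -/
noncomputable def complexify {m : ℕ}
    (p : ContinuousMultilinearMap ℝ (fun _ : Fin m => Fin n → ℝ) E) :
    ContinuousMultilinearMap ℂ (fun _ : Fin m => Fin n → ℂ) E :=
  ∑ s : Fin m → Fin n, (ContinuousMultilinearMap.mkPiRing ℂ (Fin m)
    (p fun i => Pi.single (s i) 1)).compContinuousLinearMap fun i => ContinuousLinearMap.proj (s i)

theorem complexify_apply {m : ℕ} (p : ContinuousMultilinearMap ℝ (fun _ : Fin m => Fin n → ℝ) E)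
    (z : Fin m → Fin n → ℂ) :
    complexify p z = ∑ s : Fin m → Fin n, (∏ i, z i (s i)) • p fun i => Pi.single (s i) 1 := by
  simp [complexify]

theorem complexify_realPt {m : ℕ} (p : ContinuousMultilinearMap ℝ (fun _ : Fin m => Fin n → ℝ) E)
    (v : Fin m → Fin n → ℝ) : complexify p (fun i => realPt n (v i)) = p v := by
  have h : p v = p fun i => ∑ k, v i k • Pi.single k (1 : ℝ) := by
    congr 1
    funext i
    exact pi_eq_sum_univ' (v i)
  rw [h, ContinuousMultilinearMap.map_sum, complexify_apply]
  refine Finset.sum_congr rfl fun s _ => ?_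
  rw [ContinuousMultilinearMap.map_smul_univ, ← Complex.coe_smul]
  simp [realPt_apply]

/-- The extension is a sum of nᵐ terms, each of norm at most that of the original. A geometric loss
of this kind shrinks the radius of convergence but keeps it positive. -/
theorem norm_complexify_le {m : ℕ}
    (p : ContinuousMultilinearMap ℝ (fun _ : Fin m => Fin n → ℝ) E) :
    ‖complexify p‖ ≤ (n : ℝ) ^ m * ‖p‖ := by
  refine (norm_sum_le _ _).trans ?_
  have h : ∀ s : Fin m → Fin n, ‖(ContinuousMultilinearMap.mkPiRing ℂ (Fin m)
      (p fun i => Pi.single (s i) 1)).compContinuousLinearMap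
        fun i => ContinuousLinearMap.proj (R := ℂ) (φ := fun _ : Fin n => ℂ) (s i)‖ ≤ ‖p‖ := by
    intro s
    refine ContinuousMultilinearMap.opNorm_le_bound (norm_nonneg _) fun z => ?_
    simp only [ContinuousMultilinearMap.compContinuousLinearMap_apply,
      ContinuousMultilinearMap.mkPiRing_apply, ContinuousLinearMap.proj_apply, norm_smul,
      norm_prod]
    rw [mul_comm]
    refine mul_le_mul ?_ (Finset.prod_le_prod (fun _ _ => norm_nonneg _)
      fun i _ => norm_le_pi_norm (z i) (s i)) (Finset.prod_nonneg fun _ _ => norm_nonneg _)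
      (norm_nonneg _)
    refine (p.le_opNorm _).trans ?_
    simp [Pi.norm_single]
  refine (Finset.sum_le_sum fun s _ => h s).trans ?_
  simp

/-- A real analytic map extends holomorphically to a complex neighbourhood. -/
theorem exists_complexification [CompleteSpace E] {f : (Fin n → ℝ) → E} {x : Fin n → ℝ}
    (hf : AnalyticAt ℝ f x) :
    ∃ F : (Fin n → ℂ) → E, AnalyticAt ℂ F (realPt n x) ∧ ∀ᶠ y in 𝓝 x, F (realPt n y) = f y := by
  obtain ⟨p, r, hp⟩ := hf
  let q : FormalMultilinearSeries ℂ (Fin n → ℂ) E := fun m => complexify (p m)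
  have hq : 0 < q.radius := by
    obtain ⟨r', h0, hr'⟩ := ENNReal.lt_iff_exists_nnreal_btwn.1 (hp.r_pos.trans_le hp.r_le)
    have h0' : 0 < r' := by exact_mod_cast h0
    obtain ⟨C, -, hC⟩ := p.norm_mul_pow_le_of_lt_radius hr'
    -- Division by n + 1 instead of n also covers n = 0.
    have hle := q.le_radius_of_bound C (r := r' / (n + 1)) fun m => by
      refine le_trans ?_ (hC m)
      have h1 : ((r' / (n + 1) : NNReal) : ℝ) ^ m = (r' : ℝ) ^ m / ((n : ℝ) + 1) ^ m := by
        push_cast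
        rw [div_pow]
      have h2 : (n : ℝ) ^ m ≤ ((n : ℝ) + 1) ^ m := by gcongr; linarith
      have h3 : 0 < ((n : ℝ) + 1) ^ m := by positivity
      rw [h1, mul_div_assoc', div_le_iff₀ h3]
      calc ‖q m‖ * (r' : ℝ) ^ m ≤ ((n : ℝ) ^ m * ‖p m‖) * (r' : ℝ) ^ m := by
            gcongr; exact norm_complexify_le (p m)
        _ ≤ (((n : ℝ) + 1) ^ m * ‖p m‖) * (r' : ℝ) ^ m := by gcongr
        _ = _ := by ring
    refine lt_of_lt_of_le ?_ hle
    exact_mod_cast (by positivity : (0 : NNReal) < r' / (n + 1))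
  refine ⟨fun z => q.sum (z - realPt n x), ?_, ?_⟩
  · have h := (q.hasFPowerSeriesOnBall hq).analyticAt
    refine AnalyticAt.comp (g := q.sum) (by simpa using h) (analyticAt_id.sub analyticAt_const)
  · filter_upwards [Metric.eball_mem_nhds x hp.r_pos] with y hy
    have h1 := (hp.hasSum_sub hy).tsum_eq
    rw [← h1, FormalMultilinearSeries.sum, ← map_sub]
    refine tsum_congr fun m => ?_
    exact complexify_realPt (p m) fun _ => y - x

/-- A holomorphic map which vanishes at the real points near a real point vanishes near it. -/
theorem eventually_eq_zero_of_real [CompleteSpace E] {g : (Fin n → ℂ) → E} {x : Fin n → ℝ}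
    (hg : AnalyticAt ℂ g (realPt n x)) (h : ∀ᶠ y in 𝓝 x, g (realPt n y) = 0) :
    ∀ᶠ z in 𝓝 (realPt n x), g z = 0 := by
  obtain ⟨ε, h0, hε⟩ := Metric.eventually_nhds_iff_ball.1 hg.eventually_analyticAt
  obtain ⟨δ, h0', hδ⟩ := Metric.eventually_nhds_iff_ball.1 h
  -- Both the real displacement u and the imaginary part v have norm below this radius, so ‖u‖ +
  -- 2‖v‖ stays below min ε δ, as needed for parameters w of norm less than 2.
  refine Metric.eventually_nhds_iff_ball.2 ⟨min ε δ / 3, by positivity, fun z hz => ?_⟩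
  rw [mem_ball_iff_norm] at hz
  set u : Fin n → ℝ := fun i => (z i).re - x i with hu
  set v : Fin n → ℝ := fun i => (z i).im with hv
  have hz' : z = realPt n (x + u) + Complex.I • realPt n v := by
    funext i
    apply Complex.ext <;> simp [realPt_apply, hu, hv]
  have nu : ‖u‖ ≤ ‖z - realPt n x‖ := (pi_norm_le_iff_of_nonneg (norm_nonneg _)).2 fun i => by
    refine le_trans ?_ (norm_le_pi_norm _ i)
    simpa [realPt_apply, hu] using Complex.abs_re_le_norm (z i - x i)
  have nv : ‖v‖ ≤ ‖z - realPt n x‖ := (pi_norm_le_iff_of_nonneg (norm_nonneg _)).2 fun i => by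
    refine le_trans ?_ (norm_le_pi_norm _ i)
    simpa [realPt_apply, hv] using Complex.abs_im_le_norm (z i - x i)
  have nr : ∀ w : Fin n → ℝ, ‖realPt n w‖ ≤ ‖w‖ := fun w =>
    (pi_norm_le_iff_of_nonneg (norm_nonneg _)).2 fun i => by
      simpa [realPt_apply] using norm_le_pi_norm w i
  -- This complex line is real for real w and passes through z at w = i. The one-variable identity
  -- theorem on the disc of radius 2 carries the vanishing from real w to i.
  let γ : ℂ → Fin n → ℂ := fun w => realPt n (x + u) + w • realPt n v
  have hγ : ∀ w, AnalyticAt ℂ γ w := fun w =>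
    analyticAt_const.add (analyticAt_id.smul analyticAt_const)
  have hγb : ∀ w : ℂ, ‖w‖ < 2 → γ w ∈ Metric.ball (realPt n x) (min ε δ) := by
    intro w hw
    rw [mem_ball_iff_norm]
    have e : γ w - realPt n x = realPt n u + w • realPt n v := by
      simp only [γ, map_add]; abel
    rw [e]
    calc ‖realPt n u + w • realPt n v‖ ≤ ‖realPt n u‖ + ‖w‖ * ‖realPt n v‖ := by
          rw [← norm_smul]; exact norm_add_le _ _
      _ ≤ ‖u‖ + 2 * ‖v‖ := by gcongr <;> apply nr
      _ < min ε δ := by linarith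
  have ha : AnalyticOnNhd ℂ (fun w => g (γ w)) (Metric.ball 0 2) := fun w hw =>
    AnalyticAt.comp (g := g) (hε _ (Metric.ball_subset_ball (min_le_left _ _)
      (hγb w (by simpa using hw)))) (hγ w)
  have hfr : ∃ᶠ w in 𝓝[≠] (0 : ℂ), g (γ w) = 0 := by
    have ht : Filter.Tendsto (fun t : ℝ => (t : ℂ)) (𝓝[≠] 0) (𝓝[≠] 0) := by
      refine tendsto_nhdsWithin_iff.2 ⟨?_, ?_⟩
      · exact (Complex.continuous_ofReal.tendsto' 0 0 (by simp)).mono_left nhdsWithin_le_nhds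
      · filter_upwards [self_mem_nhdsWithin] with t ht
        simpa using ht
    refine ht.frequently (Filter.Eventually.frequently ?_)
    filter_upwards [nhdsWithin_le_nhds (Metric.ball_mem_nhds (0 : ℝ) one_pos)] with t ht
    have e : γ t = realPt n (x + u + t • v) := by
      funext i
      simp [γ, realPt_apply]
    rw [e]
    refine hδ _ ?_
    rw [mem_ball_iff_norm, add_assoc, add_sub_cancel_left]
    have ht' : ‖t‖ < 1 := by simpa using ht
    calc ‖u + t • v‖ ≤ ‖u‖ + ‖t‖ * ‖v‖ := by rw [← norm_smul]; exact norm_add_le _ _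
      _ ≤ ‖u‖ + 1 * ‖v‖ := by gcongr
      _ < δ := by have := min_le_right ε δ; linarith [norm_nonneg v]
  have := ha.eqOn_zero_of_preconnected_of_frequently_eq_zero
    (convex_ball 0 2).isPreconnected (by simp) hfr (x := Complex.I) (by simp)
  rw [hz']
  exact this

end Complexification

end ClassIII

namespace ClassIII

/-! ### Holomorphic extension of CR maps -/

section Extension

variable {M M' : Patch} {x : Base}

/-- The differential of an extension of `f` at real points. -/
theorem fderiv_complexification {m : ℕ} {f : Base → Fin m → ℂ} {F : (Fin 5 → ℂ) → Fin m → ℂ}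
    (hF : DifferentiableAt ℂ F (realPt 5 x)) (h : ∀ᶠ y in 𝓝 x, F (realPt 5 y) = f y)
    (v : CVec) (j : Fin m) : fderiv ℂ F (realPt 5 x) v j = cderiv (fun y => f y j) x v := by
  have h1 : HasFDerivAt (fun y => F (realPt 5 y))
      (((fderiv ℂ F (realPt 5 x)).restrictScalars ℝ).comp (realPt 5)) x :=
    (hF.hasFDerivAt.restrictScalars ℝ).comp x (realPt 5).hasFDerivAt
  have h2 := h1.congr_of_eventuallyEq (h.mono fun _ hy => hy.symm)
  have h3 := (hasFDerivAt_pi'.1 h2) j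
  have e : ∀ k, realPt 5 (Pi.single k 1) = Pi.single k (1 : ℂ) := by
    intro k
    funext i
    by_cases hi : i = k <;> simp [realPt_apply, hi]
  conv_lhs => rw [pi_eq_sum_univ' v]
  simp only [map_sum, map_smul, Finset.sum_apply, Pi.smul_apply, smul_eq_mul, cderiv, h3.fderiv]
  refine Finset.sum_congr rfl fun k _ => ?_
  simp [e]

theorem Patch.cderiv_param_eq_zero_iff (hx : x ∈ M.dom) (v : CVec) :
    (∀ j, cderiv (fun y => M.param y j) x v = 0) ↔ (fun k => conj (v k)) ∈ M.T10 x := by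
  refine forall_congr' fun j => ?_
  have := cderiv_conj (Patch.analyticAt_param_coord hx j).differentiableAt v
  rw [this, map_eq_zero_iff _ (starRingEnd ℂ).injective]

/-- A biholomorphism near a point of `M` extending an immersion into `M'` is an equivalence. -/
theorem exists_isBiholEquiv {h : Base → Base} (hx : x ∈ M.dom) (hhx : h x ∈ M'.dom)
    (hh : AnalyticAt ℝ h x) (hi : Function.Injective (fderiv ℝ h x)) {H₀ : Amb → Amb}
    (hH : AnalyticAt ℂ H₀ (M.param x)) (he : ∀ᶠ y in 𝓝 x, M'.param (h y) = H₀ (M.param y)) :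
    ∃ H, IsBiholEquiv M M' H ∧ M.param x ∈ H.source ∧
      ∀ᶠ y in 𝓝 x, M'.param (h y) = H (M.param y) := by
  have hp := (M.analytic x hx).differentiableAt
  have hp' := (M'.analytic _ hhx).differentiableAt
  have hsurj' : Function.Surjective (fderiv ℝ h x) :=
    LinearMap.surjective_of_injective (f := (fderiv ℝ h x : Base →ₗ[ℝ] Base)) hi
  have hD : ∀ v, fderiv ℂ H₀ (M.param x) (fderiv ℝ M.param x v) =
      fderiv ℝ M'.param (h x) (fderiv ℝ h x v) := by
    intro v
    have h1 := ((hH.differentiableAt.hasFDerivAt.restrictScalars ℝ).comp x hp.hasFDerivAt)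
    have h2 := (hp'.hasFDerivAt.comp x hh.differentiableAt.hasFDerivAt).congr_of_eventuallyEq
      (he.mono fun _ hy => hy.symm)
    exact DFunLike.congr_fun (h1.unique h2) v
  -- The image contains the tangent space of M', because dh is onto by dimension; genericity of M'
  -- makes that tangent space span over ℂ.
  have hsurj : Function.Surjective (fderiv ℂ H₀ (M.param x)) := by
    have : LinearMap.range (fderiv ℂ H₀ (M.param x) : Amb →ₗ[ℂ] Amb) = ⊤ := by
      rw [eq_top_iff, ← M'.generic _ hhx, Submodule.span_le]
      rintro _ ⟨w, rfl⟩
      obtain ⟨v, rfl⟩ := hsurj' w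
      exact ⟨_, hD v⟩
    exact LinearMap.range_eq_top.1 this
  let i : Amb ≃L[ℂ] Amb := (LinearEquiv.ofBijective (fderiv ℂ H₀ (M.param x) : Amb →ₗ[ℂ] Amb)
    ⟨LinearMap.injective_iff_surjective.2 hsurj, hsurj⟩).toContinuousLinearEquiv
  have hi' : fderiv ℂ H₀ (M.param x) = i := by ext v; rfl
  obtain ⟨e, hxe, -, hee, ha, ha'⟩ := exists_analytic_openPartialHomeomorph hH hi'
    Filter.univ_mem
  let j : Base ≃L[ℝ] Base := (LinearEquiv.ofBijective (fderiv ℝ h x : Base →ₗ[ℝ] Base)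
    ⟨hi, hsurj'⟩).toContinuousLinearEquiv
  have hj : fderiv ℝ h x = j := by ext v; rfl
  have hN : {y | y ∈ M.dom ∧ M.param y ∈ e.source ∧ M'.param (h y) = H₀ (M.param y) ∧
      h y ∈ M'.dom} ∈ 𝓝 x := by
    filter_upwards [M.isOpen_dom.mem_nhds hx, he,
      hp.continuousAt.preimage_mem_nhds (e.open_source.mem_nhds hxe),
      hh.continuousAt.preimage_mem_nhds (M'.isOpen_dom.mem_nhds hhx)] with y h1 h2 h3 h4
    exact ⟨h1, h3, h2, h4⟩
  obtain ⟨l, hxl, hlN, hlh, -, -⟩ := exists_analytic_openPartialHomeomorph hh hj hN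
  -- The ambient neighbourhoods O and O' meet M and M' only in the parts matched by the local
  -- diffeomorphism l, so no other sheet can spoil the equality of images.
  obtain ⟨O, hO, hOs⟩ := Patch.exists_nhds_param hx (l.open_source.mem_nhds hxl)
  obtain ⟨O', hO', hOs'⟩ := Patch.exists_nhds_param hhx
    (l.open_target.mem_nhds (hlh ▸ l.map_source hxl))
  rw [he.self_of_nhds] at hO'
  obtain ⟨W, hW, hWo, hxW⟩ := mem_nhds_iff.1
    (Filter.inter_mem hO (hH.continuousAt.preimage_mem_nhds hO'))
  refine ⟨e.restrOpen W hWo, ⟨fun w hw => ha w hw.1, ?_, ?_⟩, ⟨hxe, hxW⟩, ?_⟩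
  · intro w hw
    exact ha' w hw.1
  · intro w hw
    have hwe : (e.restrOpen W hWo) w = H₀ w := congrFun hee w
    rw [hwe]
    constructor
    · rintro ⟨y', hy', hyw⟩
      have h1 : y' ∈ l.target := hOs' y' hy' (by rw [hyw]; exact (hW hw.2).2)
      have h2 := hlN (l.map_target h1)
      have h3 : h (l.symm y') = y' := by rw [← hlh, l.right_inv h1]
      -- The preimage of y' under l is a point of M with the same image as w, so injectivity of the
      -- ambient map places w on M.
      refine ⟨l.symm y', h2.1, e.injOn h2.2.1 hw.1 ?_⟩
      rw [hee, ← h2.2.2.1, h3, hyw]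
    · rintro ⟨y, hy, rfl⟩
      have h2 := hlN (hOs y hy (hW hw.2).1)
      exact ⟨h y, h2.2.2.2, h2.2.2.1⟩
  · filter_upwards [he] with y hy
    rw [hy]
    exact (congrFun hee _).symm

/-- An analytic map between generic submanifolds which maps the CR line to the CR line is near
each point the restriction of a holomorphic map. -/
theorem exists_holomorphic_extension {h : Base → Base} {L L' : Base → CVec}
    (hL : M.IsGenerator L) (hL' : M'.IsGenerator L') (hx : x ∈ M.dom) (hhx : h x ∈ M'.dom)
    (hh : AnalyticAt ℝ h x)
    (hs : ∀ᶠ y in 𝓝 x, push h y (L y) ∈ Submodule.span ℂ {L' (h y)}) :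
    ∃ H₀ : Amb → Amb, AnalyticAt ℂ H₀ (M.param x) ∧
      ∀ᶠ y in 𝓝 x, M'.param (h y) = H₀ (M.param y) := by
  obtain ⟨Φ, hΦ, eΦ⟩ := exists_complexification (M.analytic x hx)
  have hfa : AnalyticAt ℝ (fun y => M'.param (h y)) x := (M'.analytic _ hhx).comp hh
  obtain ⟨f, hf, ef⟩ := exists_complexification hfa
  obtain ⟨k, hk⟩ : ∃ k, L x k ≠ 0 := by
    by_contra! h0
    exact (hL.2 x hx).1 (funext h0)
  -- The kernel of dΦ at the real point is spanned by the conjugate of L, whose k-th component is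
  -- nonzero; adjoining the coordinate z_k therefore yields local holomorphic coordinates.
  let Ψ : (Fin 5 → ℂ) → Amb × ℂ := fun z => (Φ z, z k)
  have hΨ : AnalyticAt ℂ Ψ (realPt 5 x) :=
    hΦ.prod ((ContinuousLinearMap.proj (R := ℂ) (φ := fun _ : Fin 5 => ℂ) k).analyticAt _)
  have hDΨ : ∀ z, AnalyticAt ℂ Φ z → ∀ v, fderiv ℂ Ψ z v = (fderiv ℂ Φ z v, v k) := by
    intro z hz v
    have := (hz.differentiableAt.hasFDerivAt).prodMk
      (ContinuousLinearMap.proj (R := ℂ) (φ := fun _ : Fin 5 => ℂ) k).hasFDerivAt (x := z)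
    exact DFunLike.congr_fun this.fderiv v
  have hinj : Function.Injective (fderiv ℂ Ψ (realPt 5 x)) := by
    refine (injective_iff_map_eq_zero _).2 fun v hv => ?_
    rw [hDΨ _ hΦ, Prod.mk_eq_zero] at hv
    have h1 : (fun k => conj (v k)) ∈ M.T10 x :=
      (Patch.cderiv_param_eq_zero_iff hx v).1 fun j => by
        rw [← fderiv_complexification hΦ.differentiableAt eΦ, hv.1]; rfl
    rw [(hL.2 x hx).2] at h1
    obtain ⟨c, hc⟩ := Submodule.mem_span_singleton.1 h1
    have h2 : c * L x k = 0 := by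
      have := congrFun hc k
      simpa [hv.2] using this
    have hc0 := (mul_eq_zero.1 h2).resolve_right hk
    funext j
    have := congrFun hc j
    rw [hc0] at this
    simpa using this.symm
  let i : (Fin 5 → ℂ) ≃L[ℂ] Amb × ℂ :=
    (LinearEquiv.ofInjectiveOfFinrankEq (fderiv ℂ Ψ (realPt 5 x) : (Fin 5 → ℂ) →ₗ[ℂ] Amb × ℂ)
      hinj (by simp)).toContinuousLinearEquiv
  have hi : fderiv ℂ Ψ (realPt 5 x) = i := by ext1 v; rfl
  obtain ⟨e, hxe, heN, hee, ha, ha'⟩ := exists_analytic_openPartialHomeomorph hΨ hi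
    (hΦ.eventually_analyticAt.and hf.eventually_analyticAt)
  -- G is f in the new coordinates. The factorization through Φ amounts to independence of the last
  -- variable.
  let G : Amb × ℂ → Amb := fun w => f (e.symm w)
  have hG : ∀ w ∈ e.target, AnalyticAt ℂ G w := fun w hw =>
    AnalyticAt.comp (g := f) (heN (e.map_target hw)).2 (ha' w hw)
  have hge : ∀ z ∈ e.source, G (e z) = f z := fun z hz => by simp only [G, e.left_inv hz]
  have hDG : ∀ z ∈ e.source, ∀ v, fderiv ℂ G (e z) (fderiv ℂ Φ z v, v k) = fderiv ℂ f z v := by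
    intro z hz v
    have h1 := (hG _ (e.map_source hz)).differentiableAt.hasFDerivAt.comp z
      (ha z hz).differentiableAt.hasFDerivAt
    have h2 := (heN hz).2.differentiableAt.hasFDerivAt.congr_of_eventuallyEq
      (Filter.eventually_of_mem (e.open_source.mem_nhds hz) hge)
    have := DFunLike.congr_fun (h1.unique h2) v
    rw [← this, ContinuousLinearMap.comp_apply, hee, hDΨ z (heN hz).1]
  -- At real points dΨ sends the conjugate of L to a nonzero multiple of (0, 1), while df
  -- annihilates it because h preserves the CR line.
  have hreal : ∀ᶠ y in 𝓝 x, fderiv ℂ G (e (realPt 5 y)) (0, 1) = 0 := by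
    filter_upwards [eΦ.eventually_nhds, ef.eventually_nhds, hs, M.isOpen_dom.mem_nhds hx,
      hh.continuousAt.preimage_mem_nhds (M'.isOpen_dom.mem_nhds hhx), hh.eventually_analyticAt,
      (realPt 5).continuous.continuousAt.preimage_mem_nhds (e.open_source.mem_nhds hxe),
      (analyticAt_pi_iff.1 (hL.1 x hx) k).continuousAt.eventually_ne hk]
      with y hΦy hfy hsy hy hhy hay hye hky
    have hp : ∀ j, cderiv (fun y => M.param y j) y (fun k => conj (L y k)) = 0 :=
      (Patch.cderiv_param_eq_zero_iff hy _).2 (by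
        simp only [Complex.conj_conj]
        rw [(hL.2 y hy).2]
        exact Submodule.mem_span_singleton_self _)
    have hp' : ∀ j, cderiv (fun y => M'.param (h y) j) y (fun k => conj (L y k)) = 0 := by
      intro j
      rw [cderiv_comp (Patch.analyticAt_param_coord hhy j).differentiableAt hay.differentiableAt]
      refine (Patch.cderiv_param_eq_zero_iff hhy _).2 ?_ j
      rw [push_conj hay.differentiableAt]
      simp only [Complex.conj_conj]
      rw [(hL'.2 _ hhy).2]
      exact hsy
    have h1 := hDG _ hye (fun k => conj (L y k))
    have h2 : fderiv ℂ Φ (realPt 5 y) (fun k => conj (L y k)) = 0 := by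
      funext j
      rw [fderiv_complexification (heN hye).1.differentiableAt hΦy, hp]; rfl
    have h3 : fderiv ℂ f (realPt 5 y) (fun k => conj (L y k)) = 0 := by
      funext j
      rw [fderiv_complexification (heN hye).2.differentiableAt hfy, hp']; rfl
    rw [h2, h3] at h1
    have h4 : ((0 : Amb), conj (L y k)) = conj (L y k) • ((0 : Amb), (1 : ℂ)) := by simp
    rw [h4, map_smul, smul_eq_zero] at h1
    exact h1.resolve_left (by simpa using hky)
  have hK : AnalyticAt ℂ (fun z => fderiv ℂ G (e z) (0, 1)) (realPt 5 x) := by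
    have h1 : AnalyticAt ℂ (fun z => fderiv ℂ G (e z)) (realPt 5 x) :=
      AnalyticAt.comp (g := fderiv ℂ G) (hG _ (e.map_source hxe)).fderiv (ha _ hxe)
    exact ((ContinuousLinearMap.apply ℂ Amb ((0 : Amb), (1 : ℂ))).analyticAt _).comp h1
  -- The derivative of G in its last variable is holomorphic in z, so its vanishing at real points
  -- spreads to a complex neighbourhood.
  have hzero := eventually_eq_zero_of_real hK hreal
  have hzero' : ∀ᶠ w in 𝓝 (e (realPt 5 x)), fderiv ℂ G w (0, 1) = 0 ∧ AnalyticAt ℂ G w := by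
    have h1 : Filter.Tendsto e.symm (𝓝 (e (realPt 5 x))) (𝓝 (realPt 5 x)) := by
      have := (ha' _ (e.map_source hxe)).continuousAt.tendsto
      rwa [e.left_inv hxe] at this
    filter_upwards [h1.eventually hzero, e.open_target.mem_nhds (e.map_source hxe)] with w hw hwt
    rw [e.right_inv hwt] at hw
    exact ⟨hw, hG w hwt⟩
  have hex : e (realPt 5 x) = (M.param x, (x k : ℂ)) := by
    rw [hee]
    exact Prod.ext eΦ.self_of_nhds rfl
  obtain ⟨ε, h0, hε⟩ := Metric.eventually_nhds_iff_ball.1 hzero'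
  rw [hex] at hε
  refine ⟨fun w => G (w, (x k : ℂ)), ?_, ?_⟩
  · exact AnalyticAt.comp (g := G) (hε _ (Metric.mem_ball_self h0)).2
      (analyticAt_id.prod analyticAt_const)
  · have hc : ContinuousAt (fun y => e (realPt 5 y)) x :=
      ContinuousAt.comp (g := e) (ha _ hxe).continuousAt (realPt 5).continuous.continuousAt
    filter_upwards [hc.preimage_mem_nhds (by
        rw [hex]; exact Metric.ball_mem_nhds _ h0), ef, eΦ,
      (realPt 5).continuous.continuousAt.preimage_mem_nhds (e.open_source.mem_nhds hxe)]
      with y hy hfy hΦy hye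
    have he2 : e (realPt 5 y) = (M.param y, (y k : ℂ)) := by
      rw [hee]
      exact Prod.ext hΦy rfl
    have hy' : (M.param y, (y k : ℂ)) ∈ Metric.ball (M.param x, (x k : ℂ)) ε := by
      rw [← he2]; exact hy
    rw [← ball_prod_same] at hy' hε
    have h2 : ∀ t ∈ Metric.ball (x k : ℂ) ε,
        HasDerivAt (fun t => G (M.param y, t)) 0 t := by
      intro t ht
      obtain ⟨h3, h4⟩ := hε (M.param y, t) ⟨hy'.1, ht⟩
      have h5 : HasDerivAt (fun t : ℂ => (M.param y, t)) ((0 : Amb), (1 : ℂ)) t :=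
        (hasDerivAt_const t _).prodMk (hasDerivAt_id t)
      have h6 := h4.differentiableAt.hasFDerivAt.comp_hasDerivAt t h5
      rw [h3] at h6
      exact h6
    -- Constancy on the disc moves the last coordinate from y_k to the frozen value x_k.
    have h7 := (convex_ball (x k : ℂ) ε).is_const_of_fderivWithin_eq_zero (𝕜 := ℂ)
      (f := fun t => G (M.param y, t))
      (fun t ht => (h2 t ht).differentiableAt.differentiableWithinAt) (fun t ht => by
        rw [fderivWithin_of_isOpen Metric.isOpen_ball ht, (h2 t ht).hasFDerivAt.fderiv]
        ext; simp) hy'.2 (Metric.mem_ball_self h0)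
    rw [← hfy, ← hge _ hye, he2]
    exact h7

end Extension

end ClassIII

namespace ClassIII

/-! ### Equivalences of the initial structures -/

section

variable {L : Base → CVec} {x : Base}

theorem mem_span_of_comp (h : (frameMatrix L x).det ≠ 0) {v : CVec}
    (hv : ∀ i, i ≠ 4 → comp L x v i = 0) : v ∈ Submodule.span ℂ {L x} := by
  rw [← sum_comp_frame h v, Finset.sum_eq_single 4 (fun i _ hi => by rw [hv i hi, zero_smul])
    (by simp)]
  exact Submodule.smul_mem _ _ (Submodule.mem_span_singleton_self _)

theorem adaptedFrame_four (b c d e : Base → ℂ) : adaptedFrame L b c d e 4 x = L x := by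
  rw [adaptedFrame, groupMatrix_inv]
  simp [groupMatrix, Fin.sum_univ_five, frame]

theorem cext_reduced_generator (h : (frameMatrix L x).det ≠ 0) (i : Fin 5) :
    cext (reduced L i x) (L x) = if i = 4 then 1 else 0 := by
  rw [← cext_adapted_adaptedFrame (b := normB L) (c := normC L) (d := normD L) (e := normE L) h,
    adaptedFrame_four]
  rfl

theorem mem_span_of_reduced (h : (frameMatrix L x).det ≠ 0) {v : CVec}
    (hv : ∀ i, i ≠ 4 → cext (reduced L i x) v = 0) : v ∈ Submodule.span ℂ {L x} := by
  rw [← sum_adapted_adaptedFrame (b := normB L) (c := normC L) (d := normD L) (e := normE L) h v,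
    Finset.sum_eq_single 4 (fun i _ hi => by
      rw [show adapted L _ _ _ _ i = reduced L i from rfl, hv i hi, zero_smul])
    (by simp), adaptedFrame_four]
  exact Submodule.smul_mem _ _ (Submodule.mem_span_singleton_self _)

theorem eq_zero_of_reduced (h : (frameMatrix L x).det ≠ 0) {v : Base}
    (hv : ∀ i, reduced L i x v = 0) : v = 0 := by
  have h1 : toC v = 0 := eq_of_cext_adapted (b := normB L) (c := normC L) (d := normD L)
    (e := normE L) h fun i => by
      rw [cext_toC, map_zero]
      exact hv i
  funext k
  have := congrFun h1 k
  simpa [toC] using this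

theorem reduced_four_ne_zero (h : (frameMatrix L x).det ≠ 0) : reduced L 4 x ≠ 0 := by
  intro h0
  have := cext_reduced_generator h 4
  rw [h0, cext_apply] at this
  simp at this

end

variable {M M' : Patch} {L L' : Base → CVec}

theorem IsBiholEquiv.isGStructureEquiv {H : OpenPartialHomeomorph Amb Amb}
    (hH : IsBiholEquiv M M' H) (hL : M.IsGenerator L) (hL' : M'.IsGenerator L')
    (gL : Good L M.dom) (gL' : Good L' M'.dom) :
    IsGStructureEquiv M M' L L' hH.inducedHomeomorph :=
  ⟨fun _ hx => hx.1, fun _ hx => hx.1, fun _ hx => hH.analyticAt_induced hx,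
    fun _ hx => hH.symm.analyticAt_induced hx,
    fun _ hx => (hH.lineRelated hL hL' gL gL' hx).coframe₀⟩

theorem IsGStructureEquiv.exists_isBiholEquiv {h : OpenPartialHomeomorph Base Base}
    (hh : IsGStructureEquiv M M' L L' h) (hL : M.IsGenerator L) (hL' : M'.IsGenerator L')
    (gL : Good L M.dom) (gL' : Good L' M'.dom) {x : Base} (hx : x ∈ h.source) :
    ∃ H, IsBiholEquiv M M' H ∧ M.param x ∈ H.source ∧
      ∀ᶠ y in 𝓝 x, M'.param (h y) = H (M.param y) := by
  obtain ⟨h1, h2, h3, h4, h5⟩ := hh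
  have hi : Function.Injective (fderiv ℝ h x) :=
    fderiv_injective_of_leftInverse (h3 x hx).differentiableAt
      (h4 _ (h.map_source hx)).differentiableAt (h.eventually_left_inverse hx)
  obtain ⟨H₀, ha, he⟩ := exists_holomorphic_extension hL hL' (h1 hx) (h2 (h.map_source hx))
    (h3 x hx) (by
      filter_upwards [h.open_source.mem_nhds hx] with y hy
      refine mem_span_of_comp (gL'.det_ne _ (h2 (h.map_source hy))) fun i hi => ?_
      -- The last row of a group matrix is zero off the diagonal. Hence all pulled-back coframe
      -- elements except the last kill L, and its image is a multiple of L'.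
      obtain ⟨g, ⟨a, b, c, d, e, -, rfl⟩, hg⟩ := h5 y hy
      rw [← cext_coframe₀, ← cext_comp (h3 y hy).differentiableAt, hg, cext_sum]
      have hc : ∀ j, cext (coframe₀ L j y) (L y) = if j = 4 then 1 else 0 := fun j => by
        rw [cext_coframe₀]; exact comp_frame (gL.det_ne y (h1 hy)) j 4
      simp only [cext_smul, hc]
      fin_cases i <;> simp [groupMatrix] at hi ⊢)
  exact ClassIII.exists_isBiholEquiv (h1 hx) (h2 (h.map_source hx)) (h3 x hx) hi ha he

/-! ### Equivalences of the parallelisms -/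

theorem weight_mul (i : Fin 5) (a b : ℂ) : weight i (a * b) = weight i a * weight i b := by
  fin_cases i <;> simp [weight] <;> ring

theorem forall_fin_seven_sevenForms {p : Tot} {q : Tot} {A : Tot →L[ℝ] Tot}
    (hl : (lam L' q).comp A = lam L p) (hi : ∀ i, (lifted L' i q).comp A = lifted L i p)
    (i : Fin 7) : (sevenForms L' i q).comp A = sevenForms L i p := by
  have hc : ∀ ω ω' : Tot → Tot →L[ℝ] ℂ, (ω' q).comp A = ω p →
      (conjForm ω' q).comp A = conjForm ω p := fun ω ω' h => by
    rw [conjForm, conjForm, ← h]; rfl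
  fin_cases i
  exacts [hc _ _ hl, hl, hc _ _ (hi 1), hi 1, hi 2, hc _ _ (hi 4), hi 4]

theorem lifted_comp_of_sevenForms {p q : Tot} (gL : Good L M.dom) (gL' : Good L' M'.dom)
    (hp : p ∈ M.bundle) (hq : q ∈ M'.bundle) {A : Tot →L[ℝ] Tot}
    (h : ∀ i, (sevenForms L' i q).comp A = sevenForms L i p) (i : Fin 5) :
    (lifted L' i q).comp A = lifted L i p := by
  have h1 : ∀ i : Fin 5, (fiveForms L' i q).comp A = fiveForms L i p := by
    intro i
    fin_cases i
    exacts [h 2, h 3, h 4, h 5, h 6]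
  have := h1 i
  rwa [fiveForms_eq (gL.analytic _ hp.1) (gL.det_ne _ hp.1) p.2,
    fiveForms_eq (gL'.analytic _ hq.1) (gL'.det_ne _ hq.1) q.2] at this

/-! ### The lift of a biholomorphic equivalence to the bundles and its uniqueness. -/

section Lift

variable {H : OpenPartialHomeomorph Amb Amb}

/-- The bundle map covering the map induced by `H`. -/
noncomputable def liftMap (M M' : Patch) (L L' : Base → CVec)
    (H : OpenPartialHomeomorph Amb Amb) (p : Tot) : Tot :=
  (induced M M' H p.1, p.2 * scale (induced M M' H) L L' p.1)

/-- The inverse of the bundle map covering the map induced by `H`. -/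
noncomputable def liftInv (M M' : Patch) (L L' : Base → CVec)
    (H : OpenPartialHomeomorph Amb Amb) (q : Tot) : Tot :=
  (induced M' M H.symm q.1, q.2 / scale (induced M M' H) L L' (induced M' M H.symm q.1))

theorem analyticAt_liftMap (hH : IsBiholEquiv M M' H) (hL : M.IsGenerator L)
    (hL' : M'.IsGenerator L') (gL : Good L M.dom) (gL' : Good L' M'.dom) {p : Tot}
    (hp : p.1 ∈ M.part H.source) : AnalyticAt ℝ (liftMap M M' L L' H) p := by
  have h1 : AnalyticAt ℝ (fun q : Tot => induced M M' H q.1) p :=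
    (hH.analyticAt_induced hp).comp analyticAt_fst
  have h2 : AnalyticAt ℝ (fun q : Tot => scale (induced M M' H) L L' q.1) p :=
    AnalyticAt.comp (g := scale (induced M M' H) L L') (hH.lineRelated hL hL' gL gL' hp).analyticAt_scale analyticAt_fst
  exact h1.prod (analyticAt_snd.mul h2)

theorem analyticAt_liftInv (hH : IsBiholEquiv M M' H) (hL : M.IsGenerator L)
    (hL' : M'.IsGenerator L') (gL : Good L M.dom) (gL' : Good L' M'.dom) {q : Tot}
    (hq : q.1 ∈ M'.part H.target) : AnalyticAt ℝ (liftInv M M' L L' H) q := by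
  have h1 : AnalyticAt ℝ (fun q : Tot => induced M' M H.symm q.1) q :=
    (hH.symm.analyticAt_induced hq).comp analyticAt_fst
  have h3 := hH.lineRelated hL hL' gL gL' (hH.symm.induced_spec hq).1
  have h2 : AnalyticAt ℝ (fun q : Tot => scale (induced M M' H) L L'
      (induced M' M H.symm q.1)) q :=
    AnalyticAt.comp (g := scale (induced M M' H) L L') h3.analyticAt_scale h1
  exact h1.prod (analyticAt_snd.div h2 h3.scale_ne_zero)

/-- The bundle isomorphism covering the map induced by `H`. -/
noncomputable def IsBiholEquiv.lift (hH : IsBiholEquiv M M' H) (hL : M.IsGenerator L)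
    (hL' : M'.IsGenerator L') (gL : Good L M.dom) (gL' : Good L' M'.dom) :
    OpenPartialHomeomorph Tot Tot where
  toFun := liftMap M M' L L' H
  invFun := liftInv M M' L L' H
  source := M.part H.source ×ˢ {a | a ≠ 0}
  target := M'.part H.target ×ˢ {a | a ≠ 0}
  map_source' p hp := ⟨(hH.induced_spec hp.1).1,
    mul_ne_zero hp.2 (hH.lineRelated hL hL' gL gL' hp.1).scale_ne_zero⟩
  map_target' q hq := ⟨(hH.symm.induced_spec hq.1).1,
    div_ne_zero hq.2 (hH.lineRelated hL hL' gL gL' (hH.symm.induced_spec hq.1).1).scale_ne_zero⟩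
  left_inv' p hp := by
    have h1 := hH.induced_induced hp.1
    have h2 := (hH.lineRelated hL hL' gL gL' hp.1).scale_ne_zero
    simp only [liftMap, liftInv, h1, mul_div_cancel_right₀ _ h2]
  right_inv' q hq := by
    have h1 : induced M M' H (induced M' M H.symm q.1) = q.1 := by
      simpa using hH.symm.induced_induced hq.1
    have h2 := (hH.lineRelated hL hL' gL gL' (hH.symm.induced_spec hq.1).1).scale_ne_zero
    simp only [liftMap, liftInv, h1, div_mul_cancel₀ _ h2]
  open_source := (M.isOpen_part H.open_source).prod isOpen_ne
  open_target := (M'.isOpen_part H.open_target).prod isOpen_ne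
  continuousOn_toFun _ hp :=
    (analyticAt_liftMap hH hL hL' gL gL' hp.1).continuousAt.continuousWithinAt
  continuousOn_invFun _ hq :=
    (analyticAt_liftInv hH hL hL' gL gL' hq.1).continuousAt.continuousWithinAt

theorem fderiv_liftMap (hH : IsBiholEquiv M M' H) (hL : M.IsGenerator L)
    (hL' : M'.IsGenerator L') (gL : Good L M.dom) (gL' : Good L' M'.dom) {p : Tot}
    (hp : p.1 ∈ M.part H.source) (X : Tot) : fderiv ℝ (liftMap M M' L L' H) p X =
      (fderiv ℝ (induced M M' H) p.1 X.1, p.2 * fderiv ℝ (scale (induced M M' H) L L') p.1 X.1 +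
        scale (induced M M' H) L L' p.1 * X.2) := by
  have h1 : HasFDerivAt (fun q : Tot => induced M M' H q.1) _ p :=
    (hH.analyticAt_induced hp).differentiableAt.hasFDerivAt.comp p hasFDerivAt_fst
  have h2 : HasFDerivAt (fun q : Tot => scale (induced M M' H) L L' q.1) _ p :=
    HasFDerivAt.comp (g := scale (induced M M' H) L L') p
      (hH.lineRelated hL hL' gL gL' hp).analyticAt_scale.differentiableAt.hasFDerivAt
      hasFDerivAt_fst
  have h3 := h1.prodMk ((hasFDerivAt_snd (p := p)).mul h2)
  exact DFunLike.congr_fun h3.fderiv X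

theorem IsBiholEquiv.isParallelismEquiv_lift (hH : IsBiholEquiv M M' H) (hL : M.IsGenerator L)
    (hL' : M'.IsGenerator L') (gL : Good L M.dom) (gL' : Good L' M'.dom) :
    IsParallelismEquiv M M' L L' (hH.lift hL hL' gL gL') := by
  refine ⟨fun p hp => ⟨hp.1.1, hp.2⟩, fun p hp => ⟨hp.1.1, hp.2⟩,
    fun p hp => analyticAt_liftMap hH hL hL' gL gL' hp.1,
    fun p hp => analyticAt_liftInv hH hL hL' gL gL' hp.1, fun p hp => ?_⟩
  have hr := hH.lineRelated hL hL' gL gL' hp.1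
  have h0 := hr.scale_ne_zero
  have hp0 : p.2 ≠ 0 := hp.2
  refine forall_fin_seven_sevenForms (ContinuousLinearMap.ext fun X => ?_)
    fun i => ContinuousLinearMap.ext fun X => ?_
  · rw [ContinuousLinearMap.comp_apply]
    change lam L' (liftMap M M' L L' H p) (fderiv ℝ (liftMap M M' L L' H) p X) = _
    rw [fderiv_liftMap hH hL hL' gL gL' hp.1, lam_apply, lam_apply]
    simp only [liftMap]
    rw [hr.lamBase]
    field_simp
    ring
  · rw [ContinuousLinearMap.comp_apply]
    change lifted L' i (liftMap M M' L L' H p) (fderiv ℝ (liftMap M M' L L' H) p X) = _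
    rw [fderiv_liftMap hH hL hL' gL gL' hp.1, lifted_eq, lifted_eq]
    simp only [liftMap, _root_.smul_apply, pull_apply, ← hr.reduced i, weight_mul, mul_smul]
    rfl

/-- The base component is forced by injectivity of the embedding. Since ζ is a times a base form,
its preservation at a single vector where that form is nonzero determines the fibre component. -/
theorem IsBiholEquiv.eqOn_lift (hH : IsBiholEquiv M M' H) (hL : M.IsGenerator L)
    (hL' : M'.IsGenerator L') (gL : Good L M.dom) (gL' : Good L' M'.dom)
    {F : OpenPartialHomeomorph Tot Tot} (hF : IsParallelismEquiv M M' L L' F)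
    (hs : F.source ⊆ (hH.lift hL hL' gL gL').source)
    (hc : ∀ p ∈ F.source, M'.param (F p).1 = H (M.param p.1)) :
    Set.EqOn F (hH.lift hL hL' gL gL') F.source := by
  obtain ⟨h1, h2, h3, -, h5⟩ := hF
  have hfst : ∀ p ∈ F.source, (F p).1 = induced M M' H p.1 := fun p hp => by
    obtain ⟨h6, h7⟩ := hH.induced_spec (hs hp).1
    exact M'.injOn_param (h2 (F.map_source hp)).1 h6.1 ((hc p hp).trans h7.symm)
  intro p hp
  refine Prod.ext (hfst p hp) ?_
  have hr := hH.lineRelated hL hL' gL gL' (hs hp).1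
  have h4 := lifted_comp_of_sevenForms gL gL' (h1 hp) (h2 (F.map_source hp)) (h5 p hp) 4
  obtain ⟨v, hv⟩ : ∃ v, reduced L 4 p.1 v ≠ 0 := by
    by_contra! h
    exact reduced_four_ne_zero hr.det_left (ContinuousLinearMap.ext h)
  have hd : (fderiv ℝ F p (v, 0)).1 = fderiv ℝ (induced M M' H) p.1 v := by
    have e1 : HasFDerivAt (fun q : Tot => (F q).1) _ p :=
      (h3 p hp).differentiableAt.hasFDerivAt.fst
    have e2 : HasFDerivAt (fun q : Tot => induced M M' H q.1) _ p :=
      (hH.analyticAt_induced (hs hp).1).differentiableAt.hasFDerivAt.comp p hasFDerivAt_fst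
    exact DFunLike.congr_fun (e1.unique (e2.congr_of_eventuallyEq
      (Filter.eventually_of_mem (F.open_source.mem_nhds hp) hfst))) ((v, 0) : Tot)
  have h6 := DFunLike.congr_fun h4 ((v, 0) : Tot)
  rw [ContinuousLinearMap.comp_apply, lifted_eq, lifted_eq, _root_.smul_apply, _root_.smul_apply,
    pull_apply, pull_apply, hd, hfst p hp] at h6
  have h7 := DFunLike.congr_fun (hr.reduced 4) v
  rw [_root_.smul_apply, ContinuousLinearMap.comp_apply] at h7
  simp only [← h7] at h6 hv
  rw [smul_smul, ← weight_mul] at h6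
  exact mul_right_cancel₀ (right_ne_zero_of_mul hv) h6

end Lift

/-- The five lifted forms vanish on vertical vectors and detect horizontal ones, so F locally
descends to a base map. Preservation of all of them except ζ already makes this map carry the CR
line to the CR line. -/
theorem IsParallelismEquiv.exists_isBiholEquiv {F : OpenPartialHomeomorph Tot Tot}
    (hF : IsParallelismEquiv M M' L L' F) (hL : M.IsGenerator L) (hL' : M'.IsGenerator L')
    (gL : Good L M.dom) (gL' : Good L' M'.dom) {p : Tot} (hp : p ∈ F.source) :
    ∃ H, IsBiholEquiv M M' H ∧ M.param p.1 ∈ H.source ∧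
      ∀ᶠ q in 𝓝 p, M'.param (F q).1 = H (M.param q.1) := by
  obtain ⟨h1, h2, h3, -, h5⟩ := hF
  have key : ∀ q ∈ F.source, ∀ i X, weight i (F q).2 * reduced L' i (F q).1 (fderiv ℝ F q X).1 =
      weight i q.2 * reduced L i q.1 X.1 := fun q hq i X => by
    have := DFunLike.congr_fun
      (lifted_comp_of_sevenForms gL gL' (h1 hq) (h2 (F.map_source hq)) (h5 q hq) i) X
    rwa [ContinuousLinearMap.comp_apply, lifted_eq, lifted_eq] at this
  have hw : ∀ q ∈ F.source, ∀ i, weight i (F q).2 ≠ 0 := fun q hq i =>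
    weight_ne_zero i (h2 (F.map_source hq)).2
  have hvert : ∀ q ∈ F.source, ∀ b : ℂ, (fderiv ℝ F q (0, b)).1 = 0 := fun q hq b =>
    eq_zero_of_reduced (gL'.det_ne _ (h2 (F.map_source hq)).1) fun i => by
      have := key q hq i (0, b)
      rw [map_zero, mul_zero] at this
      exact (mul_eq_zero.1 this).resolve_left (hw q hq i)
  obtain ⟨x, a⟩ := p
  -- The base map is obtained by freezing the fibre coordinate; independence of that choice is
  -- established at the end.
  let h : Base → Base := fun y => (F (y, a)).1
  have hsrc : ∀ᶠ y in 𝓝 x, (y, a) ∈ F.source :=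
    (Continuous.prodMk_left a).continuousAt.preimage_mem_nhds (F.open_source.mem_nhds hp)
  have hha : ∀ y, (y, a) ∈ F.source → AnalyticAt ℝ h y := fun y hy =>
    analyticAt_fst.comp (AnalyticAt.comp (g := F) (h3 _ hy) (analyticAt_id.prod analyticAt_const))
  have hhd : ∀ y, (y, a) ∈ F.source → ∀ v, fderiv ℝ h y v = (fderiv ℝ F (y, a) (v, 0)).1 := by
    intro y hy v
    have e1 : HasFDerivAt (fun y : Base => (y, a)) _ y :=
      (hasFDerivAt_id (𝕜 := ℝ) y).prodMk (hasFDerivAt_const a y)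
    have e2 := ((h3 _ hy).differentiableAt.hasFDerivAt.comp y e1).fst
    exact DFunLike.congr_fun e2.fderiv v
  have hi : Function.Injective (fderiv ℝ h x) := by
    refine (injective_iff_map_eq_zero _).2 fun v hv => ?_
    refine eq_zero_of_reduced (gL.det_ne _ (h1 hp).1) fun i => ?_
    have := key _ hp i (v, 0)
    rw [← hhd x hp, hv, map_zero, mul_zero] at this
    exact (mul_eq_zero.1 this.symm).resolve_left (weight_ne_zero i (h1 hp).2)
  have hspan : ∀ᶠ y in 𝓝 x, push h y (L y) ∈ Submodule.span ℂ {L' (h y)} := by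
    filter_upwards [hsrc] with y hy
    refine mem_span_of_reduced (gL'.det_ne _ (h2 (F.map_source hy)).1) fun i hi => ?_
    have e : weight i (F (y, a)).2 • (reduced L' i (h y)).comp (fderiv ℝ h y) =
        weight i a • reduced L i y := by
      ext v
      have := key _ hy i (v, 0)
      rwa [← hhd y hy] at this
    have e2 := congrArg (fun ω => cext ω (L y)) e
    simp only [cext_smul, cext_comp (hha y hy).differentiableAt,
      cext_reduced_generator (gL.det_ne _ (h1 hy).1), if_neg hi, mul_zero] at e2
    exact (mul_eq_zero.1 e2).resolve_left (hw _ hy i)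
  obtain ⟨H₀, ha, he⟩ := exists_holomorphic_extension hL hL' (h1 hp).1
    (h2 (F.map_source hp)).1 (hha x hp) hspan
  obtain ⟨H, hH, hxH, heH⟩ := ClassIII.exists_isBiholEquiv (h1 hp).1 (h2 (F.map_source hp)).1
    (hha x hp) hi ha he
  refine ⟨H, hH, hxH, ?_⟩
  obtain ⟨ε, h0, hε⟩ := Metric.mem_nhds_iff.1 (F.open_source.mem_nhds hp)
  filter_upwards [Metric.ball_mem_nhds _ h0, continuousAt_fst.eventually heH] with q hq hqH
  rw [← ball_prod_same] at hq hε
  rw [← hqH]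
  congr 1
  -- The vertical derivative of the base component vanishes, so it is constant on a ball in the
  -- fibre and equals its value at the frozen coordinate a.
  have hd : ∀ t ∈ Metric.ball a ε, HasFDerivAt (fun t => (F (q.1, t)).1) (0 : ℂ →L[ℝ] Base) t := by
    intro t ht
    have hqt := hε (show (q.1, t) ∈ _ from ⟨hq.1, ht⟩)
    have e1 : HasFDerivAt (fun t : ℂ => (q.1, t)) _ t :=
      (hasFDerivAt_const q.1 t).prodMk (hasFDerivAt_id (𝕜 := ℝ) t)
    refine (((h3 _ hqt).differentiableAt.hasFDerivAt.comp t e1).fst).congr_fderiv ?_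
    exact ContinuousLinearMap.ext fun b => hvert _ hqt b
  exact (convex_ball a ε).is_const_of_fderivWithin_eq_zero (𝕜 := ℝ)
    (f := fun t => (F (q.1, t)).1)
    (fun t ht => (hd t ht).differentiableAt.differentiableWithinAt) (fun t ht => by
      rw [fderivWithin_of_isOpen Metric.isOpen_ball ht, (hd t ht).fderiv])
    hq.2 (Metric.mem_ball_self h0)

end ClassIII
-- Assembly of the theorem.
theorem theorem3p1 :
    -- the local generators used below exist
    (∀ M : ClassIII.Patch, ∃ L, M.IsGenerator L) ∧
    -- absolute parallelism and structure equations
    (∀ (M : ClassIII.Patch) (L : ClassIII.Base → ClassIII.CVec),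
      M.IsClassIII1 → M.IsGenerator L →
      ClassIII.IsAbsoluteParallelism (ClassIII.sevenForms L) M.bundle ∧
      (∀ p ∈ M.bundle, ClassIII.conjForm (ClassIII.rho L) p = ClassIII.rho L p) ∧
      (∃ (V₁ V₃ : ClassIII.Base → ℂ) (W : Fin 10 → ClassIII.Base → ℂ),
        AnalyticOnNhd ℝ (ClassIII.fnR L) M.dom ∧
        AnalyticOnNhd ℝ V₁ M.dom ∧ AnalyticOnNhd ℝ V₃ M.dom ∧
        (∀ k, AnalyticOnNhd ℝ (W k) M.dom) ∧
        ∀ (x : ClassIII.Base) (a : ℂ), (x, a) ∈ M.bundle →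
          ∀ (σ σb ρ ζ ζb l lb : ClassIII.Tot →L[ℝ] ℂ),
          σ = ClassIII.sigma L (x, a) → σb = ClassIII.conjForm (ClassIII.sigma L) (x, a) →
          ρ = ClassIII.rho L (x, a) →
          ζ = ClassIII.zeta L (x, a) → ζb = ClassIII.conjForm (ClassIII.zeta L) (x, a) →
          l = ClassIII.lam L (x, a) → lb = ClassIII.conjForm (ClassIII.lam L) (x, a) →
          ClassIII.dForm (ClassIII.sigma L) (x, a) =
              ((2 : ℂ) • l + lb) ⋏ σ
              + (a / conj a ^ 2 * conj (ClassIII.fnR L x)) • (σb ⋏ ζb) + ρ ⋏ ζ ∧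
          ClassIII.dForm (ClassIII.rho L) (x, a) =
              (l + lb) ⋏ ρ
              + (1 / (a ^ 2 * conj a ^ 2) * V₁ x) • (σb ⋏ σ)
              + (1 / conj a ^ 2 * V₃ x) • (σb ⋏ ζb)
              + (1 / a ^ 2 * conj (V₃ x)) • (σ ⋏ ζ)
              + Complex.I • (ζ ⋏ ζb) ∧
          ClassIII.dForm (ClassIII.zeta L) (x, a) =
              l ⋏ ζ
              + (1 / (a ^ 2 * conj a ^ 3) * W 0 x) • (σb ⋏ σ)
              + (1 / (a * conj a ^ 3) * W 1 x) • (σb ⋏ ρ)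
              + (1 / conj a ^ 3 * W 2 x) • (σb ⋏ ζb)
              + (1 / (a * conj a ^ 2) * W 3 x) • (σb ⋏ ζ)
              + (1 / (a ^ 2 * conj a ^ 2) * W 4 x) • (σ ⋏ ρ)
              + (1 / (a * conj a ^ 2) * W 5 x) • (σ ⋏ ζb)
              + (1 / (a ^ 2 * conj a) * W 6 x) • (σ ⋏ ζ)
              + (1 / conj a ^ 2 * W 7 x) • (ρ ⋏ ζb)
              + (1 / (a * conj a) * W 8 x) • (ρ ⋏ ζ)
              + (1 / conj a * W 9 x) • (ζb ⋏ ζ)) ∧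
      (∃ J : Fin 5 → Fin 5 → ClassIII.Tot → ℂ,
        (∀ i j, AnalyticOnNhd ℝ (J i j) M.bundle) ∧
        ∀ p ∈ M.bundle, ClassIII.dForm (ClassIII.lam L) p =
          ∑ i, ∑ j ∈ Finset.Ioi i,
            J i j p • (ClassIII.fiveForms L i p ⋏ ClassIII.fiveForms L j p))) ∧
    -- reduction of the equivalence problem
    (∀ (M M' : ClassIII.Patch) (L L' : ClassIII.Base → ClassIII.CVec),
      M.IsClassIII1 → M'.IsClassIII1 → M.IsGenerator L → M'.IsGenerator L' →
      -- every biholomorphic equivalence is an equivalence of the initial G-structures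
      (∀ H, ClassIII.IsBiholEquiv M M' H →
        ∃ h, ClassIII.IsGStructureEquiv M M' L L' h ∧
          h.source = {x | x ∈ M.dom ∧ M.param x ∈ H.source} ∧
          h.target = {x | x ∈ M'.dom ∧ M'.param x ∈ H.target} ∧
          ∀ x ∈ h.source, M'.param (h x) = H (M.param x)) ∧
      -- every equivalence of the initial G-structures is locally a biholomorphic equivalence
      (∀ h, ClassIII.IsGStructureEquiv M M' L L' h → ∀ x ∈ h.source,
        ∃ H, ClassIII.IsBiholEquiv M M' H ∧ M.param x ∈ H.source ∧
          ∀ᶠ y in 𝓝 x, M'.param (h y) = H (M.param y)) ∧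
      -- every biholomorphic equivalence lifts, uniquely and as a bundle map
      (∀ H, ClassIII.IsBiholEquiv M M' H →
        ∃ F, ClassIII.IsParallelismEquiv M M' L L' F ∧
          F.source = {p | p ∈ M.bundle ∧ M.param p.1 ∈ H.source} ∧
          F.target = {p | p ∈ M'.bundle ∧ M'.param p.1 ∈ H.target} ∧
          (∀ p ∈ F.source, M'.param (F p).1 = H (M.param p.1)) ∧
          (∀ p ∈ F.source, ∀ c : ℂ, c ≠ 0 → F (p.1, p.2 * c) = ((F p).1, (F p).2 * c)) ∧
          ∀ F', ClassIII.IsParallelismEquiv M M' L L' F' → F'.source ⊆ F.source →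
            (∀ p ∈ F'.source, M'.param (F' p).1 = H (M.param p.1)) →
            Set.EqOn F' F F'.source) ∧
      -- every equivalence of the parallelisms locally descends
      (∀ F, ClassIII.IsParallelismEquiv M M' L L' F → ∀ p ∈ F.source,
        ∃ H, ClassIII.IsBiholEquiv M M' H ∧ M.param p.1 ∈ H.source ∧
          ∀ᶠ q in 𝓝 p, M'.param (F q).1 = H (M.param q.1))) := by
  refine ⟨fun M => M.exists_generator, fun M L hM hL => ?_, fun M M' L L' hM hM' hL hL' => ?_⟩
  · have gL := hM.good hL
    have an : ∀ x ∈ M.dom, AnalyticAt ℝ L x := gL.analytic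
    refine ⟨ClassIII.isAbsoluteParallelism_sevenForms gL, ?_, ?_, ClassIII.lamCoeff L, ?_, ?_⟩
    · rintro ⟨x, a⟩ ⟨hx, -⟩
      exact ContinuousLinearMap.ext fun X => ClassIII.conj_lifted (an x hx) (gL.det_ne x hx) a 2 X
    · refine ⟨ClassIII.redTorsion L 2 0 1, ClassIII.redTorsion L 2 0 3, ClassIII.zetaCoeff L,
        fun x hx => ClassIII.analyticAt_fnR (an x hx) (gL.det_ne x hx),
        fun x hx => ClassIII.analyticAt_redTorsion (an x hx) (gL.det_ne x hx) 2 0 1,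
        fun x hx => ClassIII.analyticAt_redTorsion (an x hx) (gL.det_ne x hx) 2 0 3,
        fun k x hx => ClassIII.analyticAt_zetaCoeff (an x hx) (gL.det_ne x hx) k, ?_⟩
      rintro x a ⟨hx, ha⟩ σ σb ρ ζ ζb l lb rfl rfl rfl rfl rfl rfl rfl
      have h0 : ClassIII.conjForm (ClassIII.sigma L) (x, a) = ClassIII.lifted L 0 (x, a) :=
        ClassIII.fiveForms_eq (an x hx) (gL.det_ne x hx) a 0
      have h3 : ClassIII.conjForm (ClassIII.zeta L) (x, a) = ClassIII.lifted L 3 (x, a) :=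
        ClassIII.fiveForms_eq (an x hx) (gL.det_ne x hx) a 3
      have hl : ∀ X, ClassIII.conjForm (ClassIII.lam L) (x, a) X =
          conj (ClassIII.lam L (x, a) X) := fun _ => rfl
      rw [h0, h3]
      refine ⟨?_, ?_, ?_⟩ <;> funext X Y
      · rw [ClassIII.dForm_sigma (an x hx) (gL.det_ne x hx) ha]
        simp only [Pi.add_apply, Pi.smul_apply, ClassIII.wedge, _root_.add_apply,
          _root_.smul_apply, smul_eq_mul, hl, ClassIII.sigma, ClassIII.rho, ClassIII.zeta]
      · rw [ClassIII.dForm_rho (an x hx) (gL.det_ne x hx) ha]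
        simp only [Pi.add_apply, Pi.smul_apply, ClassIII.wedge, _root_.add_apply,
          smul_eq_mul, hl, ClassIII.sigma, ClassIII.rho, ClassIII.zeta]
      · rw [ClassIII.dForm_zeta (an x hx) (gL.det_ne x hx) ha]
        simp only [Pi.add_apply, Pi.smul_apply, ClassIII.wedge, smul_eq_mul, ClassIII.sigma,
          ClassIII.rho, ClassIII.zeta]
    · rintro i j ⟨x, a⟩ ⟨hx, ha⟩
      exact ClassIII.analyticAt_lamCoeff (an x hx) (gL.det_ne x hx) ha i j
    · rintro ⟨x, a⟩ ⟨hx, ha⟩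
      funext X Y
      rw [ClassIII.dForm_lam (an x hx) (gL.det_ne x hx) ha]
      simp [ClassIII.fiveForms_eq (an x hx) (gL.det_ne x hx), Finset.sum_apply]
  · have gL := hM.good hL
    have gL' := hM'.good hL'
    refine ⟨fun H hH => ⟨hH.inducedHomeomorph, hH.isGStructureEquiv hL hL' gL gL', rfl, rfl,
        fun x hx => (hH.induced_spec hx).2⟩,
      fun h hh x hx => hh.exists_isBiholEquiv hL hL' gL gL' hx,
      fun H hH => ⟨hH.lift hL hL' gL gL', hH.isParallelismEquiv_lift hL hL' gL gL', ?_, ?_,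
        fun p hp => (hH.induced_spec hp.1).2, fun p _ c _ => ?_,
        fun F hF hs hc => hH.eqOn_lift hL hL' gL gL' hF hs hc⟩,
      fun F hF p hp => hF.exists_isBiholEquiv hL hL' gL gL' hp⟩
    · exact Set.ext fun p => and_right_comm
    · exact Set.ext fun p => and_right_comm
    · exact Prod.ext rfl (mul_right_comm _ _ _)
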